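/- Notation. For $\tau$ in the upper half-plane $\mathbb H$ and $z\in\mathbb C$ put $e(x)=e^{2\pi i x}$, $q=e(\tau)$, $\vartheta(\tau,z)=\sum_{r\in\mathbb Z}\left(\frac{-4}{r}\right)q^{r^2/8}e(rz/2)$, and let $\eta$ be the Dedekind eta function. Let $\underline L=(L,\beta)$ be an integral lattice, i.e. a free $\mathbb Z$-module of finite rank with a nondegenerate symmetric bilinear form $\beta:L\times L\to\mathbb Z$. Write $\beta(x)=\frac12\beta(x,x)$, let $L_{ev}=\{x\in L:\beta(x)\in\mathbb Z\}$ and let $L^\bullet=\{r\in\mathbb Q\otimes L:\beta(x)\equiv\beta(r,x)\bmod\mathbb Z\text{ for all }x\in L\}$. For $k\in\mathbb Q$, $h'\in\mathbb Z$ with $k\equiv h'/2\bmod\mathbb Z$, the space $J_{k,\underline L}(\varepsilon^{h'})$ of Jacobi forms consists of the holomorphic functions $\phi(\tau,z)$ on $\mathbb H\times(\mathbb C\otimes L)$ such that (i) $\phi\left(A\tau,\frac z{c\tau+d}\right)=e\left(\frac{c\,\beta(z)}{c\tau+d}\right)(c\tau+d)^{k-h'/2}\left(\frac{\eta(A\tau)}{\eta(\tau)}\right)^{h'}\phi(\tau,z)$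 for all $A=\begin{pmatrix}a&b\\c&d\end{pmatrix}\in SL(2,\mathbb Z)$; (ii) $\phi(\tau,z+x\tau+y)=e(\beta(x+y))\,e(-\tau\beta(x)-\beta(x,z))\,\phi(\tau,z)$ for all $x,y\in L$; (iii) $\phi$ has an expansion $\phi(\tau,z)=\sum c(n,r)\,q^n e(\beta(r,z))$ over $n\in\frac{h'}{24}+\mathbb Z$ and $r\in L^\bullet$ with $n\ge\beta(r)$. For $m\in\frac12\mathbb Z_{>0}$, $J_{k,m}(\varepsilon^{h'})$ is this space for $L=\mathbb Z$, $\beta(u,v)=2muv$. A theta block is a function $\vartheta(\tau,a_1u)\cdots\vartheta(\tau,a_lu)\,\eta(\tau)^d$ of $(\tau,u)\in\mathbb H\times\mathbb C$ with nonzero integers $a_j$ and $d\in\mathbb Z$. Theorem. Let $R$ be a (reduced, crystallographic) root system spanning a Euclidean space $E$ of dimension $n$, whose inner product $(\cdot,\cdot)$ is invariant under the reflections of $R$; let $R^+$ be a system of positive roots, $F$ its set of simple roots, and $N=|R^+|$. (a) Suppose that $R$ is irreducible, with Weyl group $G$. Let $h=\frac1n\sum_{r\in R^+}(r,r)$, $w=\frac12\sum_{r\in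 R^+}r$, $W=\{x\in E:(x,r)/h\in\mathbb Z\text{ for all }r\in R\}$, $W_{ev}=\{x\in W:(x,x)/2h\in\mathbb Z\}$, and let $\ell(g)$ be the number of $r\in R^+$ such that $gr$ is negative. Then for all $\tau\in\mathbb H$ and $z\in\mathbb C\otimes W$ $$\vartheta_R(\tau,z):=\eta(\tau)^{n-N}\prod_{r\in R^+}\vartheta\left(\tau,\frac{(r,z)}h\right)=\nu\sum_{x\in w+W_{ev}}q^{(x,x)/2h}\sum_{g\in G}(-1)^{\ell(g)}e\left(\frac{(gx,z)}h\right),$$ where $1/\nu$ is the order of the stabilizer $\{g\in G: gw-w\in W_{ev}\}$ of the coset $w+W_{ev}$ in $G$, and the sum over $x$ converges absolutely. (These are the Macdonald identities.) Moreover $\underline R=(W,(\cdot,\cdot)/h)$ is an integral lattice, and $\vartheta_R\in J_{n/2,\underline R}(\varepsilon^{n+2N})$. For every nonzero $x\in W$ the function $(\tau,u)\mapsto\vartheta_R(\tau,ux)$ lies in $J_{n/2,(x,x)/2h}(\varepsilon^{n+2N})$, and it is a theta block if $(r,x)\ne0$ for all $r\in R$. (b) Let $R$ be arbitrary (not necessarily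 irreducible), and write $r=\sum_{f\in F}\gamma_{r,f}f$ with integers $\gamma_{r,f}$ for $r\in R^+$. Let $\underline R$ be the lattice $\mathbb Z^F$ with quadratic form $Q(z)=\frac12\sum_{r\in R^+}\left(\sum_f\gamma_{r,f}z_f\right)^2$. Then $$\vartheta_R(\tau,z):=\eta(\tau)^{n-N}\prod_{r\in R^+}\vartheta\Big(\tau,\sum_{f\in F}\gamma_{r,f}z_f\Big)\qquad(z\in\mathbb C^F)$$ belongs to $J_{n/2,\underline R}(\varepsilon^{n+2N})$. For every nonzero $a\in\mathbb Z^F$ the function $(\tau,u)\mapsto\vartheta_R(\tau,ua)$ lies in $J_{n/2,Q(a)}(\varepsilon^{n+2N})$, and it is a theta block if $\sum_f\gamma_{r,f}a_f\ne0$ for all $r\in R^+$. -/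

import Mathlib

open scoped TensorProduct
open UpperHalfPlane (ofComplex)

noncomputable section

namespace ThetaBlocks

/-! ### The basic functions -/

/-- `e(x) = exp(2πix)`. -/
def e (x : ℂ) : ℂ := Complex.exp (2 * Real.pi * Complex.I * x)

/-- The Jacobi theta function `ϑ(τ,z) = ∑_{r ∈ ℤ} (-4/r) q^{r²/8} ζ^{r/2}`, `q = e(τ)`, `ζ = e(z)`.
The Kronecker symbol `(-4/·)` is the nontrivial Dirichlet character modulo `4`. -/
def theta (τ : UpperHalfPlane) (z : ℂ) : ℂ :=
  ∑' r : ℤ, (ZMod.χ₄ (r : ZMod 4) : ℂ) * e ((τ : ℂ) * ((r : ℂ) ^ 2 / 8)) * e ((r : ℂ) / 2 * z)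

/-- The Dedekind eta function on the upper half-plane. -/
def eta (τ : UpperHalfPlane) : ℂ := ModularForm.eta (τ : ℂ)

/-! ### Jacobi forms of lattice index

An integral lattice `(L, β)` is given inside its complexification: `V = ℂ ⊗ L` is a complex vector
space, `L ⊆ V` is the subgroup generated by some `ℂ`-basis of `V`, and `β` is (the `ℂ`-bilinear
extension of) the form of the lattice.  The associated quadratic form is `β(x) = β(x,x)/2`. -/

section Lattice

variable {V : Type*} [AddCommGroup V] [Module ℂ V]

/-- `(L, β)` is an integral lattice with `ℂ ⊗ L = V`: `L` is free on a `ℂ`-basis of `V`, and `β` is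
symmetric, nondegenerate and integer valued on `L`. -/
structure IsIntegralLattice (L : AddSubgroup V) (β : LinearMap.BilinForm ℂ V) : Prop where
  exists_basis : ∃ (m : ℕ) (v : Module.Basis (Fin m) ℂ V), L = AddSubgroup.closure (Set.range v)
  symm : ∀ x y, β x y = β y x
  nondegenerate : ∀ x, (∀ y, β x y = 0) → x = 0
  integral : ∀ x ∈ L, ∀ y ∈ L, ∃ m : ℤ, β x y = m

/-- The shadow `L^•` of `(L, β)`: all `r ∈ ℚ ⊗ L` with `β(x) ≡ β(r,x) mod ℤ` for all `x ∈ L`. -/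
def shadow (L : AddSubgroup V) (β : LinearMap.BilinForm ℂ V) : Set V :=
  {r | (∃ m : ℕ, 0 < m ∧ m • r ∈ L) ∧ ∀ x ∈ L, ∃ m : ℤ, β x x / 2 - β r x = m}

/-- `φ` is a Jacobi form of weight `k`, index `(L, β)` and character `ε^h`, where `ε` is the
multiplier system of the eta function, i.e. `ε^h(A) = (η(Aτ)/η(τ))^h`, an element of
`J_{k,L}(ε^h)`.  (`β` takes rational values on the shadow, so that `.re` in the last field does not
lose anything.) -/
structure IsJacobiForm (L : AddSubgroup V) (β : LinearMap.BilinForm ℂ V) (k : ℚ) (h : ℤ)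
    (φ : UpperHalfPlane → V → ℂ) : Prop where
  lattice : IsIntegralLattice L β
  /-- `φ` is holomorphic on the product of the upper half-plane and `V`
  (in arbitrary linear coordinates on `V`). -/
  holomorphic : ∀ (m : ℕ) (u : (Fin m → ℂ) →ₗ[ℂ] V),
    DifferentiableOn ℂ (fun p : ℂ × (Fin m → ℂ) => φ (ofComplex p.1) (u p.2)) {p | 0 < p.1.im}
  /-- Modular transformation law; the weight must satisfy `k ≡ h/2 mod ℤ`. -/
  modular : ∃ l : ℤ, (l : ℚ) = k - (h : ℚ) / 2 ∧
    ∀ (A : Matrix.SpecialLinearGroup (Fin 2) ℤ) (τ : UpperHalfPlane) (z : V),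
      φ (A • τ) (((A 1 0 : ℂ) * (τ : ℂ) + (A 1 1 : ℂ))⁻¹ • z) =
        e ((A 1 0 : ℂ) * (β z z / 2) / ((A 1 0 : ℂ) * (τ : ℂ) + (A 1 1 : ℂ))) *
          ((A 1 0 : ℂ) * (τ : ℂ) + (A 1 1 : ℂ)) ^ l * (eta (A • τ) / eta τ) ^ h * φ τ z
  /-- Elliptic transformation law. -/
  elliptic : ∀ x ∈ L, ∀ y ∈ L, ∀ (τ : UpperHalfPlane) (z : V),
    φ τ (z + (τ : ℂ) • x + y) =
      e (β (x + y) (x + y) / 2) * e (-(τ : ℂ) * (β x x / 2) - β x z) * φ τ z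
  /-- Fourier expansion `∑ c(n,r) q^n e(β(r,z))` over `n ∈ h/24 + ℤ` and `r` in the shadow with
  `n ≥ β(r)`; the pair `(j, r)` stands for `n = h/24 + j`. -/
  fourier : ∃ c : ℤ → V → ℂ, ∀ (τ : UpperHalfPlane) (z : V),
    HasSum
      (fun p : {p : ℤ × V //
          p.2 ∈ shadow L β ∧ (β p.2 p.2).re / 2 ≤ (h : ℝ) / 24 + (p.1 : ℝ)} =>
        c p.1.1 p.1.2 * e (((h : ℂ) / 24 + (p.1.1 : ℂ)) * (τ : ℂ)) * e (β p.1.2 z))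
      (φ τ z)

end Lattice

/-- The lattice `ℤ^F` inside `ℂ^F`. -/
def intLattice (F : Type*) : AddSubgroup (F → ℂ) :=
  ((Int.castAddHom ℂ).compLeft F).range

/-- `φ` belongs to `J_{k,m}(ε^h)`: a Jacobi form in one variable of weight `k`, index `m` and
character `ε^h`, i.e. a Jacobi form whose index is `ℤ` with the bilinear form `(u,v) ↦ 2muv`. -/
def IsScalarJacobiForm (k : ℚ) (m : ℝ) (h : ℤ) (φ : UpperHalfPlane → ℂ → ℂ) : Prop :=
  IsJacobiForm (Int.castAddHom ℂ).range ((2 * (m : ℂ)) • LinearMap.mul ℂ ℂ) k h φ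

/-- `φ` is a theta block: `φ(τ,u) = ϑ(τ,a₁u) ⋯ ϑ(τ,a_lu) η(τ)^d` with nonzero integers `a_j` and an
integer `d`. -/
def IsThetaBlock (φ : UpperHalfPlane → ℂ → ℂ) : Prop :=
  ∃ (s : List ℤ) (d : ℤ), (∀ a ∈ s, a ≠ 0) ∧
    ∀ τ u, φ τ u = (s.map fun a => theta τ ((a : ℂ) * u)).prod * eta τ ^ d

/-! ### Root systems -/

section Root

variable {ι E M : Type*} [Fintype ι] [NormedAddCommGroup E] [InnerProductSpace ℝ E]
  [AddCommGroup M] [Module ℝ M] {P : RootPairing ι ℝ E M}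

/-- (Indices of) the positive roots `R⁺` with respect to a base. -/
def posRoots (b : P.Base) : Finset ι := by
  classical exact Finset.univ.filter fun i => b.IsPos i

/-- The integers `γ_{r,f}` with `r = ∑_f γ_{r,f} f`, the sum being over the simple roots `f`. -/
def rootCoeff (b : P.Base) (r : ι) (f : b.support) : ℤ :=
  (b.exists_root_eq_sum_int r).choose f

theorem root_eq_sum_rootCoeff (b : P.Base) (r : ι) :
    P.root r = ∑ f : b.support, rootCoeff b r f • P.root f := by
  change P.root r = ∑ f : b.support, (b.exists_root_eq_sum_int r).choose (f : ι) • P.root f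
  rw [Finset.sum_coe_sort b.support
    (fun j => (b.exists_root_eq_sum_int r).choose j • P.root j)]
  exact (b.exists_root_eq_sum_int r).choose_spec.2.2

/-- The linear form `z ↦ ∑_f γ_{r,f} z_f` on `ℂ^F`. -/
def rootForm (b : P.Base) (r : ι) : (b.support → ℂ) →ₗ[ℂ] ℂ :=
  ∑ f : b.support, (rootCoeff b r f : ℂ) • LinearMap.proj f

/-- The bilinear form of the lattice `R = (ℤ^F, Q)`, `Q(z) = ½ ∑_{r ∈ R⁺} (∑_f γ_{r,f} z_f)²`. -/
def starForm (b : P.Base) : LinearMap.BilinForm ℂ (b.support → ℂ) :=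
  ∑ r ∈ posRoots b, LinearMap.BilinForm.linMulLin (rootForm b r) (rootForm b r)

/-- `ϑ_R(τ,z) = η(τ)^{n-|R⁺|} ∏_{r ∈ R⁺} ϑ(τ, ∑_f γ_{r,f} z_f)` for `z ∈ ℂ^F`. -/
def rootTheta (b : P.Base) (τ : UpperHalfPlane) (z : b.support → ℂ) : ℂ :=
  eta τ ^ ((Module.finrank ℝ E : ℤ) - ((posRoots b).card : ℤ)) *
    ∏ r ∈ posRoots b, theta τ (rootForm b r z)

/-- `h = (1/n) ∑_{r ∈ R⁺} (r,r)`. -/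
def hNumber (b : P.Base) : ℝ :=
  (∑ r ∈ posRoots b, inner ℝ (P.root r) (P.root r)) / (Module.finrank ℝ E : ℝ)

/-- The Weyl vector `w`, half the sum of the positive roots. -/
def weylVector (b : P.Base) : E := (1 / 2 : ℝ) • ∑ r ∈ posRoots b, P.root r

/-- `W = {x ∈ E : (x,r)/h ∈ ℤ for all roots r}`. -/
def latticeW (b : P.Base) : AddSubgroup E where
  carrier := {x | ∀ r, ∃ m : ℤ, inner ℝ x (P.root r) / hNumber b = m}
  zero_mem' := fun r => ⟨0, by simp⟩
  add_mem' := by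
    intro x y hx hy r
    obtain ⟨m, hm⟩ := hx r
    obtain ⟨m', hm'⟩ := hy r
    exact ⟨m + m', by rw [inner_add_left, add_div, hm, hm']; push_cast; rfl⟩
  neg_mem' := by
    intro x hx r
    obtain ⟨m, hm⟩ := hx r
    exact ⟨-m, by rw [inner_neg_left, neg_div, hm]; push_cast; rfl⟩

/-- The even sublattice `W_ev` of `(W, (·,·)/h)`: the `x ∈ W` with `(x,x)/2h ∈ ℤ`. -/
def latticeWev (b : P.Base) : Set E :=
  {x | x ∈ latticeW b ∧ ∃ m : ℤ, inner ℝ x x / (2 * hNumber b) = m}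

/-- The subgroup `W = 1 ⊗ W` of `ℂ ⊗ W = ℂ ⊗ E`. -/
def latticeWC (b : P.Base) : AddSubgroup (ℂ ⊗[ℝ] E) :=
  (latticeW b).map (TensorProduct.mk ℝ ℂ E 1).toAddMonoidHom

/-- The `ℂ`-bilinear extension of `(·,·)/h` to `ℂ ⊗ E`. -/
def scaledForm (b : P.Base) : LinearMap.BilinForm ℂ (ℂ ⊗[ℝ] E) :=
  LinearMap.BilinForm.baseChange ℂ ((hNumber b)⁻¹ • innerₗ E)

/-- `ϑ_R(τ,z) = η(τ)^{n-N} ∏_{r ∈ R⁺} ϑ(τ, (r,z)/h)` for `z ∈ ℂ ⊗ W`. -/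
def macdonaldTheta (b : P.Base) (τ : UpperHalfPlane) (z : ℂ ⊗[ℝ] E) : ℂ :=
  eta τ ^ ((Module.finrank ℝ E : ℤ) - ((posRoots b).card : ℤ)) *
    ∏ r ∈ posRoots b, theta τ (scaledForm b ((1 : ℂ) ⊗ₜ[ℝ] P.root r) z)

/-- The Weyl group of a root system is finite. -/
theorem finite_weylGroup (P : RootPairing ι ℝ E M) [P.IsRootSystem] : Finite P.weylGroup := by
  refine Finite.of_injective (fun g : P.weylGroup => RootPairing.Equiv.indexHom P g.1) ?_
  intro g g' hgg
  apply Subtype.ext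
  apply RootPairing.Equiv.weightHom_injective P
  apply LinearEquiv.toLinearMap_injective
  refine LinearMap.ext_on_range (v := P.root) (RootPairing.IsRootSystem.span_root_eq_top) ?_
  intro i
  have h1 := P.weylGroup_apply_root g i
  have h2 := P.weylGroup_apply_root g' i
  have h3 : P.weylGroupToPerm g i = P.weylGroupToPerm g' i := congrArg (fun σ => σ i) hgg
  rw [h3, ← h2] at h1
  exact h1

instance fintypeWeylGroup (P : RootPairing ι ℝ E M) [P.IsRootSystem] : Fintype P.weylGroup :=
  haveI := finite_weylGroup P
  Fintype.ofFinite _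

/-- The length `ℓ(g)`: the number of positive roots `r` such that `gr` is negative. -/
def weylLength (b : P.Base) (g : P.weylGroup) : ℕ := by
  classical exact ((posRoots b).filter fun r => ¬ b.IsPos (P.weylGroupToPerm g r)).card

/-- The stabilizer in the Weyl group of the coset `w + W_ev`. -/
def weylStabilizer (b : P.Base) : Set P.weylGroup :=
  {g | g • weylVector b - weylVector b ∈ latticeWev b}

end Root

end ThetaBlocks

end

open ThetaBlocks

/-! ### The theta series and its termwise derivatives -/

noncomputable section

namespace ThetaBlocks

open Complex Filter Topology

/-! Everything is governed by a "canonical" form `D` on `E`: positive definite, Weyl invariant, with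
∑ D(x,r) r = x over the positive roots. It is (·,·)/h when R is irreducible
(`isCanonicalForm_inner`), and (T⁻¹x, y) with Tx = ∑ (x,r) r in general (`exists_isCanonicalForm`).
Since ∑ D(z,r)² = D(z,z), the product of the ϑ(τ, D(r,z)) inherits modular and elliptic
transformation laws from a single ϑ, and the lattice is the dual {x : D(x,r) ∈ ℤ} of the root
lattice. What remains is the condition n ≥ β(r) on the Fourier expansion, and this follows from the
Macdonald identity.

Multiply out the theta series and collect the terms with the same x = ½ ∑ r_i α_i. The product
becomes ∑_x f_x(τ) q^{D(x,x)/2} e(D(x,z)), with f_x = `fiberCoeff b D 0 x`. The f_x are alternating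
under the Weyl group, unchanged when x moves by an even lattice vector, and zero unless x is a
weight. Hence f_x = 0 when x lies on a wall ⟨x,r^∨⟩ ∈ m_r ℤ, where m_r = 2/D(r,r). The Weyl vector ρ
is the only weight with 0 < ⟨x,r^∨⟩ < m_r for all positive r (`eq_weylVector_of_mem_alcove`), so the
Weyl group and even translations carry every weight to ρ or onto a wall (`exists_smul_add_eq`). Thus
every f_x is a constant multiple of f_ρ (`exists_fiberCoeff_eq_mul`).

The function f_ρ is found from the heat equation. The heat operator multiplies the x-th term by the
logarithmic derivative of f_x, which does not depend on x wherever f_x is nonzero; so it acts on the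
whole product as multiplication by a function of τ. Letting z = tρ with t → 0 evaluates that
function in terms of ϑ'''(τ,0)/ϑ'(τ,0) (`fiberCoeff_one_weylVector`), and Jacobi's identity ϑ'(τ,0)
= 2πi η³ turns the answer into f_ρ' = (N−n)(η'/η) f_ρ. So f_ρ η^{n−N} is constant. Its behaviour at
i∞ shows that the constant is 1 and yields the strange formula D(ρ,ρ)/2 = (n+2N)/24
(`fiberCoeff_weylVector_mul`).

Regrouping along Weyl orbits gives the Macdonald identity (`hasSum_macdonaldTheta`). All terms have
exponent exactly β(r), so the Fourier condition holds with equality. Restricting to the line through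
a lattice vector preserves it by the Cauchy–Schwarz inequality. -/

lemma e_add (x y : ℂ) : e (x + y) = e x * e y := by
  simp [e, mul_add, Complex.exp_add]

lemma e_zero : e 0 = 1 := by simp [e]

lemma e_ne_zero (x : ℂ) : e x ≠ 0 := Complex.exp_ne_zero _

lemma e_intCast (n : ℤ) : e (n : ℂ) = 1 := by
  rw [e, mul_comm]; exact Complex.exp_int_mul_two_pi_mul_I n

lemma e_half_intCast (n : ℤ) : e ((n : ℂ) / 2) = (-1) ^ n := by
  rw [e, show (2 * Real.pi * I * ((n : ℂ) / 2)) = n * (Real.pi * I) by ring,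
    Complex.exp_int_mul, Complex.exp_pi_mul_I]

lemma e_sum {α : Type*} (s : Finset α) (f : α → ℂ) : e (∑ i ∈ s, f i) = ∏ i ∈ s, e (f i) := by
  simp [e, Finset.mul_sum, Complex.exp_sum]

lemma norm_e (x : ℂ) : ‖e x‖ = Real.exp (-(2 * Real.pi * x.im)) := by
  rw [e, Complex.norm_exp]
  congr 1
  rw [show (2 * Real.pi * I * x : ℂ) = ((2 * Real.pi : ℝ) : ℂ) * x * I by push_cast; ring,
    mul_I_re, im_ofReal_mul]

lemma hasDerivAt_e_mul (a x : ℂ) :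
    HasDerivAt (fun x => e (a * x)) (2 * Real.pi * I * a * e (a * x)) x := by
  have h : HasDerivAt (fun x : ℂ => 2 * Real.pi * I * (a * x)) (2 * Real.pi * I * a) x := by
    simpa [mul_assoc] using ((hasDerivAt_id x).const_mul a).const_mul (2 * Real.pi * I)
  simpa [e, mul_comm] using h.cexp

/-- The terms of the theta series with an extra factor `r ^ k`. -/
def thetaTerm (k : ℕ) (τ z : ℂ) (r : ℤ) : ℂ :=
  (r : ℂ) ^ k * ((ZMod.χ₄ (r : ZMod 4) : ℂ) * e (τ * ((r : ℂ) ^ 2 / 8)) * e ((r : ℂ) / 2 * z))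

/-- The theta series with an extra factor `r ^ k`. -/
def thetaDer (k : ℕ) (τ z : ℂ) : ℂ := ∑' r : ℤ, thetaTerm k τ z r

lemma theta_eq_thetaDer (τ : UpperHalfPlane) (z : ℂ) : theta τ z = thetaDer 0 τ z := by
  simp [theta, thetaDer, thetaTerm]

lemma norm_chi_le (r : ℤ) : ‖(ZMod.χ₄ (r : ZMod 4) : ℂ)‖ ≤ 1 := by
  generalize (r : ZMod 4) = a
  have : ZMod.χ₄ a = 0 ∨ ZMod.χ₄ a = 1 ∨ ZMod.χ₄ a = -1 := by revert a; decide
  rcases this with h | h | h <;> simp [h]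

/-- A summable bound for the terms of the theta series. -/
def thetaBound (k : ℕ) (T S : ℝ) (r : ℤ) : ℝ :=
  (|(r : ℝ)| ^ k) * Real.exp (-Real.pi * (T / 4 * r ^ 2 - 2 * (S / 2) * |(r : ℝ)|))

lemma summable_thetaBound (k : ℕ) {T : ℝ} (hT : 0 < T) (S : ℝ) : Summable (thetaBound k T S) := by
  have h := summable_pow_mul_jacobiTheta₂_term_bound (S / 2) (T := T / 4) (by positivity) k
  simp only [Int.cast_abs] at h
  exact h

lemma norm_thetaTerm_le (k : ℕ) {T S : ℝ} {τ z : ℂ} (hτ : T ≤ τ.im) (hz : |z.im| ≤ S) (r : ℤ) :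
    ‖thetaTerm k τ z r‖ ≤ thetaBound k T S r := by
  rw [thetaTerm, norm_mul, norm_mul, norm_mul, norm_pow, norm_e, norm_e, thetaBound]
  have hr : ‖(r : ℂ)‖ = |(r : ℝ)| := by
    rw [← Complex.ofReal_intCast, Complex.norm_real, Real.norm_eq_abs]
  rw [hr]
  refine mul_le_mul_of_nonneg_left ?_ (by positivity)
  have h1 := norm_chi_le r
  have him1 : (τ * ((r : ℂ) ^ 2 / 8)).im = τ.im * ((r : ℝ) ^ 2 / 8) := by
    rw [show (r : ℂ) ^ 2 / 8 = (((r : ℝ) ^ 2 / 8 : ℝ) : ℂ) by push_cast; rfl, im_mul_ofReal]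
  have him2 : ((r : ℂ) / 2 * z).im = (r : ℝ) / 2 * z.im := by
    rw [show (r : ℂ) / 2 = (((r : ℝ) / 2 : ℝ) : ℂ) by push_cast; rfl, im_ofReal_mul]
  rw [him1, him2, mul_assoc, ← Real.exp_add]
  calc _ ≤ 1 * Real.exp (-(2 * Real.pi * (τ.im * ((r : ℝ) ^ 2 / 8))) +
        -(2 * Real.pi * ((r : ℝ) / 2 * z.im))) := by gcongr
    _ ≤ _ := by
      rw [one_mul, Real.exp_le_exp]
      have h2 : -(|(r : ℝ)| * S) ≤ (r : ℝ) * z.im := by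
        have : |(r : ℝ) * z.im| ≤ |(r : ℝ)| * S := by rw [abs_mul]; gcongr
        linarith [neg_abs_le ((r : ℝ) * z.im)]
      have h3 : T * (r : ℝ) ^ 2 ≤ τ.im * (r : ℝ) ^ 2 := by gcongr
      nlinarith [Real.pi_pos, mul_le_mul_of_nonneg_left h2 Real.pi_pos.le,
        mul_le_mul_of_nonneg_left h3 Real.pi_pos.le]

lemma summable_thetaTerm (k : ℕ) {τ : ℂ} (hτ : 0 < τ.im) (z : ℂ) :
    Summable fun r => ‖thetaTerm k τ z r‖ :=
  .of_nonneg_of_le (fun _ => norm_nonneg _) (norm_thetaTerm_le k le_rfl le_rfl)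
    (summable_thetaBound k hτ _)

/-- Termwise differentiation of a series of holomorphic functions. -/
lemma hasDerivAt_tsum_of_norm_le {α : Type*} {U : Set ℂ} (hU : IsOpen U) {u : α → ℝ}
    (hu : Summable u) {F F' : α → ℂ → ℂ} (hF : ∀ i, ∀ w ∈ U, HasDerivAt (F i) (F' i w) w)
    (hle : ∀ i, ∀ w ∈ U, ‖F i w‖ ≤ u i) {w : ℂ} (hw : w ∈ U) :
    HasDerivAt (fun w => ∑' i, F i w) (∑' i, F' i w) w := by
  have hd : ∀ i, DifferentiableOn ℂ (F i) U := fun i w hw =>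
    (hF i w hw).differentiableAt.differentiableWithinAt
  have h1 := differentiableOn_tsum_of_summable_norm hu hd hU hle
  have h2 := Complex.hasSum_deriv_of_summable_norm hu hd hU hle hw
  have h3 := (h1.differentiableAt (hU.mem_nhds hw)).hasDerivAt
  rw [← h2.tsum_eq] at h3
  simpa [(hF _ w hw).deriv] using h3

lemma hasDerivAt_thetaDer_right (k : ℕ) {τ : ℂ} (hτ : 0 < τ.im) (z : ℂ) :
    HasDerivAt (thetaDer k τ) (Real.pi * I * thetaDer (k + 1) τ z) z := by
  have hU : IsOpen {w : ℂ | |w.im| < |z.im| + 1} :=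
    (continuous_abs.comp continuous_im).isOpen_preimage _ isOpen_Iio
  have := hasDerivAt_tsum_of_norm_le hU (summable_thetaBound k hτ (|z.im| + 1))
    (F := fun r w => thetaTerm k τ w r) (F' := fun r w => Real.pi * I * thetaTerm (k + 1) τ w r)
    (fun r w _ => ?_) (fun r w hw => norm_thetaTerm_le k le_rfl (le_of_lt hw) r)
    (w := z) (by simp)
  · rw [tsum_mul_left] at this
    exact this
  · refine (((hasDerivAt_e_mul _ w).const_mul _).const_mul _).congr_deriv ?_
    rw [thetaTerm]; ring

/-- Differentiation in `z` multiplies a term by πi r, and in `τ` by πi r²/4. Together with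
`hasDerivAt_thetaDer_right` this is the heat equation 4πi ∂_τ = ∂_z². -/
lemma hasDerivAt_thetaDer_left (k : ℕ) {τ : ℂ} (hτ : 0 < τ.im) (z : ℂ) :
    HasDerivAt (fun τ => thetaDer k τ z) (Real.pi * I / 4 * thetaDer (k + 2) τ z) τ := by
  have hU : IsOpen {w : ℂ | τ.im / 2 < w.im} := continuous_im.isOpen_preimage _ isOpen_Ioi
  have := hasDerivAt_tsum_of_norm_le hU (summable_thetaBound k (half_pos hτ) |z.im|)
    (F := fun r w => thetaTerm k w z r)
    (F' := fun r w => Real.pi * I / 4 * thetaTerm (k + 2) w z r)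
    (fun r w _ => ?_) (fun r w hw => norm_thetaTerm_le k (le_of_lt hw) le_rfl r)
    (w := τ) (by simpa using half_lt_self hτ)
  · rw [tsum_mul_left] at this
    exact this
  · have h := ((((hasDerivAt_e_mul ((r : ℂ) ^ 2 / 8) w).const_mul
      (ZMod.χ₄ (r : ZMod 4) : ℂ)).mul_const (e ((r : ℂ) / 2 * z))).const_mul ((r : ℂ) ^ k))
    simp only [mul_comm ((r : ℂ) ^ 2 / 8)] at h
    refine h.congr_deriv ?_
    rw [thetaTerm]; ring

lemma chi_neg (r : ℤ) : ZMod.χ₄ ((-r : ℤ) : ZMod 4) = -ZMod.χ₄ (r : ZMod 4) := by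
  push_cast
  generalize (r : ZMod 4) = a
  revert a; decide

lemma chi_add_two_mul (r m : ℤ) :
    ZMod.χ₄ ((r + 2 * m : ℤ) : ZMod 4) = (-1) ^ m.natAbs * ZMod.χ₄ (r : ZMod 4) := by
  have key : ∀ a : ZMod 4, ZMod.χ₄ (a + 2) = -ZMod.χ₄ a := by decide
  have h4 : (4 : ZMod 4) = 0 := by decide
  push_cast
  rcases Int.even_or_odd m with h | h
  · obtain ⟨k, rfl⟩ := h
    rw [(Int.natAbs_even.2 ⟨k, rfl⟩).neg_one_pow, one_mul]
    congr 1
    push_cast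
    linear_combination (k : ZMod 4) * h4
  · obtain ⟨k, hk⟩ := h
    rw [(Int.natAbs_odd.2 ⟨k, hk⟩).neg_one_pow, neg_one_mul, ← key, hk]
    congr 1
    push_cast
    linear_combination (k : ZMod 4) * h4

lemma thetaTerm_neg (k : ℕ) (τ z : ℂ) (r : ℤ) :
    thetaTerm k τ (-z) (-r) = (-1) ^ (k + 1) * thetaTerm k τ z r := by
  simp only [thetaTerm, chi_neg]
  push_cast
  rw [neg_pow (r : ℂ), neg_sq, show (-(r : ℂ) / 2 * -z) = (r : ℂ) / 2 * z by ring]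
  ring

lemma thetaDer_neg (k : ℕ) (τ z : ℂ) :
    thetaDer k τ (-z) = (-1) ^ (k + 1) * thetaDer k τ z := by
  rw [thetaDer, thetaDer, ← tsum_mul_left, ← (Equiv.neg ℤ).tsum_eq]
  exact tsum_congr fun r => thetaTerm_neg k τ z r

lemma thetaDer_zero_of_even {k : ℕ} (hk : Even k) (τ : ℂ) : thetaDer k τ 0 = 0 := by
  have := thetaDer_neg k τ 0
  rw [neg_zero, hk.add_one.neg_one_pow] at this
  linear_combination this / 2

end ThetaBlocks
end

/-! ### Theta under lattice translations, τ ↦ τ + 1 and τ ↦ −1/τ -/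

noncomputable section

namespace ThetaBlocks

open Complex Filter Topology

lemma thetaTerm_eq_zero_of_even {r : ℤ} (hr : Even r) (k : ℕ) (τ z : ℂ) :
    thetaTerm k τ z r = 0 := by
  have : ZMod.χ₄ (r : ZMod 4) = 0 := by
    rw [ZMod.χ₄_int_eq_if_mod_four]
    simp [Int.even_iff.1 hr]
  simp [thetaTerm, this]

lemma chi_two_mul_add_one (n : ℤ) : ZMod.χ₄ ((2 * n + 1 : ℤ) : ZMod 4) = (-1) ^ n.natAbs := by
  rw [add_comm, chi_add_two_mul]
  simp

lemma neg_one_pow_natAbs (n : ℤ) : ((-1 : ℂ)) ^ n.natAbs = (-1) ^ n := by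
  obtain ⟨k, rfl | rfl⟩ := n.eq_nat_or_neg <;> simp [← inv_pow]

/-- Only odd r = 2n + 1 contribute. The sign (−1)^n is absorbed by the shift of the argument by 1/2,
and the cross term of (2n+1)² by the shift by τ/2. -/
lemma thetaDer_eq_jacobiTheta₂ (τ z : ℂ) :
    thetaDer 0 τ z = e (τ / 8) * e (z / 2) * jacobiTheta₂ (z + τ / 2 + 1 / 2) τ := by
  have hinj : Function.Injective fun n : ℤ => 2 * n + 1 := fun a b h => by
    simpa using h
  have hsupp : Function.support (thetaTerm 0 τ z) ⊆ Set.range fun n : ℤ => 2 * n + 1 := by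
    intro r hr
    rcases Int.even_or_odd r with h | ⟨k, hk⟩
    · exact absurd (thetaTerm_eq_zero_of_even h 0 τ z) hr
    · exact ⟨k, hk.symm⟩
  rw [thetaDer, ← hinj.tsum_eq hsupp, jacobiTheta₂, ← tsum_mul_left]
  refine tsum_congr fun n => ?_
  rw [thetaTerm, chi_two_mul_add_one, jacobiTheta₂_term]
  have h1 : (((-1) ^ n.natAbs : ℤ) : ℂ) = e ((n : ℂ) / 2) := by
    rw [e_half_intCast, ← neg_one_pow_natAbs]; push_cast; rfl
  rw [h1, pow_zero, one_mul]
  simp only [e, ← Complex.exp_add]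
  congr 1
  push_cast
  ring

/-- Completing the square in the exponent amounts to r ↦ r + 2m. The character contributes (−1)^m,
and e(rn/2) = (−1)^n because r is odd. -/
lemma thetaTerm_add_lattice (τ z : ℂ) (m n r : ℤ) :
    thetaTerm 0 τ (z + m * τ + n) r =
      (-1) ^ (m + n) * e (-(τ * (m ^ 2 / 2)) - m * z) * thetaTerm 0 τ z (r + 2 * m) := by
  simp only [thetaTerm, chi_add_two_mul, pow_zero, one_mul]
  push_cast
  rw [neg_one_pow_natAbs]
  rcases Int.even_or_odd r with h | ⟨k, rfl⟩
  · have : ZMod.χ₄ (r : ZMod 4) = 0 := by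
      rw [ZMod.χ₄_int_eq_if_mod_four]
      simp [Int.even_iff.1 h]
    simp [this]
  · have h2 : e (((2 * k + 1 : ℤ) : ℂ) / 2 * (n : ℂ)) = (-1) ^ n := by
      rw [← e_half_intCast, ← one_mul (e ((n : ℂ) / 2)), ← e_intCast (k * n), ← e_add]
      congr 1
      push_cast
      ring
    have h3 : ((-1 : ℂ) ^ m) * (-1) ^ m = 1 := by
      rw [← mul_zpow]; simp
    rw [mul_add, e_add, h2, zpow_add₀ (by norm_num)]
    have h4 : e (τ * (((2 * k + 1 : ℤ) : ℂ) ^ 2 / 8)) * e (((2 * k + 1 : ℤ) : ℂ) / 2 * (z + m * τ)) =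
        e (-(τ * ((m : ℂ) ^ 2 / 2)) - m * z) *
          (e (τ * ((((2 * k + 1 : ℤ) : ℂ) + 2 * m) ^ 2 / 8)) *
            e ((((2 * k + 1 : ℤ) : ℂ) + 2 * m) / 2 * z)) := by
      simp only [← e_add]
      congr 1
      ring
    set X : ℂ := (ZMod.χ₄ ((2 * k + 1 : ℤ) : ZMod 4) : ℂ)
    calc _ = X * (-1) ^ n * (e (τ * (((2 * k + 1 : ℤ) : ℂ) ^ 2 / 8)) *
            e (((2 * k + 1 : ℤ) : ℂ) / 2 * (z + m * τ))) := by ring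
      _ = ((-1) ^ m * (-1) ^ m) * X * (-1) ^ n * (e (τ * (((2 * k + 1 : ℤ) : ℂ) ^ 2 / 8)) *
            e (((2 * k + 1 : ℤ) : ℂ) / 2 * (z + m * τ))) := by rw [h3]; ring
      _ = _ := by rw [h4]; ring

lemma thetaDer_add_lattice (τ z : ℂ) (m n : ℤ) :
    thetaDer 0 τ (z + m * τ + n) =
      (-1) ^ (m + n) * e (-(τ * (m ^ 2 / 2)) - m * z) * thetaDer 0 τ z := by
  rw [thetaDer, thetaDer, ← (Equiv.addRight (2 * m)).tsum_eq (thetaTerm 0 τ z), ← tsum_mul_left]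
  exact tsum_congr fun r => thetaTerm_add_lattice τ z m n r

lemma thetaDer_add_one_left (τ z : ℂ) :
    thetaDer 0 (τ + 1) z = e (1 / 8) * thetaDer 0 τ z := by
  rw [thetaDer, thetaDer, ← tsum_mul_left]
  refine tsum_congr fun r => ?_
  rcases Int.even_or_odd r with h | ⟨k, rfl⟩
  · simp [thetaTerm_eq_zero_of_even h]
  · obtain ⟨l, hl⟩ := Int.even_mul_succ_self k
    have h1 : e (((2 * k + 1 : ℤ) : ℂ) ^ 2 / 8) = e (1 / 8) := by
      have : (k : ℂ) * (k + 1) = l + l := by exact_mod_cast hl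
      rw [show ((2 * k + 1 : ℤ) : ℂ) ^ 2 / 8 = (l : ℂ) + 1 / 8 by
        push_cast; linear_combination this / 2, e_add, e_intCast, one_mul]
    rw [thetaTerm, thetaTerm, add_mul, one_mul, e_add, h1]
    ring

lemma thetaDer_neg_inv {τ : ℂ} (hτ : 0 < τ.im) (z : ℂ) :
    thetaDer 0 (-1 / τ) (z / τ) =
      (-I * τ) ^ (1 / 2 : ℂ) * e (-1 / 4) * e (z ^ 2 / (2 * τ)) * thetaDer 0 τ z := by
  have h0 : τ ≠ 0 := by rintro rfl; simp at hτ
  have hC : (-I * τ) ^ (1 / 2 : ℂ) ≠ 0 := by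
    rw [Ne, Complex.cpow_eq_zero_iff]; simp [h0]
  have h1 := jacobiTheta₂_functional_equation (z + τ / 2 + 1 / 2) τ
  have h2 := jacobiTheta₂_add_left' ((z + τ / 2 + 1 / 2) / τ) (-1 / τ)
  rw [thetaDer_eq_jacobiTheta₂, thetaDer_eq_jacobiTheta₂ τ z, h1]
  rw [show z / τ + -1 / τ / 2 + 1 / 2 = (z + τ / 2 + 1 / 2) / τ + -1 / τ by field_simp; ring, h2]
  have h3 : e (-1 / τ / 8) * e (z / τ / 2) *
      cexp (-Real.pi * I * (-1 / τ + 2 * ((z + τ / 2 + 1 / 2) / τ))) =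
      e (-1 / 4) * e (z ^ 2 / (2 * τ)) * (e (τ / 8) * e (z / 2)) *
      cexp (-Real.pi * I * (z + τ / 2 + 1 / 2) ^ 2 / τ) := by
    simp only [e, ← Complex.exp_add]
    congr 1
    field_simp
    ring
  set J := jacobiTheta₂ ((z + τ / 2 + 1 / 2) / τ) (-1 / τ)
  rw [show ∀ a b c d : ℂ, a * b * (c * d) = (a * b * c) * d by intros; ring, h3]
  field_simp

/-- Differentiate `thetaDer_neg_inv` at z = 0. Theta vanishes there, so the Gaussian factor
contributes nothing; the extra factor τ comes from the chain rule for z/τ. -/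
lemma thetaDer_one_neg_inv {τ : ℂ} (hτ : 0 < τ.im) :
    thetaDer 1 (-1 / τ) 0 = τ * ((-I * τ) ^ (1 / 2 : ℂ) * e (-1 / 4)) * thetaDer 1 τ 0 := by
  have h0 : τ ≠ 0 := by rintro rfl; simp at hτ
  have hτ' : 0 < (-1 / τ).im := by
    have := UpperHalfPlane.im_inv_neg_coe_pos ⟨τ, hτ⟩
    simpa [neg_div, inv_neg] using this
  have hf : HasDerivAt (fun z => thetaDer 0 (-1 / τ) (z / τ))
      (Real.pi * I * thetaDer 1 (-1 / τ) 0 * (1 / τ)) 0 := by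
    have h1 := hasDerivAt_thetaDer_right 0 hτ' (0 / τ)
    have h2 := h1.comp 0 ((hasDerivAt_id (0 : ℂ)).div_const τ)
    simpa [Function.comp_def] using h2
  have hg : HasDerivAt (fun z => (-I * τ) ^ (1 / 2 : ℂ) * e (-1 / 4) * e (z ^ 2 / (2 * τ)) *
      thetaDer 0 τ z)
      ((-I * τ) ^ (1 / 2 : ℂ) * e (-1 / 4) * (Real.pi * I * thetaDer 1 τ 0)) 0 := by
    have h1 := hasDerivAt_thetaDer_right 0 hτ 0
    have h2 : DifferentiableAt ℂ (fun z : ℂ => e (z ^ 2 / (2 * τ))) 0 := by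
      unfold e; fun_prop
    have h3 := ((h2.hasDerivAt.mul h1).const_mul ((-I * τ) ^ (1 / 2 : ℂ) * e (-1 / 4)))
    have h4 := thetaDer_zero_of_even (k := 0) (by simp) τ
    refine HasDerivAt.congr_deriv (h3.congr_of_eventuallyEq ?_) ?_
    · exact Eventually.of_forall fun z => by simp only [Pi.mul_apply]; ring
    · simp [h4, e_zero]
  have h := hf.unique (hg.congr_of_eventuallyEq
    (Eventually.of_forall fun z => thetaDer_neg_inv hτ z))
  have hpi : (Real.pi * I : ℂ) ≠ 0 := by simp [Real.pi_ne_zero]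
  have h5 : (Real.pi * I : ℂ) * thetaDer 1 (-1 / τ) 0 =
      Real.pi * I * (τ * ((-I * τ) ^ (1 / 2 : ℂ) * e (-1 / 4)) * thetaDer 1 τ 0) := by
    have h6 : τ * (1 / τ) = 1 := by field_simp
    linear_combination τ * h - (Real.pi * I : ℂ) * thetaDer 1 (-1 / τ) 0 * h6
  exact mul_left_cancel₀ hpi h5

lemma thetaDer_one_add_one_left {τ : ℂ} (hτ : 0 < τ.im) :
    thetaDer 1 (τ + 1) 0 = e (1 / 8) * thetaDer 1 τ 0 := by
  have h1 := hasDerivAt_thetaDer_right 0 (τ := τ + 1) (by simpa using hτ) 0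
  have h2 := (hasDerivAt_thetaDer_right 0 hτ 0).const_mul (e (1 / 8))
  have h := h1.unique (h2.congr_of_eventuallyEq
    (Eventually.of_forall fun z => thetaDer_add_one_left τ z))
  have hpi : (Real.pi * I : ℂ) ≠ 0 := by simp [Real.pi_ne_zero]
  refine mul_left_cancel₀ hpi ?_
  linear_combination h

end ThetaBlocks
end

/-! ### Jacobi's identity for the theta derivative -/

noncomputable section

namespace ThetaBlocks

open Complex Filter Topology

lemma e_pow (x : ℂ) (n : ℕ) : e x ^ n = e (n * x) := by
  rw [e, ← Complex.exp_nat_mul, e]; congr 1; ring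

lemma norm_e_mul_ofReal (τ : ℂ) (w : ℝ) : ‖e (τ * w)‖ = Real.exp (-(2 * Real.pi * w * τ.im)) := by
  rw [norm_e, im_mul_ofReal]; congr 1; ring

/-- If all exponents are nonnegative, `∑ c_i q^{w_i}` tends to the sum of the `c_i` with `w_i = 0`. -/
lemma tendsto_tsum_e_atImInfty {α : Type*} {c : α → ℂ} {w : α → ℝ} (hw : ∀ i, 0 ≤ w i)
    (hs : Summable fun i => ‖c i‖ * Real.exp (-(2 * Real.pi * w i))) :
    Tendsto (fun τ : UpperHalfPlane => ∑' i, c i * e ((τ : ℂ) * w i)) UpperHalfPlane.atImInfty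
      (𝓝 (∑' i, if w i = 0 then c i else 0)) := by
  refine tendsto_tsum_of_dominated_convergence hs (fun i => ?_) ?_
  · by_cases h : w i = 0
    · simp [h, e_zero]
    · rw [if_neg h, tendsto_zero_iff_norm_tendsto_zero]
      have h0 : 0 < w i := lt_of_le_of_ne (hw i) (Ne.symm h)
      simp only [norm_mul, norm_e_mul_ofReal]
      rw [← mul_zero ‖c i‖]
      refine Tendsto.const_mul _ (Real.tendsto_exp_neg_atTop_nhds_zero.comp ?_)
      exact Tendsto.const_mul_atTop (by positivity) (show Tendsto UpperHalfPlane.im UpperHalfPlane.atImInfty atTop from tendsto_comap)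
  · have : ∀ᶠ τ : UpperHalfPlane in UpperHalfPlane.atImInfty, 1 ≤ τ.im :=
      (show Tendsto UpperHalfPlane.im UpperHalfPlane.atImInfty atTop from tendsto_comap).eventually_ge_atTop 1
    filter_upwards [this] with τ hτ i
    rw [norm_mul, norm_e_mul_ofReal]
    refine mul_le_mul_of_nonneg_left (Real.exp_le_exp.2 (neg_le_neg ?_)) (norm_nonneg _)
    have h1 : 0 ≤ 2 * Real.pi * w i := mul_nonneg (by positivity) (hw i)
    exact le_mul_of_one_le_right h1 hτ

lemma tendsto_thetaDer_one_atImInfty :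
    Tendsto (fun τ : UpperHalfPlane => thetaDer 1 τ 0 * e (-(τ : ℂ) / 8)) UpperHalfPlane.atImInfty
      (𝓝 2) := by
  let c : ℤ → ℂ := fun r => (r : ℂ) * (ZMod.χ₄ (r : ZMod 4) : ℂ)
  -- The term r = 0 has coefficient zero, but its natural exponent −1/8 would violate nonnegativity,
  -- so it is replaced by 0.
  let w : ℤ → ℝ := fun r => if r = 0 then 0 else ((r : ℝ) ^ 2 - 1) / 8
  have hw : ∀ r, 0 ≤ w r := by
    intro r
    by_cases h : r = 0
    · simp [w, h]
    · have : (1 : ℝ) ≤ (r : ℝ) ^ 2 := by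
        have : (1 : ℤ) ≤ r ^ 2 := by have := sq_pos_of_ne_zero h; omega
        exact_mod_cast this
      simp only [w, if_neg h]
      linarith
  have hterm : ∀ (τ : UpperHalfPlane) (r : ℤ),
      thetaTerm 1 τ 0 r * e (-(τ : ℂ) / 8) = c r * e ((τ : ℂ) * w r) := by
    intro τ r
    by_cases h : r = 0
    · simp [h, c, thetaTerm]
    · simp only [thetaTerm, c, w, if_neg h, mul_zero, e_zero, mul_one, pow_one]
      rw [mul_assoc, mul_assoc, ← e_add, mul_assoc]
      congr 3
      push_cast
      ring
  have hs : Summable fun r => ‖c r‖ * Real.exp (-(2 * Real.pi * w r)) := by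
    have h := ((summable_thetaTerm 1 (τ := I) (by simp) 0).mul_right ‖e (-I / 8)‖)
    refine h.congr fun r => ?_
    have := hterm UpperHalfPlane.I r
    rw [UpperHalfPlane.coe_I] at this
    rw [← norm_mul, this, norm_mul, norm_e_mul_ofReal]
    simp
  have h := tendsto_tsum_e_atImInfty hw hs
  have hval : (∑' r, if w r = 0 then c r else 0) = 2 := by
    rw [tsum_eq_sum (s := {1, -1})]
    · rw [Finset.sum_pair (by decide)]
      have h1 : ZMod.χ₄ (1 : ZMod 4) = 1 := by decide
      have h2 : ZMod.χ₄ (-1 : ZMod 4) = -1 := by decide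
      simp only [w, c, Int.cast_one, Int.cast_neg, h1, h2]
      norm_num
    · intro r hr
      by_cases h0 : r = 0
      · simp [h0, c]
      · rw [if_neg]
        simp only [w, if_neg h0]
        intro h
        have h2 : (r : ℝ) ^ 2 = 1 := by linarith
        have h3 : r ^ 2 = 1 := by exact_mod_cast h2
        rcases (mul_self_eq_one_iff.1 (by rwa [← sq]) : r = 1 ∨ r = -1) with h | h <;> simp [h] at hr
  rw [hval] at h
  refine h.congr fun τ => ?_
  rw [thetaDer, ← tsum_mul_right]
  exact tsum_congr fun r => (hterm τ r).symm

lemma tendsto_eta_atImInfty :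
    Tendsto (fun τ : UpperHalfPlane => eta τ * e (-(τ : ℂ) / 24)) UpperHalfPlane.atImInfty
      (𝓝 1) := by
  have htprod : Tendsto (fun q : ℂ ↦ ∏' (n : ℕ), (1 - q ^ (n + 1))) (𝓝 0) (𝓝 1) := by
    have hd := ModularForm.differentiableOn_tprod_one_sub_pow.differentiableAt
      (Metric.isOpen_ball.mem_nhds (Metric.mem_ball_self (x := (0 : ℂ)) one_pos))
    simpa using hd.continuousAt.tendsto
  have := htprod.comp (UpperHalfPlane.qParam_tendsto_atImInfty zero_lt_one)
  refine this.congr fun τ => ?_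
  have h2 : Function.Periodic.qParam 24 (τ : ℂ) * e (-(τ : ℂ) / 24) = 1 := by
    simp only [Function.Periodic.qParam, e, ← Complex.exp_add]
    rw [← Complex.exp_zero]
    congr 1
    push_cast
    ring
  rw [eta, ModularForm.eta, mul_right_comm, h2, one_mul]
  rfl

lemma eta_ne_zero (τ : UpperHalfPlane) : eta τ ≠ 0 := ModularForm.eta_ne_zero τ.2

open scoped MatrixGroups Manifold ModularForm

/-- The eighth power of `ϑ'(τ,0)`, up to a constant, as a cusp form of weight 12. -/
def thetaNullCuspForm : CuspForm 𝒮ℒ 12 :=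
  have hS : ((fun τ : UpperHalfPlane => thetaDer 1 τ 0 ^ 8) ∣[(12 : ℤ)] ModularGroup.S) =
      fun τ : UpperHalfPlane => thetaDer 1 τ 0 ^ 8 := by
    ext z
    rw [ModularForm.SL_slash_apply, UpperHalfPlane.modular_S_smul]
    have h0 : (z : ℂ) ≠ 0 := z.ne_zero
    have h1 : (-(z : ℂ))⁻¹ = -1 / z := by field_simp
    have h2 : ((-I * (z : ℂ)) ^ (1 / 2 : ℂ)) ^ 8 = (z : ℂ) ^ 4 := by
      rw [← Complex.cpow_nat_mul]
      norm_num
      rw [mul_pow, I_pow_four, one_mul]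
    have h3 : e (-1 / 4) ^ 8 = 1 := by
      rw [e_pow, show ((8 : ℕ) : ℂ) * (-1 / 4) = ((-2 : ℤ) : ℂ) by norm_num, e_intCast]
    simp only [h1, thetaDer_one_neg_inv z.2, mul_pow, h2, h3,
      ModularGroup.denom_S]
    rw [zpow_neg]
    have : (z : ℂ) ^ (12 : ℤ) = (z : ℂ) ^ 8 * (z : ℂ) ^ 4 := by
      rw [← pow_add]; norm_cast
    rw [this]
    field_simp
  have hT : ((fun τ : UpperHalfPlane => thetaDer 1 τ 0 ^ 8) ∣[(12 : ℤ)] ModularGroup.T) =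
      fun τ : UpperHalfPlane => thetaDer 1 τ 0 ^ 8 := by
    ext z
    rw [ModularForm.SL_slash_apply, UpperHalfPlane.modular_T_smul]
    have h3 : e (1 / 8) ^ 8 = 1 := by
      rw [e_pow, show ((8 : ℕ) : ℂ) * (1 / 8) = ((1 : ℤ) : ℂ) by norm_num, e_intCast]
    have h4 : ((((1 : ℝ) +ᵥ z : UpperHalfPlane)) : ℂ) = z + 1 := by
      rw [UpperHalfPlane.coe_vadd]; push_cast; ring
    have hd : UpperHalfPlane.denom ModularGroup.T z = 1 := by
      rw [ModularGroup.denom_apply]; simp [ModularGroup.T]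
    rw [h4, thetaDer_one_add_one_left z.2, mul_pow, h3, hd, one_mul, one_zpow, mul_one]
  { toFun := fun τ => thetaDer 1 τ 0 ^ 8
    slash_action_eq' := by
      rintro A ⟨A, rfl⟩
      exact SlashInvariantForm.slash_action_generators_SL2Z hS hT A
    holo' := by
      rw [UpperHalfPlane.mdifferentiable_iff]
      refine .congr (f := fun τ => thetaDer 1 τ 0 ^ 8) (fun z hz ↦
        ((hasDerivAt_thetaDer_left 1 hz 0).differentiableAt.pow 8).differentiableWithinAt)
        fun z hz ↦ ?_
      simp [UpperHalfPlane.ofComplex_apply_of_im_pos hz]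
    zero_at_cusps' := by
      intro c hc
      rw [Subgroup.IsArithmetic.isCusp_iff_isCusp_SL2Z] at hc
      rw [OnePoint.isZeroAt_iff_forall_SL2Z hc]
      intro γ _
      rw [SlashInvariantForm.slash_action_generators_SL2Z hS hT]
      -- The eighth power is q times a function that converges at i∞, so it vanishes at the cusp.
      have h := (tendsto_thetaDer_one_atImInfty.pow 8).mul
        (UpperHalfPlane.qParam_tendsto_atImInfty zero_lt_one)
      rw [mul_zero] at h
      refine h.congr fun τ => ?_
      have h2 : e (-(τ : ℂ) / 8) ^ 8 * Function.Periodic.qParam 1 (τ : ℂ) = 1 := by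
        simp only [Function.Periodic.qParam, e, ← Complex.exp_nat_mul, ← Complex.exp_add]
        rw [← Complex.exp_zero]
        congr 1
        push_cast
        ring
      rw [mul_pow, mul_assoc, h2, mul_one] }

/-- Jacobi's identity `ϑ'(τ,0) = 2πi η(τ)³`. -/
theorem thetaDer_one_zero_eq (τ : UpperHalfPlane) : thetaDer 1 τ 0 = 2 * eta τ ^ 3 := by
  -- The level one cusp forms of weight 12 are the multiples of η²⁴. This gives the identity up to
  -- an eighth root of unity, which the rest of the proof pins down by continuation and the limit at
  -- i∞.
  obtain ⟨c, hc⟩ := CuspForm.exists_smul_discriminant_of_weight_eq_twelve thetaNullCuspForm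
  have hc8 : ∀ τ : UpperHalfPlane, thetaDer 1 τ 0 ^ 8 = c * eta τ ^ 24 := fun τ =>
    (congrArg (fun f : CuspForm 𝒮ℒ 12 => f τ) hc).symm
  let g : ℂ → ℂ := fun τ => thetaDer 1 τ 0 / ModularForm.eta τ ^ 3
  have hg8 : ∀ τ : ℂ, 0 < τ.im → g τ ^ 8 = c := fun τ hτ => by
    have h1 := hc8 ⟨τ, hτ⟩
    have h2 := eta_ne_zero ⟨τ, hτ⟩
    simp only [eta] at h1 h2
    simp only [g, div_pow, h1]
    field_simp
  have hlim : Tendsto (fun τ : UpperHalfPlane => g τ) UpperHalfPlane.atImInfty (𝓝 2) := by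
    have h := tendsto_thetaDer_one_atImInfty.div (tendsto_eta_atImInfty.pow 3) (by norm_num)
    norm_num at h
    refine h.congr fun τ => ?_
    have h2 : e (-(τ : ℂ) / 24) ^ 3 = e (-(τ : ℂ) / 8) := by
      simp only [e, ← Complex.exp_nat_mul]
      congr 1
      push_cast
      ring
    rw [Pi.div_apply, mul_pow, h2, mul_div_mul_right _ _ (e_ne_zero _)]
    rfl
  have hc0 : c = 2 ^ 8 := by
    refine tendsto_nhds_unique (f := fun τ : UpperHalfPlane => g τ ^ 8)
      (tendsto_const_nhds.congr fun τ => (hg8 τ τ.2).symm) (hlim.pow 8)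
  have hgd : ∀ τ : ℂ, 0 < τ.im → DifferentiableAt ℂ g τ := fun τ hτ =>
    (hasDerivAt_thetaDer_left 1 hτ 0).differentiableAt.div
      ((ModularForm.differentiableAt_eta_of_mem_upperHalfPlaneSet hτ).pow 3)
      (pow_ne_zero _ (ModularForm.eta_ne_zero hτ))
  have hopen : IsOpen {τ : ℂ | 0 < τ.im} := continuous_im.isOpen_preimage _ isOpen_Ioi
  -- As g⁸ is a nonzero constant, 8 g⁷ g' = 0 forces g' = 0.
  have hderiv : Set.EqOn (deriv g) 0 {τ : ℂ | 0 < τ.im} := by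
    intro τ hτ
    have h1 := ((hgd τ hτ).hasDerivAt.pow 8).unique
      ((hasDerivAt_const τ c).congr_of_eventuallyEq
        ((hopen.eventually_mem hτ).mono fun w hw => hg8 w hw))
    have h2 : g τ ≠ 0 := by
      intro h
      have := hg8 τ hτ
      rw [h, hc0] at this
      norm_num at this
    simpa [h2] using h1
  have hconst : ∀ τ : UpperHalfPlane, g τ = g I := fun τ =>
    hopen.is_const_of_deriv_eq_zero (convex_halfSpace_im_gt 0).isPreconnected
      (fun w hw => (hgd w hw).differentiableWithinAt) hderiv τ.2 (by simp)
  have h2 : g I = 2 := tendsto_nhds_unique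
    (tendsto_const_nhds.congr fun τ => (hconst τ).symm) hlim
  have h3 := hconst τ
  rw [h2] at h3
  have h4 := eta_ne_zero τ
  simp only [g] at h3
  change thetaDer 1 τ 0 / eta τ ^ 3 = 2 at h3
  rw [div_eq_iff (pow_ne_zero _ h4)] at h3
  exact h3

end ThetaBlocks
end

/-! ### Theta under the full modular group -/

noncomputable section

namespace ThetaBlocks

open Complex Filter Topology MatrixGroups

/-- The automorphy factor `cτ + d`. -/
def autFactor (A : SL(2, ℤ)) (τ : UpperHalfPlane) : ℂ := (A 1 0 : ℂ) * (τ : ℂ) + (A 1 1 : ℂ)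

lemma autFactor_eq_denom (A : SL(2, ℤ)) (τ : UpperHalfPlane) :
    autFactor A τ = UpperHalfPlane.denom A τ := by
  rw [ModularGroup.denom_apply]; rfl

lemma autFactor_ne_zero (A : SL(2, ℤ)) (τ : UpperHalfPlane) : autFactor A τ ≠ 0 := by
  rw [autFactor_eq_denom]; exact UpperHalfPlane.denom_ne_zero _ _

lemma autFactor_mul_smul (A : SL(2, ℤ)) (τ : UpperHalfPlane) :
    autFactor A τ * ((A • τ : UpperHalfPlane) : ℂ) = (A 0 0 : ℂ) * τ + A 0 1 := by
  have h := autFactor_ne_zero A τ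
  rw [UpperHalfPlane.coe_specialLinearGroup_apply]
  simp only [eq_intCast, Complex.ofReal_intCast, autFactor] at h ⊢
  field_simp

lemma autFactor_mul (A B : SL(2, ℤ)) (τ : UpperHalfPlane) :
    autFactor (A * B) τ = autFactor A (B • τ) * autFactor B τ := by
  have h := autFactor_mul_smul B τ
  have h1 : autFactor A (B • τ) = (A 1 0 : ℂ) * ((B • τ : UpperHalfPlane) : ℂ) + A 1 1 := rfl
  rw [h1]
  have h2 : autFactor (A * B) τ =
      (A 1 0 * B 0 0 + A 1 1 * B 1 0 : ℂ) * τ + (A 1 0 * B 0 1 + A 1 1 * B 1 1) := by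
    simp [autFactor, Matrix.mul_apply, Fin.sum_univ_two]
  have h3 : autFactor B τ = (B 1 0 : ℂ) * τ + B 1 1 := rfl
  rw [h2]
  linear_combination -(A 1 0 : ℂ) * h - (A 1 1 : ℂ) * h3

/-- This is det B = 1 in disguise. It makes the Gaussian exponents c z²/(2(cτ+d)) of A and B add up
to that of AB. -/
lemma autFactor_cocycle (A B : SL(2, ℤ)) (τ : UpperHalfPlane) :
    ((A * B) 1 0 : ℂ) * autFactor B τ = A 1 0 + B 1 0 * autFactor (A * B) τ := by
  have hdet : (B 0 0 : ℂ) * B 1 1 - B 0 1 * B 1 0 = 1 := by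
    have := B.det_coe
    rw [Matrix.det_fin_two] at this
    exact_mod_cast this
  have h2 : autFactor (A * B) τ =
      (A 1 0 * B 0 0 + A 1 1 * B 1 0 : ℂ) * τ + (A 1 0 * B 0 1 + A 1 1 * B 1 1) := by
    simp [autFactor, Matrix.mul_apply, Fin.sum_univ_two]
  have h3 : (((A * B) 1 0 : ℤ) : ℂ) = A 1 0 * B 0 0 + A 1 1 * B 1 0 := by
    simp [Matrix.mul_apply, Fin.sum_univ_two]
  rw [h2, h3, autFactor]
  linear_combination (A 1 0 : ℂ) * hdet

/-- The transformation law of the theta function, up to a factor independent of `z`. -/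
def IsThetaTransform (A : SL(2, ℤ)) : Prop :=
  ∀ τ : UpperHalfPlane, ∃ K : ℂ, K ≠ 0 ∧ ∀ z : ℂ,
    theta (A • τ) ((autFactor A τ)⁻¹ * z) =
      K * e ((A 1 0 : ℂ) * (z ^ 2 / 2) / autFactor A τ) * theta τ z

lemma IsThetaTransform.mul {A B : SL(2, ℤ)} (hA : IsThetaTransform A) (hB : IsThetaTransform B) :
    IsThetaTransform (A * B) := by
  intro τ
  obtain ⟨K, hK, h1⟩ := hA (B • τ)
  obtain ⟨K', hK', h2⟩ := hB τ
  refine ⟨K * K', mul_ne_zero hK hK', fun z => ?_⟩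
  have hb := autFactor_ne_zero B τ
  have ha := autFactor_ne_zero A (B • τ)
  have hab := autFactor_mul A B τ
  have hc := autFactor_cocycle A B τ
  rw [mul_smul, hab, mul_inv, mul_assoc, h1, h2]
  have : e (((A * B) 1 0 : ℂ) * (z ^ 2 / 2) / (autFactor A (B • τ) * autFactor B τ)) =
      e ((A 1 0 : ℂ) * (((autFactor B τ)⁻¹ * z) ^ 2 / 2) / autFactor A (B • τ)) *
        e ((B 1 0 : ℂ) * (z ^ 2 / 2) / autFactor B τ) := by
    rw [← e_add]
    congr 1
    rw [hab] at hc
    field_simp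
    linear_combination z ^ 2 * hc
  rw [this]
  ring

lemma IsThetaTransform.inv {A : SL(2, ℤ)} (hA : IsThetaTransform A) : IsThetaTransform A⁻¹ := by
  intro τ
  obtain ⟨K, hK, h⟩ := hA (A⁻¹ • τ)
  refine ⟨K⁻¹, inv_ne_zero hK, fun z => ?_⟩
  have h1 := autFactor_mul A A⁻¹ τ
  have h2 := autFactor_cocycle A A⁻¹ τ
  have h0 : autFactor 1 τ = 1 := by simp [autFactor]
  rw [mul_inv_cancel, h0] at h1 h2
  have ha := autFactor_ne_zero A (A⁻¹ • τ)
  have hb := autFactor_ne_zero A⁻¹ τ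
  have h3 := h ((autFactor A⁻¹ τ)⁻¹ * z)
  rw [smul_inv_smul, ← mul_assoc, ← mul_inv, ← h1, inv_one, one_mul] at h3
  rw [h3]
  have : e ((A⁻¹ 1 0 : ℂ) * (z ^ 2 / 2) / autFactor A⁻¹ τ) *
      e ((A 1 0 : ℂ) * (((autFactor A⁻¹ τ)⁻¹ * z) ^ 2 / 2) / autFactor A (A⁻¹ • τ)) = 1 := by
    rw [← e_add, ← e_zero]
    congr 1
    simp only [Matrix.SpecialLinearGroup.coe_one, ne_eq, one_ne_zero, not_false_eq_true,
      Matrix.one_apply_ne, Int.cast_zero, zero_mul, mul_one] at h2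
    have h4 : autFactor A (A⁻¹ • τ) = (autFactor A⁻¹ τ)⁻¹ := eq_inv_of_mul_eq_one_left h1.symm
    rw [h4]
    field_simp
    linear_combination -z ^ 2 * h2
  rw [show ∀ a b c d e : ℂ, a * b * (c * d * e) = (a * c) * (b * d) * e by intros; ring, this,
    inv_mul_cancel₀ hK]
  ring

/-- With the factor K left unspecified the law is stable under products and inverses, so the
generators S and T suffice and no square root has to be followed through the group. -/
lemma isThetaTransform (A : SL(2, ℤ)) : IsThetaTransform A := by
  have hA : A ∈ Subgroup.closure {ModularGroup.S, ModularGroup.T} := by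
    rw [SpecialLinearGroup.SL2Z_generators]; trivial
  induction hA using Subgroup.closure_induction with
  | mem x hx =>
    rcases hx with rfl | rfl
    · intro τ
      have h0 : (τ : ℂ) ≠ 0 := τ.ne_zero
      have hj : autFactor ModularGroup.S τ = τ := by simp [autFactor, ModularGroup.S]
      have hc : ((ModularGroup.S 1 0 : ℤ) : ℂ) = 1 := by simp [ModularGroup.S]
      refine ⟨(-I * τ) ^ (1 / 2 : ℂ) * e (-1 / 4), mul_ne_zero ?_ (e_ne_zero _), fun z => ?_⟩
      · rw [Ne, Complex.cpow_eq_zero_iff]; simp [h0]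
      · rw [theta_eq_thetaDer, theta_eq_thetaDer, hj, hc, one_mul, UpperHalfPlane.modular_S_smul]
        simp only
        rw [show (-(τ : ℂ))⁻¹ = -1 / τ by field_simp, show (τ : ℂ)⁻¹ * z = z / τ by ring,
          thetaDer_neg_inv τ.2]
        congr 3
        field_simp
    · intro τ
      have hj : autFactor ModularGroup.T τ = 1 := by simp [autFactor, ModularGroup.T]
      have hc : ((ModularGroup.T 1 0 : ℤ) : ℂ) = 0 := by simp [ModularGroup.T]
      refine ⟨e (1 / 8), e_ne_zero _, fun z => ?_⟩
      have h4 : ((((1 : ℝ) +ᵥ τ : UpperHalfPlane)) : ℂ) = τ + 1 := by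
        rw [UpperHalfPlane.coe_vadd]; push_cast; ring
      rw [theta_eq_thetaDer, theta_eq_thetaDer, hj, hc, UpperHalfPlane.modular_T_smul, h4,
        inv_one, one_mul, thetaDer_add_one_left]
      simp [e_zero]
  | one =>
    intro τ
    exact ⟨1, one_ne_zero, fun z => by simp [autFactor, e_zero]⟩
  | mul x y _ _ hx hy => exact hx.mul hy
  | inv x _ hx => exact hx.inv

lemma hasDerivAt_theta (τ : UpperHalfPlane) :
    HasDerivAt (theta τ) (Real.pi * I * (2 * eta τ ^ 3)) 0 := by
  have h := hasDerivAt_thetaDer_right 0 τ.2 0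
  rw [← thetaDer_one_zero_eq]
  exact h.congr_of_eventuallyEq (Eventually.of_forall fun z => theta_eq_thetaDer τ z)

lemma theta_zero (τ : UpperHalfPlane) : theta τ 0 = 0 := by
  rw [theta_eq_thetaDer]; exact thetaDer_zero_of_even (by simp) _

/-- The theta function is a Jacobi form of weight and index `1/2` with character `ε³`. -/
theorem theta_smul (A : SL(2, ℤ)) (τ : UpperHalfPlane) (z : ℂ) :
    theta (A • τ) ((autFactor A τ)⁻¹ * z) =
      e ((A 1 0 : ℂ) * (z ^ 2 / 2) / autFactor A τ) *
        ((autFactor A τ)⁻¹ * (eta (A • τ) / eta τ) ^ 3) * theta τ z := by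
  obtain ⟨K, -, h⟩ := isThetaTransform A τ
  have hj := autFactor_ne_zero A τ
  have he := eta_ne_zero τ
  -- Comparing the z-derivatives of both sides at 0 determines K, since ϑ' is a multiple of η³
  -- there.
  suffices hK : K = (autFactor A τ)⁻¹ * (eta (A • τ) / eta τ) ^ 3 by
    rw [h, hK]; ring
  have h1 : HasDerivAt (fun z => theta (A • τ) ((autFactor A τ)⁻¹ * z))
      (Real.pi * I * (2 * eta (A • τ) ^ 3) * (autFactor A τ)⁻¹) 0 := by
    have h2 := hasDerivAt_theta (A • τ)
    rw [← mul_zero (autFactor A τ)⁻¹] at h2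
    simpa [Function.comp_def] using h2.comp 0 ((hasDerivAt_id (0 : ℂ)).const_mul _)
  have h2 : HasDerivAt (fun z => K * e ((A 1 0 : ℂ) * (z ^ 2 / 2) / autFactor A τ) * theta τ z)
      (K * (Real.pi * I * (2 * eta τ ^ 3))) 0 := by
    have h3 : DifferentiableAt ℂ
        (fun z : ℂ => K * e ((A 1 0 : ℂ) * (z ^ 2 / 2) / autFactor A τ)) 0 := by
      unfold e; fun_prop
    refine (h3.hasDerivAt.mul (hasDerivAt_theta τ)).congr_deriv ?_
    simp [theta_zero, e_zero]
  have h3 := h1.unique (h2.congr_of_eventuallyEq (Eventually.of_forall h))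
  have hpi : (Real.pi * I * 2 : ℂ) ≠ 0 := by simp [Real.pi_ne_zero]
  have h4 : eta (A • τ) ^ 3 * (autFactor A τ)⁻¹ = K * eta τ ^ 3 := by
    refine mul_left_cancel₀ hpi ?_
    linear_combination h3
  rw [div_pow, ← mul_div_assoc, mul_comm (autFactor A τ)⁻¹, h4]
  field_simp

lemma theta_add_lattice (τ : UpperHalfPlane) (z : ℂ) (m n : ℤ) :
    theta τ (z + m * τ + n) = (-1) ^ (m + n) * e (-(τ * (m ^ 2 / 2)) - m * z) * theta τ z := by
  rw [theta_eq_thetaDer, theta_eq_thetaDer, thetaDer_add_lattice]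

lemma differentiableAt_thetaDer_zero {p : ℂ × ℂ} (hp : 0 < p.1.im) :
    DifferentiableAt ℂ (fun p : ℂ × ℂ => thetaDer 0 p.1 p.2) p := by
  simp only [thetaDer_eq_jacobiTheta₂]
  have h1 := (hasFDerivAt_jacobiTheta₂ (p.2 + p.1 / 2 + 1 / 2) hp).differentiableAt
  have h2 : DifferentiableAt ℂ (fun p : ℂ × ℂ => ((p.2 + p.1 / 2 + 1 / 2, p.1) : ℂ × ℂ)) p := by
    fun_prop
  have h3 := DifferentiableAt.comp p
    (g := fun p : ℂ × ℂ => jacobiTheta₂ p.1 p.2) h1 h2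
  refine DifferentiableAt.mul ?_ h3
  unfold e
  fun_prop

end ThetaBlocks
end

/-! ### Canonical forms, root levels and the fundamental alcove -/

noncomputable section

set_option linter.unusedSectionVars false

namespace ThetaBlocks

open RootPairing

section Root

variable {ι E M : Type*} [Fintype ι] [NormedAddCommGroup E] [InnerProductSpace ℝ E]
  [AddCommGroup M] [Module ℝ M] {P : RootPairing ι ℝ E M}

lemma coroot'_reflection_same (i : ι) (x : E) :
    P.coroot' i (P.reflection i x) = -P.coroot' i x := by
  rw [reflection_apply, map_sub, map_smul, root_coroot'_eq_pairing, pairing_same, smul_eq_mul]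
  ring

lemma mem_posRoots {b : P.Base} {i : ι} : i ∈ posRoots b ↔ b.IsPos i := by
  simp [posRoots]

lemma root_neg (i : ι) : P.root (P.reflectionPerm i i) = -P.root i := by
  rw [root_reflectionPerm, reflection_apply_self]

lemma reflectionPerm_reflectionPerm_self (i : ι) :
    P.reflectionPerm (P.reflectionPerm i i) (P.reflectionPerm i i) = i :=
  P.root.injective (by rw [root_neg, root_neg, neg_neg])

lemma isPos_neg_iff {b : P.Base} {i : ι} : b.IsPos (P.reflectionPerm i i) ↔ ¬ b.IsPos i :=
  Base.IsPos.neg_iff_not b i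

/-- A symmetric, positive definite and Weyl group invariant form `D` on the space of a root system
such that `∑_{r ∈ R⁺} D(x,r) r = x`. -/
structure IsCanonicalForm (b : P.Base) (D : LinearMap.BilinForm ℝ E) : Prop where
  symm : ∀ x y, D x y = D y x
  pos : ∀ x, x ≠ 0 → 0 < D x x
  reflection : ∀ i x y, D (P.reflection i x) (P.reflection i y) = D x y
  sum_smul : ∀ x, ∑ i ∈ posRoots b, D x (P.root i) • P.root i = x

/-- The integer `m` with `m D(x, r) = ⟨x, r^∨⟩`. -/
def rootLevel (D : LinearMap.BilinForm ℝ E) (i : ι) : ℝ := 2 / D (P.root i) (P.root i)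

/-- The even part of the lattice dual to the root lattice. -/
def IsEvenVector (P : RootPairing ι ℝ E M) (D : LinearMap.BilinForm ℝ E) (x : E) : Prop :=
  (∀ i, ∃ m : ℤ, D x (P.root i) = m) ∧ ∃ m : ℤ, D x x / 2 = m

/-- The weights of the root system. -/
def IsWeight (P : RootPairing ι ℝ E M) (x : E) : Prop := ∀ i, ∃ m : ℤ, P.coroot' i x = m

namespace IsCanonicalForm

variable {b : P.Base} {D : LinearMap.BilinForm ℝ E}

lemma apply_sum (hD : IsCanonicalForm b D) (x y : E) :
    ∑ i ∈ posRoots b, D x (P.root i) * D y (P.root i) = D x y := by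
  conv_rhs => rw [← hD.sum_smul y]
  simp only [map_sum, map_smul, smul_eq_mul]
  exact Finset.sum_congr rfl fun i _ => mul_comm _ _

lemma root_pos (hD : IsCanonicalForm b D) (i : ι) : 0 < D (P.root i) (P.root i) :=
  hD.pos _ (P.ne_zero i)

lemma rootLevel_pos (hD : IsCanonicalForm b D) (i : ι) : 0 < rootLevel (P := P) D i :=
  div_pos two_pos (hD.root_pos i)

/-- Invariance of `D` under the reflection in a root, tested against that root, forces ⟨x,r^∨⟩ =
2D(x,r)/D(r,r). -/
lemma rootLevel_mul (hD : IsCanonicalForm b D) (i : ι) (x : E) :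
    rootLevel (P := P) D i * D x (P.root i) = P.coroot' i x := by
  have h := hD.reflection i x (P.root i)
  rw [reflection_apply_self, reflection_apply] at h
  simp only [map_sub, map_neg, map_smul, LinearMap.sub_apply, LinearMap.smul_apply,
    smul_eq_mul] at h
  have h0 := (hD.root_pos i).ne'
  rw [rootLevel]
  field_simp
  linarith

lemma apply_root (hD : IsCanonicalForm b D) (i : ι) (x : E) :
    D x (P.root i) = P.coroot' i x / rootLevel (P := P) D i := by
  rw [eq_div_iff (hD.rootLevel_pos i).ne', mul_comm, hD.rootLevel_mul]

lemma root_self (_hD : IsCanonicalForm b D) (i : ι) :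
    D (P.root i) (P.root i) = 2 / rootLevel (P := P) D i := by
  rw [rootLevel, div_div_cancel₀ two_ne_zero]

lemma two_mul_rootLevel (hD : IsCanonicalForm b D) (i : ι) :
    2 * rootLevel (P := P) D i = ∑ r ∈ posRoots b, P.pairing r i ^ 2 := by
  have h := hD.apply_sum (P.root i) (P.root i)
  rw [hD.root_self] at h
  have h0 := hD.rootLevel_pos i
  calc _ = rootLevel (P := P) D i ^ 2 * (2 / rootLevel (P := P) D i) := by field_simp
    _ = _ := by
      rw [← h, Finset.mul_sum]
      refine Finset.sum_congr rfl fun r _ => ?_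
      rw [← root_coroot'_eq_pairing, ← hD.rootLevel_mul, hD.symm (P.root i)]
      ring

end IsCanonicalForm

lemma coroot'_root (i j : ι) [P.IsCrystallographic] :
    P.coroot' i (P.root j) = (P.pairingIn ℤ j i : ℝ) := by
  rw [root_coroot'_eq_pairing, ← P.algebraMap_pairingIn ℤ]; rfl

lemma isWeight_root [P.IsCrystallographic] (j : ι) : IsWeight P (P.root j) :=
  fun i => ⟨_, coroot'_root i j⟩

lemma IsWeight.add {x y : E} (hx : IsWeight P x) (hy : IsWeight P y) : IsWeight P (x + y) := by
  intro i
  obtain ⟨m, hm⟩ := hx i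
  obtain ⟨n, hn⟩ := hy i
  exact ⟨m + n, by rw [map_add, hm, hn]; push_cast; rfl⟩

lemma IsWeight.sub {x y : E} (hx : IsWeight P x) (hy : IsWeight P y) : IsWeight P (x - y) := by
  intro i
  obtain ⟨m, hm⟩ := hx i
  obtain ⟨n, hn⟩ := hy i
  exact ⟨m - n, by rw [map_sub, hm, hn]; push_cast; rfl⟩

lemma IsWeight.zsmul {x : E} (hx : IsWeight P x) (k : ℤ) : IsWeight P (k • x) := by
  intro i
  obtain ⟨m, hm⟩ := hx i
  exact ⟨k * m, by rw [map_zsmul, hm]; push_cast; simp⟩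

lemma isWeight_sum {α : Type*} (s : Finset α) {f : α → E} (hf : ∀ a ∈ s, IsWeight P (f a)) :
    IsWeight P (∑ a ∈ s, f a) := by
  classical
  induction s using Finset.induction_on with
  | empty => exact fun i => ⟨0, by simp⟩
  | insert a s ha ih =>
    rw [Finset.sum_insert ha]
    exact (hf a (by simp)).add (ih fun c hc => hf c (by simp [hc]))

section Weyl

variable [P.IsCrystallographic] [P.IsReduced] (b : P.Base)

/-- The reflection in f permutes the other positive roots and negates their pairing with f^∨, so
these pairings cancel and only half of ⟨f,f^∨⟩ = 2 remains. -/
lemma coroot'_weylVector {f : ι} (hf : f ∈ b.support) : P.coroot' f (weylVector b) = 1 := by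
  classical
  have hfp : f ∈ posRoots b := mem_posRoots.2 (b.isPos_of_mem_support hf)
  have hinv : ∑ r ∈ (posRoots b).erase f, P.coroot' f (P.root r) = 0 := by
    have h : ∑ r ∈ (posRoots b).erase f, P.coroot' f (P.root r) =
        ∑ r ∈ (posRoots b).erase f, -P.coroot' f (P.root r) := by
      refine Finset.sum_nbij' (P.reflectionPerm f) (P.reflectionPerm f) ?_ ?_ ?_ ?_ ?_
      · intro r hr
        rw [Finset.mem_erase, mem_posRoots] at hr ⊢
        refine ⟨fun h => ?_, hr.2.reflectionPerm hf hr.1⟩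
        have h2 : r = P.reflectionPerm f f := by
          rw [← P.reflectionPerm_self f r, h]
        exact isPos_neg_iff.1 (h2 ▸ hr.2) (b.isPos_of_mem_support hf)
      · intro r hr
        rw [Finset.mem_erase, mem_posRoots] at hr ⊢
        refine ⟨fun h => ?_, hr.2.reflectionPerm hf hr.1⟩
        have h2 : r = P.reflectionPerm f f := by
          rw [← P.reflectionPerm_self f r, h]
        exact isPos_neg_iff.1 (h2 ▸ hr.2) (b.isPos_of_mem_support hf)
      · intro r _; exact P.reflectionPerm_self _ _
      · intro r _; exact P.reflectionPerm_self _ _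
      · intro r _
        rw [root_reflectionPerm, coroot'_reflection_same, neg_neg]
    rw [Finset.sum_neg_distrib] at h
    linarith
  rw [weylVector, map_smul, map_sum, ← Finset.add_sum_erase _ _ hfp, hinv,
    root_coroot'_eq_pairing, pairing_same]
  norm_num

lemma isWeight_of_forall_support {x : E} (hx : ∀ f ∈ b.support, ∃ m : ℤ, P.coroot' f x = m) :
    IsWeight P x := by
  intro i
  have h := b.coroot_mem_span_int i
  change ∃ m : ℤ, P.toLinearMap x (P.coroot i) = m
  generalize P.coroot i = c at h ⊢
  induction h using Submodule.span_induction with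
  | mem y hy => obtain ⟨f, hf, rfl⟩ := hy; exact hx f hf
  | zero => exact ⟨0, by simp⟩
  | add y z _ _ hy hz =>
    obtain ⟨m, hm⟩ := hy
    obtain ⟨n, hn⟩ := hz
    exact ⟨m + n, by rw [map_add, hm, hn]; push_cast; rfl⟩
  | smul k y _ hy =>
    obtain ⟨m, hm⟩ := hy
    exact ⟨k * m, by rw [map_zsmul, hm]; push_cast; simp⟩

lemma isWeight_weylVector : IsWeight P (weylVector b) :=
  isWeight_of_forall_support b fun f hf => ⟨1, by rw [coroot'_weylVector b hf]; simp⟩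

lemma two_mul_coroot'_weylVector (i : ι) :
    2 * P.coroot' i (weylVector b) = ∑ r ∈ posRoots b, P.pairing r i := by
  rw [weylVector, map_smul, map_sum, smul_eq_mul, ← mul_assoc]
  norm_num

variable {b} {D : LinearMap.BilinForm ℝ E}

/-- Nonnegativity on simple roots implies nonnegativity on positive roots. -/
lemma apply_root_eq_sum (D : LinearMap.BilinForm ℝ E) (x : E) (i : ι) :
    D x (P.root i) = ∑ f : b.support, (rootCoeff b i f : ℝ) * D x (P.root f) := by
  conv_lhs => rw [root_eq_sum_rootCoeff b i]
  simp

lemma rootCoeff_nonneg {i : ι} (hi : b.IsPos i) (f : b.support) : 0 ≤ rootCoeff b i f := by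
  obtain ⟨h1, h2, h3⟩ := (b.exists_root_eq_sum_int i).choose_spec
  rcases h2 with h | h
  · exact h.le _
  · exfalso
    have hh : b.height i ≤ 0 := Finset.sum_nonpos fun j _ => h.le j
    exact absurd hi (not_lt.2 hh)

lemma exists_rootCoeff_pos {i : ι} (hi : b.IsPos i) : ∃ f : b.support, 0 < rootCoeff b i f := by
  by_contra! h
  have h1 := root_eq_sum_rootCoeff b i
  have h2 : ∀ f : b.support, rootCoeff b i f = 0 := fun f =>
    le_antisymm (h f) (rootCoeff_nonneg hi f)
  simp only [h2, zero_smul, Finset.sum_const_zero] at h1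
  exact P.ne_zero i h1

namespace IsCanonicalForm

lemma weylVector_root_pos (hD : IsCanonicalForm b D) {i : ι} (hi : b.IsPos i) :
    0 < D (weylVector b) (P.root i) := by
  rw [apply_root_eq_sum (b := b)]
  have hf : ∀ f : b.support, 0 < D (weylVector b) (P.root f) := fun f => by
    rw [hD.apply_root, coroot'_weylVector b f.2]
    exact div_pos one_pos (hD.rootLevel_pos _)
  obtain ⟨f, hf1⟩ := exists_rootCoeff_pos hi
  refine Finset.sum_pos' (fun g _ => mul_nonneg ?_ (hf g).le) ⟨f, Finset.mem_univ _, ?_⟩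
  · exact_mod_cast rootCoeff_nonneg hi g
  · exact mul_pos (by exact_mod_cast hf1) (hf f)

lemma coroot'_weylVector_pos (hD : IsCanonicalForm b D) {i : ι} (hi : b.IsPos i) :
    0 < P.coroot' i (weylVector b) := by
  rw [← hD.rootLevel_mul]
  exact mul_pos (hD.rootLevel_pos i) (hD.weylVector_root_pos hi)

/-- Both 2m_i = ∑ c_r² and 2⟨ρ,i^∨⟩ = ∑ c_r are sums over positive roots, with c_r = ⟨r,i^∨⟩. The
summands c(c−1) are even, nonnegative, and zero only for c ∈ {0,1}. From this follow the integrality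
of the level, the position of ρ inside the alcove, and the criterion for ρ to lie one step from its
upper wall. -/
lemma rootLevel_sub (hD : IsCanonicalForm b D) (i : ι) :
    2 * (rootLevel (P := P) D i - P.coroot' i (weylVector b)) =
      ((∑ r ∈ posRoots b, P.pairingIn ℤ r i * (P.pairingIn ℤ r i - 1) : ℤ) : ℝ) := by
  rw [mul_sub, hD.two_mul_rootLevel, two_mul_coroot'_weylVector, ← Finset.sum_sub_distrib]
  push_cast
  refine Finset.sum_congr rfl fun r _ => ?_
  have : P.pairing r i = (P.pairingIn ℤ r i : ℝ) := (P.algebraMap_pairingIn ℤ r i).symm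
  rw [this]
  ring

lemma exists_rootLevel_eq (hD : IsCanonicalForm b D) (i : ι) :
    ∃ m : ℤ, 0 < m ∧ rootLevel (P := P) D i = m := by
  obtain ⟨k, hk⟩ := isWeight_weylVector b i
  have h := hD.rootLevel_sub i
  have heven : Even (∑ r ∈ posRoots b, P.pairingIn ℤ r i * (P.pairingIn ℤ r i - 1)) :=
    Finset.even_sum _ fun r _ => Int.even_mul_pred_self _
  obtain ⟨l, hl⟩ := heven
  rw [hl, hk] at h
  push_cast at h
  have h2 : rootLevel (P := P) D i = ((k + l : ℤ) : ℝ) := by push_cast; linarith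
  refine ⟨k + l, ?_, h2⟩
  have := hD.rootLevel_pos i
  rw [h2] at this
  exact_mod_cast this

lemma int_mul_pred_nonneg (c : ℤ) : 0 ≤ c * (c - 1) := by
  rcases le_or_gt c 0 with h | h
  · nlinarith
  · exact mul_nonneg h.le (by omega)

/-- The root i itself contributes 2·(2−1) > 0 to the sum in `rootLevel_sub`. -/
lemma coroot'_weylVector_lt (hD : IsCanonicalForm b D) {i : ι} (hi : b.IsPos i) :
    P.coroot' i (weylVector b) < rootLevel (P := P) D i := by
  have h := hD.rootLevel_sub i
  have h2 : 0 < ∑ r ∈ posRoots b, P.pairingIn ℤ r i * (P.pairingIn ℤ r i - 1) :=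
    Finset.sum_pos' (fun r _ => int_mul_pred_nonneg _) ⟨i, mem_posRoots.2 hi, by simp⟩
  have h3 : (0 : ℝ) < ((∑ r ∈ posRoots b, P.pairingIn ℤ r i * (P.pairingIn ℤ r i - 1) : ℤ) : ℝ) :=
    by exact_mod_cast h2
  linarith

/-- If `μ` is a nonzero dominant vector, there is a root that is not orthogonal to `μ` and whose
coroot takes the values `0` and `1` on all other positive roots. -/
lemma exists_rootLevel_eq_add_one (hD : IsCanonicalForm b D) {μ : E} (hμ : μ ≠ 0)
    (hdom : ∀ r, b.IsPos r → 0 ≤ D μ (P.root r)) :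
    ∃ i, b.IsPos i ∧ 0 < D μ (P.root i) ∧
      rootLevel (P := P) D i = P.coroot' i (weylVector b) + 1 := by
  classical
  -- The root sought is chosen among those with D(μ,·) > 0: first of maximal length, then of maximal
  -- height.
  let S : Finset ι := Finset.univ.filter fun i => 0 < D μ (P.root i)
  have hS : S.Nonempty := by
    by_contra hne
    rw [Finset.not_nonempty_iff_eq_empty, Finset.filter_eq_empty_iff] at hne
    have h0 := hD.pos μ hμ
    rw [← hD.apply_sum] at h0
    refine h0.ne' (Finset.sum_eq_zero fun r hr => ?_)
    have h1 := hdom r (mem_posRoots.1 hr)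
    have h2 := hne (Finset.mem_univ r)
    rw [le_antisymm (not_lt.1 h2) h1, mul_zero]
  obtain ⟨i₀, hi₀, hmax₀⟩ := S.exists_max_image (fun i => D (P.root i) (P.root i)) hS
  let S' : Finset ι := S.filter fun i => D (P.root i) (P.root i) = D (P.root i₀) (P.root i₀)
  obtain ⟨i, hi, hmax'⟩ := S'.exists_max_image b.height ⟨i₀, by simp [S', hi₀]⟩
  have hiS : 0 < D μ (P.root i) := (Finset.mem_filter.1 (Finset.mem_filter.1 hi).1).2
  have hlen : ∀ j, 0 < D μ (P.root j) → D (P.root j) (P.root j) ≤ D (P.root i) (P.root i) := by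
    intro j hj
    rw [(Finset.mem_filter.1 hi).2]
    exact hmax₀ j (by simp [S, hj])
  have hht : ∀ j, 0 < D μ (P.root j) → D (P.root j) (P.root j) = D (P.root i) (P.root i) →
      b.height j ≤ b.height i := by
    intro j hj hj2
    rw [(Finset.mem_filter.1 hi).2] at hj2
    exact hmax' j (by simp [S', S, hj, hj2])
  have hpos : ∀ j, 0 < D μ (P.root j) → b.IsPos j := by
    intro j hj
    by_contra hn
    have := hdom _ (isPos_neg_iff.2 hn)
    rw [root_neg, map_neg] at this
    linarith
  refine ⟨i, hpos i hiS, hiS, ?_⟩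
  have hrefl : ∀ j k, P.root (P.reflectionPerm j k) = P.root k - (P.pairingIn ℤ k j) • P.root j :=
    fun j k => by
      rw [root_reflectionPerm, reflection_apply, coroot'_root, Int.cast_smul_eq_zsmul]
  have hDz : ∀ (k : ℤ) (j : ι), D μ (k • P.root j) = k * D μ (P.root j) := fun k j => by
    rw [map_zsmul, zsmul_eq_mul]
  have key : ∀ r, b.IsPos r → r ≠ i → P.pairingIn ℤ r i = 0 ∨ P.pairingIn ℤ r i = 1 := by
    intro r hr hri
    have hrne : P.root r ≠ -P.root i := by
      rw [← root_neg]
      intro h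
      rw [P.root.injective h] at hr
      exact isPos_neg_iff.1 hr (hpos i hiS)
    have hmem := P.pairingIn_pairingIn_mem_set_of_isCrystal_of_isRed' r i
      (fun h => hri (P.root.injective h)) hrne
    by_contra! hcon
    -- If ⟨r,i^∨⟩ < 0, reflecting i in r would give a root of the same length and greater height,
    -- still positive on μ.
    have hneg : ¬ (P.pairingIn ℤ r i < 0) := by
      intro h
      have h' : P.pairingIn ℤ i r < 0 := by
        simp only [Set.mem_insert_iff, Set.mem_singleton_iff, Prod.mk.injEq] at hmem
        omega
      have hj := hrefl r i
      have hpos' : 0 < D μ (P.root (P.reflectionPerm r i)) := by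
        rw [hj, map_sub, hDz]
        have h1 : (P.pairingIn ℤ i r : ℝ) ≤ 0 := by exact_mod_cast h'.le
        nlinarith [hdom r hr]
      have h2 := hht _ hpos' (by rw [root_reflectionPerm, hD.reflection])
      have h3 : b.height (P.reflectionPerm r i) = b.height i + (-P.pairingIn ℤ i r) • b.height r :=
        b.height_add_zsmul (by rw [hj, neg_smul, sub_eq_add_neg])
      rw [h3, smul_eq_mul] at h2
      have h4 : 0 < b.height r := hr
      nlinarith
    -- For c = ⟨r,i^∨⟩ ≥ 2 the root r is longer than i, hence orthogonal to μ by maximality. But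
    -- then c·i − r is a root as long as r and positive on μ, a contradiction.
    have h2 : 2 ≤ P.pairingIn ℤ r i ∧ P.pairingIn ℤ i r = 1 := by
      simp only [Set.mem_insert_iff, Set.mem_singleton_iff, Prod.mk.injEq] at hmem
      omega
    have hlenr : D (P.root i) (P.root i) < D (P.root r) (P.root r) := by
      have h3 := hD.apply_root i (P.root r)
      have h4 := hD.apply_root r (P.root i)
      rw [coroot'_root] at h3 h4
      rw [hD.symm, h3, h2.2] at h4
      rw [hD.root_self, hD.root_self]
      have h5 := hD.rootLevel_pos i
      have h6 := hD.rootLevel_pos r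
      have h7 : (2 : ℝ) ≤ P.pairingIn ℤ r i := by exact_mod_cast h2.1
      rw [div_lt_div_iff₀ h5 h6]
      rw [div_eq_div_iff h5.ne' h6.ne'] at h4
      push_cast at h4
      nlinarith
    have hr0 : D μ (P.root r) = 0 := by
      refine le_antisymm (not_lt.1 fun h => ?_) (hdom r hr)
      exact absurd (hlen r h) (not_le.2 hlenr)
    have hj := hrefl i r
    set j := P.reflectionPerm (P.reflectionPerm i r) (P.reflectionPerm i r) with hjdef
    have hjr : P.root j = -(P.root r - (P.pairingIn ℤ r i) • P.root i) := by
      rw [hjdef, root_neg, hj]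
    have hjpos : 0 < D μ (P.root j) := by
      rw [hjr, map_neg, map_sub, hDz, hr0]
      have h7 : (2 : ℝ) ≤ P.pairingIn ℤ r i := by exact_mod_cast h2.1
      nlinarith
    have hjlen : D (P.root j) (P.root j) = D (P.root r) (P.root r) := by
      rw [hjr, ← hj, root_reflectionPerm, map_neg, map_neg, LinearMap.neg_apply, neg_neg,
        hD.reflection]
    exact absurd (hlen j hjpos) (not_le.2 (hjlen ▸ hlenr))
  -- All c_r with r ≠ i are 0 or 1, so only the contribution 2 of i itself survives.
  have h := hD.rootLevel_sub i
  rw [Finset.sum_eq_single_of_mem i (mem_posRoots.2 (hpos i hiS))] at h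
  · rw [pairingIn_same] at h
    push_cast at h
    linarith
  · intro r hr hri
    rcases key r (mem_posRoots.1 hr) hri with h | h <;> simp [h]

/-- The Weyl vector is the only weight inside the fundamental alcove. -/
lemma eq_weylVector_of_mem_alcove (hD : IsCanonicalForm b D) {x : E} (hx : IsWeight P x)
    (h : ∀ i, b.IsPos i → 0 < P.coroot' i x ∧ P.coroot' i x < rootLevel (P := P) D i) :
    x = weylVector b := by
  by_contra hne
  have hμ : x - weylVector b ≠ 0 := sub_ne_zero.2 hne
  have hw := hx.sub (isWeight_weylVector b)
  have hdom : ∀ r, b.IsPos r → 0 ≤ D (x - weylVector b) (P.root r) := by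
    intro r hr
    rw [apply_root_eq_sum (b := b)]
    refine Finset.sum_nonneg fun f _ => mul_nonneg (by exact_mod_cast rootCoeff_nonneg hr f) ?_
    rw [hD.apply_root]
    refine div_nonneg ?_ (hD.rootLevel_pos _).le
    rw [map_sub, coroot'_weylVector b f.2]
    obtain ⟨m, hm⟩ := hx f
    have h1 := (h f (b.isPos_of_mem_support f.2)).1
    rw [hm] at h1 ⊢
    have : 0 < m := by exact_mod_cast h1
    have h2 : (1 : ℝ) ≤ m := by exact_mod_cast this
    linarith
  -- For this i, ⟨x−ρ,i^∨⟩ is a positive integer, so ⟨x,i^∨⟩ ≥ ⟨ρ,i^∨⟩ + 1 = m_i and x is not inside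
  -- the alcove.
  obtain ⟨i, hi, hpos, hlev⟩ := hD.exists_rootLevel_eq_add_one hμ hdom
  have h1 : 0 < P.coroot' i (x - weylVector b) := by
    rw [← hD.rootLevel_mul]
    exact mul_pos (hD.rootLevel_pos i) hpos
  obtain ⟨m, hm⟩ := hw i
  rw [hm] at h1
  have h2 : 0 < m := by exact_mod_cast h1
  have h3 : (1 : ℝ) ≤ m := by exact_mod_cast h2
  have h4 := (h i hi).2
  rw [map_sub] at hm
  linarith

end IsCanonicalForm

end Weyl

end Root
end ThetaBlocks
end

/-! ### Weights modulo the Weyl group and even translations -/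

noncomputable section

set_option linter.unusedSectionVars false

namespace ThetaBlocks

open RootPairing

section Root

variable {ι E M : Type*} [Fintype ι] [NormedAddCommGroup E] [InnerProductSpace ℝ E]
  [AddCommGroup M] [Module ℝ M] {P : RootPairing ι ℝ E M}

/-- The action of an element of the Weyl group as a linear map. -/
def weylMap (g : P.weylGroup) : E →ₗ[ℝ] E := P.weylGroupRootRep g

lemma weylMap_apply (g : P.weylGroup) (x : E) : weylMap g x = g • x := rfl

lemma ofIdx_smul_eq (i : ι) (x : E) : weylGroup.ofIdx P i • x = P.reflection i x := rfl

variable {b : P.Base} {D : LinearMap.BilinForm ℝ E}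

namespace IsCanonicalForm

lemma weyl (hD : IsCanonicalForm b D) (g : P.weylGroup) (x y : E) : D (g • x) (g • y) = D x y := by
  obtain ⟨g, hg⟩ := g
  change D (g • x) (g • y) = D x y
  induction hg using weylGroup.induction generalizing x y with
  | mem i => rw [Equiv.reflection_smul, Equiv.reflection_smul, hD.reflection]
  | one => simp
  | mul g h _ _ hg hh => rw [mul_smul, mul_smul, hg, hh]

lemma weyl_left (hD : IsCanonicalForm b D) (g : P.weylGroup) (x y : E) :
    D (g • x) y = D x (g⁻¹ • y) := by
  rw [← hD.weyl g x, smul_inv_smul]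

lemma apply_smul_root (hD : IsCanonicalForm b D) (g : P.weylGroup) (x : E) (i : ι) :
    D (g • x) (P.root i) = D x (P.root (P.weylGroupToPerm g⁻¹ i)) := by
  rw [hD.weyl_left, weylGroup_apply_root]

lemma coroot'_smul (hD : IsCanonicalForm b D) (g : P.weylGroup) (x : E) (i : ι) :
    P.coroot' i (g • x) = P.coroot' (P.weylGroupToPerm g⁻¹ i) x := by
  rw [← hD.rootLevel_mul, ← hD.rootLevel_mul, hD.apply_smul_root]
  congr 1
  rw [rootLevel, rootLevel, ← weylGroup_apply_root, hD.weyl]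

lemma isWeight_smul (hD : IsCanonicalForm b D) (g : P.weylGroup) {x : E} (hx : IsWeight P x) :
    IsWeight P (g • x) := fun i => by
  rw [hD.coroot'_smul]; exact hx _

lemma isEvenVector_smul (hD : IsCanonicalForm b D) (g : P.weylGroup) {x : E}
    (hx : IsEvenVector P D x) : IsEvenVector P D (g • x) :=
  ⟨fun i => by rw [hD.apply_smul_root]; exact hx.1 _, by rw [hD.weyl]; exact hx.2⟩

lemma exists_int_apply (hD : IsCanonicalForm b D) {x y : E}
    (hx : ∀ i, ∃ m : ℤ, D x (P.root i) = m) (hy : ∀ i, ∃ m : ℤ, D y (P.root i) = m) :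
    ∃ m : ℤ, D x y = m := by
  choose m hm using hx
  choose n hn using hy
  refine ⟨∑ i ∈ posRoots b, m i * n i, ?_⟩
  rw [← hD.apply_sum]
  push_cast
  simp only [hm, hn]

lemma isEvenVector_add (hD : IsCanonicalForm b D) {x y : E}
    (hx : IsEvenVector P D x) (hy : IsEvenVector P D y) : IsEvenVector P D (x + y) := by
  obtain ⟨k, hk⟩ := hD.exists_int_apply hx.1 hy.1
  obtain ⟨m, hm⟩ := hx.2
  obtain ⟨n, hn⟩ := hy.2
  refine ⟨fun i => ?_, m + n + k, ?_⟩
  · obtain ⟨m, hm⟩ := hx.1 i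
    obtain ⟨n, hn⟩ := hy.1 i
    exact ⟨m + n, by rw [map_add, LinearMap.add_apply, hm, hn]; push_cast; rfl⟩
  · simp only [map_add, LinearMap.add_apply]
    rw [hD.symm y x, hk]
    push_cast
    linarith

lemma isEvenVector_neg {x : E} (hx : IsEvenVector P D x) : IsEvenVector P D (-x) := by
  refine ⟨fun i => ?_, by simpa using hx.2⟩
  obtain ⟨m, hm⟩ := hx.1 i
  exact ⟨-m, by rw [map_neg, LinearMap.neg_apply, hm]; push_cast; rfl⟩

lemma isEvenVector_zero : IsEvenVector P D 0 := ⟨fun i => ⟨0, by simp⟩, 0, by simp⟩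

variable [P.IsCrystallographic] [P.IsReduced]

/-- Composed with the reflection in r, these translations give the affine reflections in the walls
⟨x,r^∨⟩ = k m_r. The half norm of k m_r r is k² m_r. -/
lemma isEvenVector_rootLevel_smul (hD : IsCanonicalForm b D) (i : ι) (k : ℤ) :
    IsEvenVector P D (((k : ℝ) * rootLevel (P := P) D i) • P.root i) := by
  have h0 := (hD.rootLevel_pos i).ne'
  obtain ⟨m, -, hm⟩ := hD.exists_rootLevel_eq i
  refine ⟨fun j => ⟨k * P.pairingIn ℤ j i, ?_⟩, k ^ 2 * m, ?_⟩
  · rw [map_smul, LinearMap.smul_apply, hD.symm, hD.apply_root, coroot'_root, smul_eq_mul]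
    push_cast
    field_simp
  · rw [map_smul, map_smul, LinearMap.smul_apply, hD.root_self, smul_eq_mul, smul_eq_mul]
    push_cast
    rw [← hm]
    field_simp

/-- The norm of a weight, multiplied by a common denominator, is a natural number. -/
lemma exists_natCast_eq (hD : IsCanonicalForm b D) :
    ∃ K : ℕ, 0 < K ∧ ∀ x, IsWeight P x → ∃ n : ℕ, (K : ℝ) * D x x = n := by
  choose m hm0 hm using fun i => hD.exists_rootLevel_eq (P := P) i
  have hM : 0 < ∏ i, m i := Finset.prod_pos fun i _ => hm0 i
  -- For a weight x, the product of all levels clears the denominator of every D(x,r); its square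
  -- therefore clears that of D(x,x) = ∑ D(x,r)².
  refine ⟨((∏ i, m i) ^ 2).toNat, by have := pow_pos hM 2; omega, fun x hx => ?_⟩
  have hcast : ((((∏ i, m i) ^ 2).toNat : ℕ) : ℝ) = ((∏ i, m i : ℤ) : ℝ) ^ 2 := by
    rw [← Int.cast_natCast, Int.toNat_of_nonneg (pow_pos hM 2).le]
    push_cast
    rfl
  choose n hn using hx
  have hdvd : ∀ i, ∃ k : ℤ, ((∏ i, m i : ℤ) : ℝ) * D x (P.root i) = k := by
    intro i
    obtain ⟨l, hl⟩ := Finset.dvd_prod_of_mem m (Finset.mem_univ i)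
    refine ⟨l * n i, ?_⟩
    rw [hl, hD.apply_root, hn, hm]
    have : (m i : ℝ) ≠ 0 := by exact_mod_cast (hm0 i).ne'
    push_cast
    field_simp
  choose k hk using hdvd
  refine ⟨(∑ i ∈ posRoots b, k i ^ 2).toNat, ?_⟩
  rw [hcast, ← hD.apply_sum, Finset.mul_sum, ← Int.cast_natCast, Int.toNat_of_nonneg
    (Finset.sum_nonneg fun i _ => sq_nonneg _)]
  push_cast
  refine Finset.sum_congr rfl fun i _ => ?_
  rw [← hk]
  push_cast
  ring

/-- Modulo the Weyl group and the even lattice, every weight is equivalent to the Weyl vector or to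
a weight on a wall of the fundamental alcove. -/
theorem exists_smul_add_eq (hD : IsCanonicalForm b D) {x : E} (hx : IsWeight P x) :
    ∃ (g : P.weylGroup) (y : E), IsEvenVector P D y ∧
      (g • x + y = weylVector b ∨
        ∃ (i : ι) (k : ℤ), b.IsPos i ∧ P.coroot' i (g • x + y) = k * rootLevel (P := P) D i) := by
  classical
  obtain ⟨K, hK, hnat⟩ := hD.exists_natCast_eq
  have hweight : ∀ (g : P.weylGroup) (y : E), IsEvenVector P D y → IsWeight P (g • x + y) := by
    intro g y hy
    refine (hD.isWeight_smul g hx).add fun i => ?_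
    obtain ⟨m, -, hm⟩ := hD.exists_rootLevel_eq i
    obtain ⟨n, hn⟩ := hy.1 i
    exact ⟨m * n, by rw [← hD.rootLevel_mul, hm, hn]; push_cast; rfl⟩
  -- Choose the point of the orbit closest to ρ. It exists because the scaled squared distances are
  -- natural numbers.
  let p : ℕ → Prop := fun n => ∃ (g : P.weylGroup) (y : E), IsEvenVector P D y ∧
    (K : ℝ) * D (g • x + y - weylVector b) (g • x + y - weylVector b) = n
  have hp : ∃ n, p n := by
    obtain ⟨n, hn⟩ := hnat _ ((hweight 1 0 isEvenVector_zero).sub (isWeight_weylVector b))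
    exact ⟨n, 1, 0, isEvenVector_zero, hn⟩
  obtain ⟨g, y, hy, hgy⟩ := Nat.find_spec hp
  refine ⟨g, y, hy, ?_⟩
  have hmin : ∀ (g' : P.weylGroup) (y' : E), IsEvenVector P D y' →
      D (g • x + y - weylVector b) (g • x + y - weylVector b) ≤
        D (g' • x + y' - weylVector b) (g' • x + y' - weylVector b) := by
    intro g' y' hy'
    obtain ⟨n, hn⟩ := hnat _ ((hweight g' y' hy').sub (isWeight_weylVector b))
    have h1 : Nat.find hp ≤ n := Nat.find_min' hp ⟨g', y', hy', hn⟩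
    have hK' : (0 : ℝ) < K := by exact_mod_cast hK
    refine le_of_mul_le_mul_left ?_ hK'
    rw [hgy, hn]
    exact_mod_cast h1
  set z := g • x + y with hz
  -- Reflecting z in the wall ⟨·,i^∨⟩ = k m_i changes the squared distance to ρ by 2/m_i times this
  -- product. Minimality thus says that no wall strictly separates z from ρ.
  have hwall : ∀ i (k : ℤ), 0 ≤ (k * rootLevel (P := P) D i - P.coroot' i z) *
      (k * rootLevel (P := P) D i - P.coroot' i (weylVector b)) := by
    intro i k
    have hy' := hD.isEvenVector_add (hD.isEvenVector_smul (weylGroup.ofIdx P i) hy)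
      (hD.isEvenVector_rootLevel_smul i k)
    have h := hmin (weylGroup.ofIdx P i * g) _ hy'
    have hm := hD.rootLevel_pos i
    set m := rootLevel (P := P) D i with hmdef
    have heq : (weylGroup.ofIdx P i * g) • x +
        (weylGroup.ofIdx P i • y + ((k : ℝ) * m) • P.root i) - weylVector b =
        (z - weylVector b) + (k * m - P.coroot' i z) • P.root i := by
      rw [mul_smul, ← add_assoc, ← smul_add, ← hz, ofIdx_smul_eq, reflection_apply, sub_smul]
      abel
    rw [heq] at h
    have hu : P.coroot' i (z - weylVector b) = P.coroot' i z - P.coroot' i (weylVector b) :=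
      map_sub _ _ _
    generalize z - weylVector b = u at h hu
    simp only [map_add, map_smul, LinearMap.add_apply, LinearMap.smul_apply, smul_eq_mul] at h
    rw [hD.symm (P.root i) u, hD.apply_root, hD.root_self, hu, ← hmdef] at h
    have h2 : 0 ≤ 2 / m * ((k * m - P.coroot' i z) * (k * m - P.coroot' i (weylVector b))) := by
      have : 2 / m * ((k * m - P.coroot' i z) * (k * m - P.coroot' i (weylVector b))) =
        (k * m - P.coroot' i z) * ((P.coroot' i z - P.coroot' i (weylVector b)) / m) +
        ((k * m - P.coroot' i z) * ((P.coroot' i z - P.coroot' i (weylVector b)) / m) +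
         (k * m - P.coroot' i z) * ((k * m - P.coroot' i z) * (2 / m))) := by ring
      rw [this]
      nlinarith
    exact nonneg_of_mul_nonneg_right h2 (by positivity)
  by_cases hreg : ∃ (i : ι) (k : ℤ), b.IsPos i ∧ P.coroot' i z = k * rootLevel (P := P) D i
  · exact Or.inr hreg
  · left
    push Not at hreg
    -- As z lies on no wall, the walls k = 0 and k = 1 confine it to the open alcove that contains
    -- ρ.
    refine hD.eq_weylVector_of_mem_alcove (hweight g y hy) fun i hi => ?_
    have h0 := hwall i 0
    have h1 := hwall i 1
    have h2 := hD.coroot'_weylVector_pos hi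
    have h3 := hD.coroot'_weylVector_lt hi
    have h4 := hreg i 0 hi
    have h5 := hreg i 1 hi
    push_cast at h0 h1 h4 h5
    rw [zero_mul] at h0 h4
    rw [one_mul] at h1 h5
    constructor
    · refine lt_of_le_of_ne ?_ (Ne.symm h4)
      by_contra! hlt
      nlinarith [mul_pos (neg_pos.2 hlt) h2]
    · refine lt_of_le_of_ne ?_ h5
      by_contra! hlt
      nlinarith [mul_pos (sub_pos.2 hlt) (sub_pos.2 h3)]

end IsCanonicalForm

end Root

end ThetaBlocks
end

/-! ### Multiplying series, and signs of Weyl group elements -/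

noncomputable section

set_option linter.unusedSectionVars false

namespace ThetaBlocks

open RootPairing

/-- A finite product of absolutely convergent series over `ℤ`. -/
lemma hasSum_prod_fin (n : ℕ) (f : Fin n → ℤ → ℂ) (hf : ∀ i, Summable fun k => ‖f i k‖) :
    (Summable fun r : Fin n → ℤ => ‖∏ i, f i (r i)‖) ∧
      HasSum (fun r : Fin n → ℤ => ∏ i, f i (r i)) (∏ i, ∑' k, f i k) := by
  induction n with
  | zero =>
    refine ⟨(hasSum_fintype _).summable, ?_⟩
    convert hasSum_fintype (fun r : Fin 0 → ℤ => ∏ i, f i (r i)) using 1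
    rw [Fintype.sum_unique, Finset.univ_eq_empty, Finset.prod_empty, Finset.prod_empty]
  | succ n ih =>
    obtain ⟨h1, h2⟩ := ih (fun i => f i.succ) fun i => hf i.succ
    have hp : Summable fun x : ℤ × (Fin n → ℤ) => ‖f 0 x.1 * ∏ i : Fin n, f i.succ (x.2 i)‖ :=
      Summable.mul_norm (g := fun r : Fin n → ℤ => ∏ i : Fin n, f i.succ (r i)) (hf 0) h1
    have hs : HasSum (fun x : ℤ × (Fin n → ℤ) => f 0 x.1 * ∏ i : Fin n, f i.succ (x.2 i))
        ((∑' k, f 0 k) * ∏ i : Fin n, ∑' k, f i.succ k) :=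
      HasSum.mul (g := fun r : Fin n → ℤ => ∏ i : Fin n, f i.succ (r i))
        (hf 0).of_norm.hasSum h2 hp.of_norm
    let ε : ℤ × (Fin n → ℤ) ≃ (Fin (n + 1) → ℤ) := Fin.consEquiv fun _ => ℤ
    have hε : ∀ x, ∏ i, f i (ε x i) = f 0 x.1 * ∏ i : Fin n, f i.succ (x.2 i) := fun x => by
      rw [Fin.prod_univ_succ]
      rfl
    rw [← ε.summable_iff, ← ε.hasSum_iff, Fin.prod_univ_succ]
    simp only [Function.comp_def, hε]
    exact ⟨hp, hs⟩

lemma hasSum_prod_fintype {I : Type*} [Fintype I] (f : I → ℤ → ℂ)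
    (hf : ∀ i, Summable fun k => ‖f i k‖) :
    (Summable fun r : I → ℤ => ‖∏ i, f i (r i)‖) ∧
      HasSum (fun r : I → ℤ => ∏ i, f i (r i)) (∏ i, ∑' k, f i k) := by
  let ε := Fintype.equivFin I
  obtain ⟨h1, h2⟩ := hasSum_prod_fin _ (fun i => f (ε.symm i)) fun i => hf _
  let ε' : (I → ℤ) ≃ (Fin (Fintype.card I) → ℤ) := ε.arrowCongr (Equiv.refl ℤ)
  have h3 : ∀ r : I → ℤ, ∏ i, f (ε.symm i) (ε' r i) = ∏ i, f i (r i) := fun r =>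
    (Equiv.prod_comp ε.symm fun i => f i (r i))
  rw [← ε'.summable_iff] at h1
  rw [← ε'.hasSum_iff] at h2
  rw [Equiv.prod_comp ε.symm fun i => ∑' k, f i k] at h2
  simp only [Function.comp_def, h3] at h1 h2
  exact ⟨h1, h2⟩

/-- Grouping the terms of an absolutely convergent series along the fibres of a map. -/
lemma hasSum_fiberwise {α β : Type*} [DecidableEq β] (f : α → β) {F : α → ℂ} {a : ℂ}
    (hF : HasSum F a) :
    HasSum (fun y => ∑' x, if f x = y then F x else 0) a := by
  rw [← (Equiv.sigmaFiberEquiv f).hasSum_iff] at hF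
  have h := hF.sigma fun y => (hF.summable.sigma_factor y).hasSum
  refine h.congr_fun fun y => ?_
  have h2 := tsum_subtype {x | f x = y} F
  simp only [Set.indicator_apply, Set.mem_ofPred_eq] at h2
  rw [← h2]
  rfl

section Root

variable {ι E M : Type*} [Fintype ι] [NormedAddCommGroup E] [InnerProductSpace ℝ E]
  [AddCommGroup M] [Module ℝ M] {P : RootPairing ι ℝ E M} (b : P.Base)

lemma weylGroupToPerm_neg (g : P.weylGroup) (i : ι) :
    P.weylGroupToPerm g (P.reflectionPerm i i) =
      P.reflectionPerm (P.weylGroupToPerm g i) (P.weylGroupToPerm g i) := by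
  apply P.root.injective
  rw [root_neg, ← weylGroup_apply_root, ← weylGroup_apply_root, root_neg, smul_neg]

variable {b} in
lemma neg_mem_posRoots {i : ι} (hi : i ∉ posRoots b) : P.reflectionPerm i i ∈ posRoots b := by
  rw [mem_posRoots] at hi ⊢
  exact isPos_neg_iff.2 hi

open Classical in
/-- The extension of a function on the positive roots to an odd function on all roots. -/
def oddExt {R : Type*} [Neg R] (r : posRoots b → R) (i : ι) : R :=
  if h : i ∈ posRoots b then r ⟨i, h⟩ else -r ⟨P.reflectionPerm i i, neg_mem_posRoots h⟩

lemma oddExt_coe {R : Type*} [Neg R] (r : posRoots b → R) (i : posRoots b) :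
    oddExt b r i = r i := by
  simp [oddExt]

lemma oddExt_neg (r : posRoots b → ℤ) (i : ι) :
    oddExt b r (P.reflectionPerm i i) = -oddExt b r i := by
  by_cases h : i ∈ posRoots b
  · have h2 : P.reflectionPerm i i ∉ posRoots b := by
      rw [mem_posRoots] at h ⊢
      exact fun h' => isPos_neg_iff.1 h' h
    simp [oddExt, h, h2, reflectionPerm_reflectionPerm_self]
  · simp [oddExt, h, neg_mem_posRoots h]

/-- The action of the Weyl group on odd functions on the roots, restricted to positive roots. -/
def oddAct (g : P.weylGroup) (r : posRoots b → ℤ) (i : posRoots b) : ℤ :=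
  oddExt b r (P.weylGroupToPerm g i)

lemma oddExt_oddAct (g : P.weylGroup) (r : posRoots b → ℤ) (i : ι) :
    oddExt b (oddAct b g r) i = oddExt b r (P.weylGroupToPerm g i) := by
  by_cases h : i ∈ posRoots b
  · exact oddExt_coe b _ ⟨i, h⟩
  · have h2 := oddExt_coe b (oddAct b g r) ⟨_, neg_mem_posRoots h⟩
    rw [oddExt_neg] at h2
    rw [← neg_inj, h2, oddAct, weylGroupToPerm_neg, oddExt_neg]

/-- `oddAct` as a bijection. -/
def oddActEquiv (g : P.weylGroup) : (posRoots b → ℤ) ≃ (posRoots b → ℤ) where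
  toFun := oddAct b g
  invFun := oddAct b g⁻¹
  left_inv r := by
    ext i
    change oddExt b (oddAct b g r) _ = _
    rw [oddExt_oddAct, ← Equiv.Perm.mul_apply, ← map_mul, mul_inv_cancel, map_one]
    exact oddExt_coe b r i
  right_inv r := by
    ext i
    change oddExt b (oddAct b g⁻¹ r) _ = _
    rw [oddExt_oddAct, ← Equiv.Perm.mul_apply, ← map_mul, inv_mul_cancel, map_one]
    exact oddExt_coe b r i

lemma sum_eq_two_nsmul_sum_posRoots {A : Type*} [AddCommMonoid A] (F : ι → A)
    (hF : ∀ i, F (P.reflectionPerm i i) = F i) :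
    ∑ i, F i = 2 • ∑ i ∈ posRoots b, F i := by
  classical
  rw [← Finset.sum_add_sum_compl (posRoots b) F, two_nsmul]
  congr 1
  refine Finset.sum_nbij' (fun i => P.reflectionPerm i i) (fun i => P.reflectionPerm i i) ?_ ?_ ?_
    ?_ ?_
  · intro i hi
    exact neg_mem_posRoots (Finset.mem_compl.1 hi)
  · intro i hi
    rw [mem_posRoots] at hi
    rw [Finset.mem_compl, mem_posRoots]
    exact fun h' => isPos_neg_iff.1 h' hi
  · intro i _; exact reflectionPerm_reflectionPerm_self i
  · intro i _; exact reflectionPerm_reflectionPerm_self i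
  · intro i _; exact (hF i).symm

/-- A Weyl group element changes the product of an odd function over the positive roots by the
sign `(-1)^{ℓ(g)}`. -/
lemma prod_weylGroupToPerm {A : Type*} [CommRing A] (F : ι → A)
    (hF : ∀ i, F (P.reflectionPerm i i) = -F i) (g : P.weylGroup) :
    ∏ i ∈ posRoots b, F (P.weylGroupToPerm g i) =
      (-1) ^ weylLength b g * ∏ i ∈ posRoots b, F i := by
  classical
  let σ := P.weylGroupToPerm g
  -- This map picks the positive member of each pair ±i. Following g by it permutes the positive
  -- roots, so only the signs of the roots made negative remain.
  let p : ι → ι := fun i => if i ∈ posRoots b then i else P.reflectionPerm i i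
  have hp : ∀ i, p i ∈ posRoots b := by
    intro i
    by_cases h : i ∈ posRoots b
    · simp [p, h]
    · simp [p, h, neg_mem_posRoots h]
  have hpp : ∀ i, p (P.reflectionPerm i i) = p i := by
    intro i
    by_cases h : i ∈ posRoots b
    · have h2 : P.reflectionPerm i i ∉ posRoots b := by
        rw [mem_posRoots] at h ⊢
        exact fun h' => isPos_neg_iff.1 h' h
      simp [p, h, h2, reflectionPerm_reflectionPerm_self]
    · simp [p, h, neg_mem_posRoots h]
  have hpσ : ∀ (τ : P.weylGroup) (i : ι),
      p (P.weylGroupToPerm τ (p i)) = p (P.weylGroupToPerm τ i) := by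
    intro τ i
    by_cases h : i ∈ posRoots b
    · simp [p, h]
    · have : p i = P.reflectionPerm i i := by simp [p, h]
      rw [this, weylGroupToPerm_neg, hpp]
  have hpid : ∀ i ∈ posRoots b, p i = i := fun i hi => by simp [p, hi]
  have h1 : ∀ i, F i = (if i ∈ posRoots b then 1 else -1) * F (p i) := by
    intro i
    by_cases h : i ∈ posRoots b
    · simp [p, h]
    · simp [p, h, hF]
  have h2 : ∏ i ∈ posRoots b, F (p (σ i)) = ∏ i ∈ posRoots b, F i := by
    refine Finset.prod_nbij' (fun i => p (σ i)) (fun i => p (P.weylGroupToPerm g⁻¹ i)) ?_ ?_ ?_ ?_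
      ?_
    · intro i _; exact hp _
    · intro i _; exact hp _
    · intro i hi
      simp only [σ]
      rw [hpσ, ← Equiv.Perm.mul_apply, ← map_mul, inv_mul_cancel, map_one]
      exact hpid i hi
    · intro i hi
      simp only [σ]
      rw [hpσ, ← Equiv.Perm.mul_apply, ← map_mul, mul_inv_cancel, map_one]
      exact hpid i hi
    · intro i _; rfl
  rw [Finset.prod_congr rfl fun i _ => h1 (P.weylGroupToPerm g i), Finset.prod_mul_distrib, h2,
    Finset.prod_ite, Finset.prod_const_one, one_mul, Finset.prod_const, weylLength]
  congr 3
  ext i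
  simp only [Finset.mem_filter, mem_posRoots]

/-- The map r ↦ −s_i(r) is a fixed-point-free involution on the positive roots other than i that s_i
makes negative. With i itself their number is odd. The root i need not be simple. -/
lemma neg_one_pow_weylLength_ofIdx [P.IsCrystallographic] [P.IsReduced] {i : ι} (hi : b.IsPos i) :
    (-1 : ℂ) ^ weylLength b (weylGroup.ofIdx P i) = -1 := by
  classical
  set σ := P.weylGroupToPerm (weylGroup.ofIdx P i) with hσ
  have hroot : ∀ r, P.root (σ r) = P.reflection i (P.root r) := fun r => by
    rw [hσ, ← weylGroup_apply_root, ofIdx_smul_eq]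
  set A := (posRoots b).filter fun r => ¬ b.IsPos (σ r) with hA
  have hiA : i ∈ A := by
    rw [hA, Finset.mem_filter, mem_posRoots]
    refine ⟨hi, ?_⟩
    have : σ i = P.reflectionPerm i i := P.root.injective (by
      rw [hroot, reflection_apply_self, root_neg])
    rw [this]
    exact fun h => isPos_neg_iff.1 h hi
  have hodd : ((A.erase i).card : ZMod 2) = 0 := by
    have : ∑ r ∈ A.erase i, (1 : ZMod 2) = 0 := by
      have hφ : ∀ r, P.root (P.reflectionPerm (σ r) (σ r)) = -P.reflection i (P.root r) :=
        fun r => by rw [root_neg, hroot]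
      refine Finset.sum_involution (fun r _ => P.reflectionPerm (σ r) (σ r)) ?_ ?_ ?_ ?_
      · intro r _; decide
      -- A fixed point would satisfy 2r = ⟨r,i^∨⟩ i, so the product of the two pairings would be 4,
      -- which is impossible for r ≠ ±i in a reduced system.
      · intro r hr _ heq
        have hr' := Finset.mem_erase.1 hr
        have hrpos := mem_posRoots.1 (Finset.mem_filter.1 hr'.2).1
        have h1 := hφ r
        rw [heq, reflection_apply] at h1
        have h2 := congrArg (P.coroot' r) h1
        have hrne : P.root r ≠ -P.root i := by
          rw [← root_neg]
          intro h
          rw [P.root.injective h] at hrpos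
          exact isPos_neg_iff.1 hrpos hi
        have hmem := P.pairingIn_pairingIn_mem_set_of_isCrystal_of_isRed' r i
          (fun h => hr'.1 (P.root.injective h)) hrne
        rw [map_neg, map_sub, map_smul, coroot'_root, coroot'_root, coroot'_root, pairingIn_same,
          smul_eq_mul] at h2
        have h3 : (P.pairingIn ℤ r i * P.pairingIn ℤ i r : ℤ) = 4 := by
          have : (P.pairingIn ℤ r i : ℝ) * P.pairingIn ℤ i r = 4 := by
            push_cast at h2; linarith
          exact_mod_cast this
        simp only [Set.mem_insert_iff, Set.mem_singleton_iff, Prod.mk.injEq] at hmem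
        rcases hmem with h | h | h | h | h | h | h | h | h | h | h <;>
          · rw [h.1, h.2] at h3; norm_num at h3
      · intro r hr
        have hr' := Finset.mem_erase.1 hr
        have h1 := Finset.mem_filter.1 hr'.2
        have hinv : σ (P.reflectionPerm (σ r) (σ r)) = P.reflectionPerm r r :=
          P.root.injective (by rw [hroot, hφ, map_neg, reflection_same, root_neg])
        rw [Finset.mem_erase, hA, Finset.mem_filter, mem_posRoots, hinv]
        refine ⟨fun h => hr'.1 ?_, isPos_neg_iff.2 h1.2, fun h => ?_⟩
        · apply P.root.injective
          have := hφ r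
          rw [h, eq_neg_iff_add_eq_zero, add_comm, ← eq_neg_iff_add_eq_zero] at this
          rw [← P.reflection_same i (P.root r), this, map_neg, reflection_apply_self, neg_neg]
        · exact isPos_neg_iff.1 h (mem_posRoots.1 h1.1)
      · intro r hr
        apply P.root.injective
        rw [hφ, hφ, map_neg, reflection_same, neg_neg]
    simpa using this
  have hcard : weylLength b (weylGroup.ofIdx P i) = (A.erase i).card + 1 := by
    rw [Finset.card_erase_add_one hiA]
    rfl
  rw [hcard, (Even.add_one ((ZMod.natCast_eq_zero_iff_even).1 hodd)).neg_one_pow]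

end Root

end ThetaBlocks
end

/-! ### Theta decomposition of the product of theta functions -/

noncomputable section

set_option linter.unusedSectionVars false

namespace ThetaBlocks

open RootPairing

section Root

variable {ι E M : Type*} [Fintype ι] [NormedAddCommGroup E] [InnerProductSpace ℝ E]
  [AddCommGroup M] [Module ℝ M] {P : RootPairing ι ℝ E M} {b : P.Base}

/-- `½ ∑_{i ∈ R⁺} r_i α_i`. -/
def halfSum (r : posRoots b → ℤ) : E := (1 / 2 : ℝ) • ∑ i, (r i : ℝ) • P.root i

/-- The product of the Kronecker symbols `(-4/r_i)`. -/
def signProd (r : posRoots b → ℤ) : ℂ := ∏ i, (ZMod.χ₄ (r i : ZMod 4) : ℂ)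

/-- `⅛ ∑ r_i² - ½ D(λ,λ)`, where `λ = ½ ∑ r_i α_i`. -/
def defect (D : LinearMap.BilinForm ℝ E) (r : posRoots b → ℤ) : ℝ :=
  (∑ i, (r i : ℝ) ^ 2) / 8 - D (halfSum r) (halfSum r) / 2

/-- A term of the series for the theta decomposition of a product of theta functions. -/
def defectTerm (D : LinearMap.BilinForm ℝ E) (k : ℕ) (τ : ℂ) (r : posRoots b → ℤ) : ℂ :=
  signProd r * ((defect D r : ℂ) ^ k * e (τ * defect D r))

open Classical in
/-- The coefficient at `x` of the theta decomposition of a product of theta functions. -/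
def fiberCoeff (b : P.Base) (D : LinearMap.BilinForm ℝ E) (k : ℕ) (x : E) (τ : ℂ) : ℂ :=
  ∑' r : posRoots b → ℤ, if halfSum r = x then defectTerm D k τ r else 0

section Expansion

variable (D : LinearMap.BilinForm ℝ E)

lemma apply_halfSum (ζ : E →ₗ[ℝ] ℂ) (r : posRoots b → ℤ) :
    ζ (halfSum r) = ∑ i, (r i : ℂ) / 2 * ζ (P.root i) := by
  rw [halfSum, map_smul, map_sum, Finset.smul_sum]
  refine Finset.sum_congr rfl fun i _ => ?_
  rw [map_smul, smul_smul, Complex.real_smul]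
  push_cast
  ring

/-- Written as a quadratic polynomial in the r_i, the defect is the symbol of a second order
differential operator. Inserting it into the series therefore produces `heatProd`. -/
lemma defect_eq (r : posRoots b → ℤ) :
    defect D r = (∑ i, (r i : ℝ) * r i -
      ∑ i : posRoots b, ∑ j : posRoots b, D (P.root (i : ι)) (P.root (j : ι)) * ((r i : ℝ) * r j)) / 8 := by
  rw [defect, halfSum]
  simp only [map_smul, LinearMap.smul_apply, map_sum, LinearMap.sum_apply, smul_eq_mul,
    Finset.mul_sum, Finset.sum_div, sub_div]
  congr 1
  · exact Finset.sum_congr rfl fun i _ => by rw [sq]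
  · rw [Finset.sum_comm]
    refine Finset.sum_congr rfl fun i _ => ?_
    refine Finset.sum_congr rfl fun j _ => ?_
    ring

/-- The exponents of a product of theta functions with two derivatives. -/
def twoDer {I : Type*} [DecidableEq I] (i j l : I) : ℕ :=
  (if l = i then 1 else 0) + (if l = j then 1 else 0)

lemma prod_pow_twoDer {I : Type*} [Fintype I] [DecidableEq I] (i j : I) (r : I → ℂ) :
    ∏ l, r l ^ twoDer i j l = r i * r j := by
  simp only [twoDer, pow_add, Finset.prod_mul_distrib, pow_ite, pow_one, pow_zero]
  simp

lemma prod_thetaTerm_zero (τ : ℂ) (ζ : E →ₗ[ℝ] ℂ) (r : posRoots b → ℤ) :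
    ∏ i : posRoots b, thetaTerm 0 τ (ζ (P.root i)) (r i) =
      defectTerm D 0 τ r *
        (e (τ * ((D (halfSum r) (halfSum r) / 2 : ℝ) : ℂ)) * e (ζ (halfSum r))) := by
  simp only [thetaTerm, pow_zero, one_mul, Finset.prod_mul_distrib]
  rw [apply_halfSum, ← e_sum, ← e_sum, defectTerm, signProd, ← mul_assoc, pow_zero, one_mul,
    mul_assoc _ (e (τ * _)) (e (τ * _)), ← e_add, ← mul_add, ← Finset.mul_sum,
    ← Complex.ofReal_add, defect, sub_add_cancel]
  push_cast
  rw [Finset.sum_div]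

lemma prod_thetaTerm_twoDer [DecidableEq (posRoots b)] (τ : ℂ) (v : posRoots b → ℂ)
    (i j : posRoots b) (r : posRoots b → ℤ) :
    ∏ l, thetaTerm (twoDer i j l) τ (v l) (r l) =
      (r i : ℂ) * r j * ∏ l, thetaTerm 0 τ (v l) (r l) := by
  rw [← prod_pow_twoDer i j fun l => (r l : ℂ), ← Finset.prod_mul_distrib]
  exact Finset.prod_congr rfl fun l _ => by simp [thetaTerm]

/-- The full terms of the expansion of a product of theta functions. -/
def expansionTerm (k : ℕ) (τ : ℂ) (ζ : E →ₗ[ℝ] ℂ) (r : posRoots b → ℤ) : ℂ :=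
  defectTerm D k τ r * (e (τ * ((D (halfSum r) (halfSum r) / 2 : ℝ) : ℂ)) * e (ζ (halfSum r)))

lemma expansionTerm_zero {τ : ℂ} (hτ : 0 < τ.im) (ζ : E →ₗ[ℝ] ℂ) :
    (Summable fun r : posRoots b → ℤ => ‖expansionTerm D 0 τ ζ r‖) ∧
      HasSum (expansionTerm (b := b) D 0 τ ζ)
        (∏ i : posRoots b, thetaDer 0 τ (ζ (P.root i))) := by
  have h := hasSum_prod_fintype (fun i : posRoots b => thetaTerm 0 τ (ζ (P.root i)))
    fun i => summable_thetaTerm 0 hτ _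
  simp only [prod_thetaTerm_zero D] at h
  exact h

/-- The value of the heat operator on a product of theta functions. -/
def heatProd [DecidableEq (posRoots b)] (τ : ℂ) (v : posRoots b → ℂ) : ℂ :=
  (∑ i, ∏ l, thetaDer (twoDer i i l) τ (v l) -
    ∑ i : posRoots b, ∑ j : posRoots b, (D (P.root (i : ι)) (P.root (j : ι)) : ℂ) *
      ∏ l, thetaDer (twoDer i j l) τ (v l)) / 8

lemma hasSum_sub_sum_mul {α I : Type*} [Fintype I] {T : I → I → α → ℂ} {S : I → I → ℂ}
    (d : I → I → ℂ) (h : ∀ i j, HasSum (T i j) (S i j)) :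
    HasSum (fun r => (∑ i, T i i r - ∑ i, ∑ j, d i j * T i j r) / 8)
      ((∑ i, S i i - ∑ i, ∑ j, d i j * S i j) / 8) :=
  ((hasSum_sum fun i _ => h i i).sub
    (hasSum_sum fun i _ => hasSum_sum fun j _ => (h i j).mul_left _)).div_const _

lemma expansionTerm_one [DecidableEq (posRoots b)] {τ : ℂ} (hτ : 0 < τ.im) (ζ : E →ₗ[ℝ] ℂ) :
    (Summable fun r : posRoots b → ℤ => ‖expansionTerm D 1 τ ζ r‖) ∧
      HasSum (expansionTerm (b := b) D 1 τ ζ) (heatProd D τ fun i : posRoots b => ζ (P.root i)) := by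
  have h := fun i j : posRoots b =>
    hasSum_prod_fintype (fun l : posRoots b => thetaTerm (twoDer i j l) τ (ζ (P.root l)))
      fun l => summable_thetaTerm _ hτ _
  have heq : ∀ r : posRoots b → ℤ, expansionTerm D 1 τ ζ r =
      (∑ i : posRoots b, ∏ l : posRoots b,
          thetaTerm (twoDer i i l) τ (ζ (P.root l)) (r l) -
        ∑ i : posRoots b, ∑ j : posRoots b, (D (P.root (i : ι)) (P.root (j : ι)) : ℂ) *
          ∏ l : posRoots b, thetaTerm (twoDer i j l) τ (ζ (P.root l)) (r l)) / 8 := by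
    intro r
    have h1 : expansionTerm D 1 τ ζ r =
        (defect D r : ℂ) * ∏ i : posRoots b, thetaTerm 0 τ (ζ (P.root i)) (r i) := by
      rw [prod_thetaTerm_zero D, expansionTerm, defectTerm, defectTerm]
      ring
    simp only [prod_thetaTerm_twoDer]
    rw [h1, defect_eq]
    push_cast
    rw [div_mul_eq_mul_div, sub_mul, Finset.sum_mul, Finset.sum_mul]
    simp only [Finset.sum_mul, mul_assoc]
  have h2 := hasSum_sub_sum_mul (fun i j : posRoots b => (D (P.root (i : ι)) (P.root (j : ι)) : ℂ))
    (T := fun (i j : posRoots b) (r : posRoots b → ℤ) =>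
      ∏ l : posRoots b, thetaTerm (twoDer i j l) τ (ζ (P.root l)) (r l))
    (S := fun i j : posRoots b => ∏ l : posRoots b, thetaDer (twoDer i j l) τ (ζ (P.root l)))
    fun i j => (h i j).2
  have h3 : HasSum (expansionTerm (b := b) D 1 τ ζ) (heatProd D τ fun i : posRoots b => ζ (P.root i)) := by
    rw [funext heq]
    exact h2
  exact ⟨h3.summable.norm, h3⟩

lemma fiberCoeff_mul (k : ℕ) (τ : ℂ) (ζ : E →ₗ[ℝ] ℂ) (x : E) [DecidableEq E] :
    fiberCoeff b D k x τ * (e (τ * ((D x x / 2 : ℝ) : ℂ)) * e (ζ x)) =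
      ∑' r : posRoots b → ℤ, if halfSum r = x then expansionTerm D k τ ζ r else 0 := by
  rw [fiberCoeff, ← tsum_mul_right]
  refine tsum_congr fun r => ?_
  by_cases h : halfSum r = x
  · rw [if_pos h, if_pos h, expansionTerm, h]
  · rw [if_neg h, if_neg h, zero_mul]

/-- The theta decomposition of a product of theta functions. -/
lemma hasSum_fiberCoeff_zero {τ : ℂ} (hτ : 0 < τ.im) (ζ : E →ₗ[ℝ] ℂ) :
    HasSum (fun x => fiberCoeff b D 0 x τ * (e (τ * ((D x x / 2 : ℝ) : ℂ)) * e (ζ x)))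
      (∏ i : posRoots b, thetaDer 0 τ (ζ (P.root i))) := by
  classical
  simp only [fiberCoeff_mul]
  exact hasSum_fiberwise halfSum (expansionTerm_zero D hτ ζ).2

lemma hasSum_fiberCoeff_one [DecidableEq (posRoots b)] {τ : ℂ} (hτ : 0 < τ.im)
    (ζ : E →ₗ[ℝ] ℂ) :
    HasSum (fun x => fiberCoeff b D 1 x τ * (e (τ * ((D x x / 2 : ℝ) : ℂ)) * e (ζ x)))
      (heatProd D τ fun i : posRoots b => ζ (P.root i)) := by
  classical
  simp only [fiberCoeff_mul]
  exact hasSum_fiberwise halfSum (expansionTerm_one D hτ ζ).2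

end Expansion

/-! ### Symmetries of the coefficients -/

/-- The odd extension to all roots removes the choice of positive roots, so the Weyl group acts
merely by reindexing. -/
lemma halfSum_eq_sum (r : posRoots b → ℤ) :
    halfSum r = (1 / 4 : ℝ) • ∑ i, ((oddExt b r i : ℤ) : ℝ) • P.root i := by
  rw [sum_eq_two_nsmul_sum_posRoots b, ← Finset.sum_coe_sort, halfSum]
  · simp only [oddExt_coe]
    rw [two_nsmul, smul_add, ← add_smul]
    norm_num
  · intro i
    rw [oddExt_neg, root_neg]
    push_cast
    rw [neg_smul_neg]

lemma halfSum_oddAct (g : P.weylGroup) (r : posRoots b → ℤ) :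
    halfSum (oddAct b g r) = g⁻¹ • halfSum r := by
  rw [← weylMap_apply, halfSum_eq_sum, halfSum_eq_sum, map_smul, map_sum]
  congr 1
  rw [← Equiv.sum_comp (P.weylGroupToPerm g) fun i => weylMap g⁻¹ _]
  refine Finset.sum_congr rfl fun i _ => ?_
  rw [oddExt_oddAct, map_smul, weylMap_apply, weylGroup_apply_root, ← Equiv.Perm.mul_apply,
    ← map_mul, inv_mul_cancel, map_one, Equiv.Perm.one_apply]

lemma sum_sq_oddAct (g : P.weylGroup) (r : posRoots b → ℤ) :
    ∑ i, (oddAct b g r i : ℝ) ^ 2 = ∑ i, (r i : ℝ) ^ 2 := by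
  have key : ∀ r : posRoots b → ℤ,
      ∑ i, ((oddExt b r i : ℤ) : ℝ) ^ 2 = 2 * ∑ i, (r i : ℝ) ^ 2 := by
    intro r
    rw [sum_eq_two_nsmul_sum_posRoots b, ← Finset.sum_coe_sort]
    · simp only [oddExt_coe, nsmul_eq_mul]
      norm_num
    · intro i
      rw [oddExt_neg]
      push_cast
      rw [neg_sq]
  have h := key (oddAct b g r)
  simp only [oddExt_oddAct] at h
  rw [Equiv.sum_comp (P.weylGroupToPerm g) fun i => ((oddExt b r i : ℤ) : ℝ) ^ 2, key] at h
  linarith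

lemma signProd_oddAct (g : P.weylGroup) (r : posRoots b → ℤ) :
    signProd (oddAct b g r) = (-1) ^ weylLength b g * signProd r := by
  have h := prod_weylGroupToPerm b (fun i => (ZMod.χ₄ ((oddExt b r i : ℤ) : ZMod 4) : ℂ))
    (fun i => by rw [oddExt_neg, chi_neg]; push_cast; rfl) g
  rw [← Finset.prod_coe_sort, ← Finset.prod_coe_sort (posRoots b) fun i =>
    (ZMod.χ₄ ((oddExt b r i : ℤ) : ZMod 4) : ℂ)] at h
  simp only [oddExt_coe] at h
  exact h

variable {D : LinearMap.BilinForm ℝ E}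

namespace IsCanonicalForm

lemma defectTerm_oddAct (hD : IsCanonicalForm b D) (k : ℕ) (τ : ℂ) (g : P.weylGroup)
    (r : posRoots b → ℤ) :
    defectTerm D k τ (oddAct b g r) = (-1) ^ weylLength b g * defectTerm D k τ r := by
  have h : defect D (oddAct b g r) = defect D r := by
    rw [defect, defect, sum_sq_oddAct, halfSum_oddAct, hD.weyl]
  rw [defectTerm, defectTerm, h, signProd_oddAct, mul_assoc]

/-- Reindexing by `oddAct` maps one fibre to the other, preserves the defect, and changes the
product of the odd characters by (−1)^{ℓ(g)}. -/
lemma fiberCoeff_smul (hD : IsCanonicalForm b D) (k : ℕ) (τ : ℂ) (g : P.weylGroup) (x : E) :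
    fiberCoeff b D k (g • x) τ = (-1) ^ weylLength b g * fiberCoeff b D k x τ := by
  have h1 : fiberCoeff b D k x τ = (-1) ^ weylLength b g * fiberCoeff b D k (g • x) τ := by
    rw [fiberCoeff, fiberCoeff, ← (oddActEquiv b g).tsum_eq, ← tsum_mul_left]
    refine tsum_congr fun r => ?_
    rw [show oddActEquiv b g r = oddAct b g r from rfl, hD.defectTerm_oddAct, halfSum_oddAct, mul_ite, mul_zero]
    by_cases h : halfSum r = g • x
    · rw [if_pos h, if_pos (inv_smul_eq_iff.2 h)]
    · rw [if_neg h, if_neg (mt inv_smul_eq_iff.1 h)]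
  rw [h1, ← mul_assoc, ← mul_pow]
  norm_num

/-- The translation lifts to r_i ↦ r_i + 2D(y,α_i): canonicity of `D` makes `halfSum` move by
exactly y and leaves the defect unchanged. The sign changes by (−1)^{∑ D(y,α_i)} = (−1)^{D(y,y)},
which is 1 as y is even. -/
lemma fiberCoeff_add (hD : IsCanonicalForm b D) (k : ℕ) (τ : ℂ) {y : E}
    (hy : IsEvenVector P D y) (x : E) :
    fiberCoeff b D k (x + y) τ = fiberCoeff b D k x τ := by
  obtain ⟨hy1, c, hc⟩ := hy
  choose m hm using hy1
  have hsum : ∑ i : posRoots b, (m i : ℝ) • P.root i = y := by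
    rw [Finset.sum_coe_sort (posRoots b) fun i => (m i : ℝ) • P.root i]
    simp only [← hm]
    exact hD.sum_smul y
  have hsq : ∑ i : posRoots b, (m i : ℝ) ^ 2 = D y y := by
    rw [Finset.sum_coe_sort (posRoots b) fun i => (m i : ℝ) ^ 2]
    simp only [← hm, sq]
    exact hD.apply_sum y y
  let ψ : (posRoots b → ℤ) ≃ (posRoots b → ℤ) := Equiv.addRight fun i => 2 * m i
  have hψ : ∀ r i, ψ r i = r i + 2 * m i := fun r i => rfl
  have hhalf : ∀ r, halfSum (ψ r) = halfSum r + y := by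
    intro r
    rw [halfSum, halfSum]
    simp only [hψ, Int.cast_add, Int.cast_mul, add_smul, Finset.sum_add_distrib, smul_add]
    congr 1
    rw [← hsum, Finset.smul_sum]
    refine Finset.sum_congr rfl fun i _ => ?_
    rw [smul_smul]
    congr 1
    push_cast
    ring
  have hdef : ∀ r, defect D (ψ r) = defect D r := by
    intro r
    have h1 : ∑ i : posRoots b, (r i : ℝ) * m i = 2 * D (halfSum r) y := by
      rw [halfSum, map_smul, map_sum, LinearMap.smul_apply, LinearMap.sum_apply, smul_eq_mul,
        ← mul_assoc]
      norm_num
      refine Finset.sum_congr rfl fun i _ => ?_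
      rw [hD.symm, hm]
    rw [defect, defect, hhalf]
    simp only [hψ, map_add, LinearMap.add_apply]
    rw [hD.symm y (halfSum r)]
    have h2 : ∑ i, (((r i + 2 * m i : ℤ) : ℝ)) ^ 2 =
        ∑ i, (r i : ℝ) ^ 2 + 4 * ∑ i : posRoots b, (r i : ℝ) * m i
          + 4 * ∑ i : posRoots b, (m i : ℝ) ^ 2 := by
      rw [Finset.mul_sum, Finset.mul_sum, ← Finset.sum_add_distrib, ← Finset.sum_add_distrib]
      exact Finset.sum_congr rfl fun i _ => by push_cast; ring
    rw [h2, h1, hsq]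
    ring
  have hsign : ∀ r, signProd (ψ r) = signProd r := by
    intro r
    have h1 : ∀ i : posRoots b, (ZMod.χ₄ ((ψ r i : ℤ) : ZMod 4) : ℂ) =
        (-1) ^ m i * (ZMod.χ₄ (r i : ZMod 4) : ℂ) := by
      intro i
      rw [hψ, chi_add_two_mul, ← neg_one_pow_natAbs]
      push_cast
      rfl
    rw [signProd, Finset.prod_congr rfl fun i _ => h1 i, Finset.prod_mul_distrib, ← signProd]
    have h2 : ∏ i : posRoots b, (-1 : ℂ) ^ m i = 1 := by
      -- Since m and m² have the same parity, the total sign depends only on ∑ m_i² = D(y,y) = 2c.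
      have h3 : ∀ i : posRoots b, (-1 : ℂ) ^ m i = e (((m i) ^ 2 : ℤ) / 2) := by
        intro i
        rw [e_half_intCast]
        rcases Int.even_or_odd (m i) with h | h
        · rw [h.neg_one_zpow, (h.pow_of_ne_zero two_ne_zero).neg_one_zpow]
        · rw [h.neg_one_zpow, h.pow.neg_one_zpow]
      rw [Finset.prod_congr rfl fun i _ => h3 i, ← e_sum, ← Finset.sum_div]
      have h4 : (∑ i : posRoots b, (((m i) ^ 2 : ℤ) : ℂ)) / 2 = (c : ℂ) := by
        have : (∑ i : posRoots b, (m i : ℝ) ^ 2) / 2 = c := by rw [hsq, hc]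
        have := congrArg (fun t : ℝ => (t : ℂ)) this
        push_cast at this ⊢
        exact this
      rw [h4, e_intCast]
    rw [h2, one_mul]
  rw [fiberCoeff, fiberCoeff, ← ψ.tsum_eq]
  refine tsum_congr fun r => ?_
  rw [hhalf, defectTerm, defectTerm, hdef, hsign]
  by_cases h : halfSum r = x <;> simp [h]

variable [P.IsCrystallographic] [P.IsReduced]

/-- A nonzero character product needs all r_i odd, and then `halfSum r` lies in ρ plus the root
lattice. -/
lemma isWeight_of_fiberCoeff_ne_zero {k : ℕ} {τ : ℂ} {x : E} (hx : fiberCoeff b D k x τ ≠ 0) :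
    IsWeight P x := by
  by_contra h
  refine hx ?_
  rw [fiberCoeff]
  refine (tsum_congr fun r => ?_).trans tsum_zero
  by_cases hr : halfSum r = x
  · rw [if_pos hr, defectTerm]
    have h0 : signProd r = 0 := by
      by_contra hne
      have hodd : ∀ i, ∃ k, r i = 2 * k + 1 := by
        intro i
        by_contra hi
        have hi2 : Even (r i) := Int.not_odd_iff_even.1 hi
        refine hne (Finset.prod_eq_zero (Finset.mem_univ i) ?_)
        rw [ZMod.χ₄_int_eq_if_mod_four]
        simp [Int.even_iff.1 hi2]
      choose m hm using hodd
      refine h ?_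
      have : x = weylVector b + ∑ i, m i • P.root (i : ι) := by
        rw [← hr, halfSum, weylVector, ← Finset.sum_coe_sort (posRoots b), Finset.smul_sum,
          Finset.smul_sum, ← Finset.sum_add_distrib]
        refine Finset.sum_congr rfl fun i _ => ?_
        rw [hm, ← Int.cast_smul_eq_zsmul ℝ, ← add_smul, smul_smul]
        congr 1
        push_cast
        ring
      rw [this]
      exact (isWeight_weylVector b).add (isWeight_sum _ fun i _ => (isWeight_root _).zsmul _)
    rw [h0, zero_mul]
  · rw [if_neg hr]

/-- The affine reflection in the wall fixes x. It is a reflection, of sign −1, followed by an even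
translation, so the coefficient equals its own negative. -/
lemma fiberCoeff_eq_zero_of_wall (hD : IsCanonicalForm b D) (k : ℕ) (τ : ℂ) {x : E} {i : ι}
    (hi : b.IsPos i) {m : ℤ} (hx : P.coroot' i x = m * rootLevel (P := P) D i) :
    fiberCoeff b D k x τ = 0 := by
  have h1 := hD.fiberCoeff_smul k τ (weylGroup.ofIdx P i) x
  rw [neg_one_pow_weylLength_ofIdx b hi, ofIdx_smul_eq, reflection_apply, sub_eq_add_neg,
    ← neg_smul, hx, ← neg_mul, ← Int.cast_neg,
    hD.fiberCoeff_add k τ (hD.isEvenVector_rootLevel_smul i (-m))] at h1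
  have h2 : 2 * fiberCoeff b D k x τ = 0 := by linear_combination h1
  simpa using h2

/-- Up to a factor that depends only on `x`, all coefficients agree with the one at the Weyl
vector. -/
lemma exists_fiberCoeff_eq_mul (hD : IsCanonicalForm b D) (x : E) :
    ∃ s : ℂ, (∀ k τ, fiberCoeff b D k x τ = s * fiberCoeff b D k (weylVector b) τ) ∧
      (s ≠ 0 → ∃ (g : P.weylGroup) (y : E), IsEvenVector P D y ∧ g • x + y = weylVector b) := by
  by_cases hx : IsWeight P x
  · obtain ⟨g, y, hy, h | ⟨i, k, hi, h⟩⟩ := hD.exists_smul_add_eq hx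
    · refine ⟨(-1) ^ weylLength b g, fun k τ => ?_, fun _ => ⟨g, y, hy, h⟩⟩
      rw [← h, hD.fiberCoeff_add k τ hy, hD.fiberCoeff_smul, ← mul_assoc, ← mul_pow]
      norm_num
    · refine ⟨0, fun k τ => ?_, fun h => absurd rfl h⟩
      have h1 := hD.fiberCoeff_eq_zero_of_wall k τ hi h
      rw [hD.fiberCoeff_add k τ hy, hD.fiberCoeff_smul] at h1
      rw [zero_mul]
      exact (mul_eq_zero.1 h1).resolve_left (pow_ne_zero _ (by norm_num))
  · refine ⟨0, fun k τ => ?_, fun h => absurd rfl h⟩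
    rw [zero_mul]
    by_contra h
    exact hx (isWeight_of_fiberCoeff_ne_zero h)

end IsCanonicalForm

end Root

end ThetaBlocks
end

/-! ### Behaviour of theta and its logarithmic derivative at the origin -/

noncomputable section

set_option linter.unusedSectionVars false

namespace ThetaBlocks

open RootPairing Filter Topology
open Complex (I)

/-- Integration of an asymptotic expansion at the origin. -/
lemma tendsto_div_pow_succ {f f' : ℂ → ℂ} (hf : ∀ z, HasDerivAt f (f' z) z) (h0 : f 0 = 0)
    (hc : ContinuousAt f' 0)
    {k : ℕ} {c : ℂ} (h : Tendsto (fun z => f' z / z ^ k) (𝓝[≠] 0) (𝓝 c)) :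
    Tendsto (fun z => f z / z ^ (k + 1)) (𝓝[≠] 0) (𝓝 (c / (k + 1))) := by
  have hk : (k + 1 : ℂ) ≠ 0 := Nat.cast_add_one_ne_zero k
  rw [Metric.tendsto_nhdsWithin_nhds] at h ⊢
  intro ε hε
  obtain ⟨δ, hδ, h1⟩ := h (ε / 2) (half_pos hε)
  refine ⟨δ, hδ, fun z hz hzδ => ?_⟩
  have hz : z ≠ 0 := hz
  rw [dist_zero_right] at hzδ
  let g : ℂ → ℂ := fun w => f w - c / (k + 1) * w ^ (k + 1)
  let g' : ℂ → ℂ := fun w => f' w - c * w ^ k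
  have hg : ∀ w, HasDerivAt g (g' w) w := fun w => by
    refine ((hf w).sub ((hasDerivAt_pow (k + 1) w).const_mul (c / (k + 1)))).congr_deriv ?_
    simp only [g', Nat.add_sub_cancel]
    push_cast
    field_simp
  have hnear : ∀ w ≠ 0, ‖w‖ < δ → ‖g' w‖ ≤ ε / 2 * ‖w‖ ^ k := fun w hw0 hw => by
    have h2 := h1 (x := w) hw0 (by rwa [dist_zero_right])
    rw [dist_eq_norm] at h2
    have h3 : g' w = (f' w / w ^ k - c) * w ^ k := by
      simp only [g']
      field_simp
    rw [h3, norm_mul, norm_pow]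
    exact mul_le_mul_of_nonneg_right h2.le (by positivity)
  have hnear0 : ∀ w, ‖w‖ < δ → ‖g' w‖ ≤ ε / 2 * ‖w‖ ^ k := fun w hw => by
    rcases eq_or_ne w 0 with rfl | hw0
    · have hcg : ContinuousAt g' 0 := hc.sub (by fun_prop)
      have hcr : ContinuousAt (fun w : ℂ => ε / 2 * ‖w‖ ^ k) 0 := by fun_prop
      refine le_of_tendsto_of_tendsto (hcg.norm.tendsto.mono_left nhdsWithin_le_nhds)
        (hcr.tendsto.mono_left (nhdsWithin_le_nhds (s := {0}ᶜ))) ?_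
      filter_upwards [self_mem_nhdsWithin,
        mem_nhdsWithin_of_mem_nhds (Metric.ball_mem_nhds (0 : ℂ) hδ)] with w hw hwδ
      exact hnear w hw (by simpa using hwδ)
    · exact hnear w hw0 hw
  have hg0 : ‖g z‖ ≤ ε / 2 * ‖z‖ ^ k * ‖z‖ := by
    have := (convex_closedBall (0 : ℂ) ‖z‖).norm_image_sub_le_of_norm_hasDerivWithin_le
      (f := g) (f' := g') (C := ε / 2 * ‖z‖ ^ k) (x := 0) (y := z)
      (fun w _ => (hg w).hasDerivWithinAt) (fun w hw => ?_) (by simp) (by simp)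
    · simpa [g, h0] using this
    · have hw : ‖w‖ ≤ ‖z‖ := by simpa using hw
      refine (hnear0 w (hw.trans_lt hzδ)).trans ?_
      gcongr
  have h4 : f z / z ^ (k + 1) - c / (k + 1) = g z / z ^ (k + 1) := by
    simp only [g]
    field_simp
  rw [dist_eq_norm, h4, norm_div, norm_pow, div_lt_iff₀ (by positivity)]
  calc ‖g z‖ ≤ ε / 2 * ‖z‖ ^ k * ‖z‖ := hg0
    _ = ε / 2 * ‖z‖ ^ (k + 1) := by ring
    _ < ε * ‖z‖ ^ (k + 1) := by
      have : 0 < ‖z‖ := norm_pos_iff.2 hz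
      have := pow_pos this (k + 1)
      nlinarith

section Local

variable {τ : ℂ} (hτ : 0 < τ.im)
include hτ

lemma continuous_thetaDer (k : ℕ) : Continuous (thetaDer k τ) :=
  continuous_iff_continuousAt.2 fun z => (hasDerivAt_thetaDer_right k hτ z).continuousAt

lemma tendsto_thetaDer_div {k : ℕ} (hk : Even k) :
    Tendsto (fun z => thetaDer k τ z / z) (𝓝[≠] 0) (𝓝 (Real.pi * I * thetaDer (k + 1) τ 0)) := by
  have h := tendsto_div_pow_succ (k := 0) (c := Real.pi * I * thetaDer (k + 1) τ 0)
    (hasDerivAt_thetaDer_right k hτ) (thetaDer_zero_of_even hk τ)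
    (continuous_const.mul (continuous_thetaDer hτ _)).continuousAt ?_
  · simpa using h
  · simp only [pow_zero, div_one]
    exact ((continuous_const.mul (continuous_thetaDer hτ _)).tendsto 0).mono_left
      nhdsWithin_le_nhds

variable (h1 : thetaDer 1 τ 0 ≠ 0)
include h1

lemma eventually_thetaDer_zero_ne : ∀ᶠ z in 𝓝[≠] 0, thetaDer 0 τ z ≠ 0 := by
  have hpi : (Real.pi * I : ℂ) ≠ 0 := by simp [Real.pi_ne_zero]
  filter_upwards [(tendsto_thetaDer_div hτ (k := 0) (by decide)).eventually_ne
    (mul_ne_zero hpi h1)] with z hz h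
  exact hz (by rw [h, zero_div])

lemma tendsto_thetaDer_two_div_zero :
    Tendsto (fun z => thetaDer 2 τ z / thetaDer 0 τ z) (𝓝[≠] 0)
      (𝓝 (thetaDer 3 τ 0 / thetaDer 1 τ 0)) := by
  have hpi : (Real.pi * I : ℂ) ≠ 0 := by simp [Real.pi_ne_zero]
  have h := (tendsto_thetaDer_div hτ (k := 2) (by decide)).div
    (tendsto_thetaDer_div hτ (k := 0) (by decide)) (mul_ne_zero hpi h1)
  rw [mul_div_mul_left _ _ hpi] at h
  refine h.congr' ?_
  filter_upwards [self_mem_nhdsWithin] with z hz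
  exact div_div_div_cancel_right₀ hz _ _

/-- The logarithmic derivative of theta, multiplied by `z`. -/
lemma tendsto_logDeriv_sub :
    Tendsto (fun z => (z * (thetaDer 1 τ z / thetaDer 0 τ z) - (Real.pi * I)⁻¹) / z ^ 2) (𝓝[≠] 0)
      (𝓝 (Real.pi * I / 3 * (thetaDer 3 τ 0 / thetaDer 1 τ 0))) := by
  have hpi : (Real.pi * I : ℂ) ≠ 0 := by simp [Real.pi_ne_zero]
  have h2 := tendsto_div_pow_succ (k := 2) (c := Real.pi * I * (Real.pi * I * thetaDer 3 τ 0))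
    (f := fun z => z * thetaDer 1 τ z - (Real.pi * I)⁻¹ * thetaDer 0 τ z)
    (f' := fun z => Real.pi * I * (z * thetaDer 2 τ z)) (fun z => ?_) ?_ ?_ ?_
  · have h := h2.div (tendsto_thetaDer_div hτ (k := 0) (by decide)) (mul_ne_zero hpi h1)
    have heq : Real.pi * I * (Real.pi * I * thetaDer 3 τ 0) / ((2 : ℕ) + 1) /
        (Real.pi * I * thetaDer (0 + 1) τ 0) =
        Real.pi * I / 3 * (thetaDer 3 τ 0 / thetaDer 1 τ 0) := by
      push_cast
      field_simp
      norm_num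
    rw [heq] at h
    refine h.congr' ?_
    filter_upwards [self_mem_nhdsWithin, eventually_thetaDer_zero_ne hτ h1] with z hz hθ
    have hz : z ≠ 0 := hz
    simp only [Pi.div_apply]
    field_simp
    ring
  · refine (((hasDerivAt_id z).mul (hasDerivAt_thetaDer_right 1 hτ z)).sub
      ((hasDerivAt_thetaDer_right 0 hτ z).const_mul _)).congr_deriv ?_
    simp only [id]
    field_simp
    ring
  · simp [thetaDer_zero_of_even (k := 0) (by decide)]
  · exact (continuous_const.mul (continuous_id.mul (continuous_thetaDer hτ _))).continuousAt
  · refine ((tendsto_thetaDer_div hτ (k := 2) (by decide)).const_mul _).congr' ?_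
    filter_upwards [self_mem_nhdsWithin] with z hz
    have hz : z ≠ 0 := hz
    field_simp

/-- The logarithmic derivative of theta, multiplied by `z`. -/
lemma tendsto_mul_logDeriv :
    Tendsto (fun z => z * (thetaDer 1 τ z / thetaDer 0 τ z)) (𝓝[≠] 0) (𝓝 (Real.pi * I)⁻¹) := by
  have hsq : Tendsto (fun z : ℂ => z ^ 2) (𝓝[≠] 0) (𝓝 0) := by
    have : Continuous fun z : ℂ => z ^ 2 := by fun_prop
    simpa using (this.tendsto 0).mono_left (nhdsWithin_le_nhds (s := {0}ᶜ))
  have h := ((tendsto_logDeriv_sub hτ h1).mul hsq).add_const (Real.pi * I : ℂ)⁻¹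
  rw [mul_zero, zero_add] at h
  refine h.congr' ?_
  filter_upwards [self_mem_nhdsWithin] with z hz
  have hz : z ≠ 0 := hz
  rw [div_mul_cancel₀ _ (pow_ne_zero 2 hz), sub_add_cancel]

/-- With K = `thetaDer 3 τ 0 / thetaDer 1 τ 0`, the normalised logarithmic derivative is 1/(πi z) +
(πi K/3) z + …. In the product of two of them the only pole is the 1/t² term, and the cross terms
give the constant. -/
lemma tendsto_logDeriv_mul_sub {a c : ℂ} (ha : a ≠ 0) (hc : c ≠ 0) :
    Tendsto (fun t : ℂ =>
      (thetaDer 1 τ (t * a) / thetaDer 0 τ (t * a)) * (thetaDer 1 τ (t * c) / thetaDer 0 τ (t * c))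
        - ((Real.pi * I) ^ 2 * (a * c))⁻¹ / t ^ 2) (𝓝[≠] 0)
      (𝓝 (thetaDer 3 τ 0 / thetaDer 1 τ 0 / 3 * (a / c + c / a))) := by
  have hpi : (Real.pi * I : ℂ) ≠ 0 := by simp [Real.pi_ne_zero]
  have hmul : ∀ {a : ℂ}, a ≠ 0 → Tendsto (fun t : ℂ => t * a) (𝓝[≠] 0) (𝓝[≠] 0) := by
    intro a ha
    refine tendsto_nhdsWithin_iff.2 ⟨?_, ?_⟩
    · have : Continuous fun t : ℂ => t * a := by fun_prop
      simpa using (this.tendsto 0).mono_left (nhdsWithin_le_nhds (s := {0}ᶜ))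
    · filter_upwards [self_mem_nhdsWithin] with t ht
      exact mul_ne_zero ht ha
  have hA := (tendsto_logDeriv_sub hτ h1).comp (hmul ha)
  have hC := (tendsto_logDeriv_sub hτ h1).comp (hmul hc)
  have hC0 := (tendsto_mul_logDeriv hτ h1).comp (hmul hc)
  have h := ((hA.mul hC0).const_mul (a / c)).add ((hC.const_mul ((Real.pi * I)⁻¹ * (c / a))))
  have heq : a / c * (Real.pi * I / 3 * (thetaDer 3 τ 0 / thetaDer 1 τ 0) * (Real.pi * I)⁻¹) +
      (Real.pi * I)⁻¹ * (c / a) * (Real.pi * I / 3 * (thetaDer 3 τ 0 / thetaDer 1 τ 0)) =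
      thetaDer 3 τ 0 / thetaDer 1 τ 0 / 3 * (a / c + c / a) := by
    field_simp
  rw [heq] at h
  refine h.congr' ?_
  filter_upwards [self_mem_nhdsWithin] with t ht
  have ht : t ≠ 0 := ht
  simp only [Function.comp_apply]
  generalize thetaDer 1 τ (t * a) / thetaDer 0 τ (t * a) = A
  generalize thetaDer 1 τ (t * c) / thetaDer 0 τ (t * c) = C
  field_simp
  ring

end Local

end ThetaBlocks
end

/-! ### The heat operator on the product -/

noncomputable section

set_option linter.unusedSectionVars false

namespace ThetaBlocks

open RootPairing Filter Topology
open Complex (I)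

lemma prod_thetaDer_twoDer {J : Type*} [Fintype J] [DecidableEq J] {τ : ℂ} {v : J → ℂ}
    (hv : ∀ l, thetaDer 0 τ (v l) ≠ 0) (i j : J) :
    ∏ l, thetaDer (twoDer i j l) τ (v l) =
      (∏ l, thetaDer 0 τ (v l)) *
        if i = j then thetaDer 2 τ (v i) / thetaDer 0 τ (v i)
        else thetaDer 1 τ (v i) / thetaDer 0 τ (v i) *
          (thetaDer 1 τ (v j) / thetaDer 0 τ (v j)) := by
  have h : ∀ l, thetaDer (twoDer i j l) τ (v l) = thetaDer 0 τ (v l) *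
      (if i = j then (if l = i then thetaDer 2 τ (v l) / thetaDer 0 τ (v l) else 1)
        else (if l = i then thetaDer 1 τ (v l) / thetaDer 0 τ (v l) else 1) *
          (if l = j then thetaDer 1 τ (v l) / thetaDer 0 τ (v l) else 1)) := by
    intro l
    have h0 := hv l
    by_cases hij : i = j
    · subst hij
      by_cases hl : l = i
      · simp only [twoDer, hl, if_true]
        rw [← hl, mul_div_cancel₀ _ h0]
      · simp [twoDer, hl]
    · by_cases hl : l = i
      · have hlj : l ≠ j := fun h => hij (hl.symm.trans h)
        simp only [twoDer, hij, hl, if_true, if_false, mul_one, add_zero]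
        rw [← hl, mul_div_cancel₀ _ h0]
      · by_cases hlj : l = j
        · simp only [twoDer, hij, hlj, if_true, if_false]
          rw [if_neg (Ne.symm hij), if_neg (Ne.symm hij), one_mul, ← hlj, mul_div_cancel₀ _ h0]
        · simp [twoDer, hij, hl, hlj]
  rw [Finset.prod_congr rfl fun l _ => h l, Finset.prod_mul_distrib]
  congr 1
  by_cases hij : i = j
  · simp only [if_pos hij]
    simp
  · simp only [if_neg hij, Finset.prod_mul_distrib]
    simp

section Root

variable {ι E M : Type*} [Fintype ι] [NormedAddCommGroup E] [InnerProductSpace ℝ E]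
  [AddCommGroup M] [Module ℝ M] {P : RootPairing ι ℝ E M} {b : P.Base}
  {D : LinearMap.BilinForm ℝ E}

lemma finiteDimensional_of_isRootSystem (P : RootPairing ι ℝ E M) [P.IsRootSystem] :
    FiniteDimensional ℝ E := by
  refine ⟨⟨(Set.finite_range P.root).toFinset, ?_⟩⟩
  rw [Set.Finite.coe_toFinset]
  exact RootPairing.IsRootSystem.span_root_eq_top

namespace IsCanonicalForm

/-- This is the trace of the identity, written as the sum of the rank one maps x ↦ D(r,x) r. -/
lemma sum_apply_self [P.IsRootSystem] (hD : IsCanonicalForm b D) :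
    ∑ i ∈ posRoots b, D (P.root i) (P.root i) = Module.finrank ℝ E := by
  have := finiteDimensional_of_isRootSystem P
  have h : ∑ i ∈ posRoots b, (D (P.root i)).smulRight (P.root i) = LinearMap.id := by
    ext x
    rw [LinearMap.sum_apply, LinearMap.id_apply, ← hD.sum_smul x]
    refine Finset.sum_congr rfl fun i _ => ?_
    rw [hD.sum_smul x, LinearMap.smulRight_apply, hD.symm]
  have h2 := congrArg (LinearMap.trace ℝ E) h
  rw [map_sum, LinearMap.trace_id] at h2
  simpa only [LinearMap.trace_smulRight] using h2

variable [P.IsCrystallographic] [P.IsReduced]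

/-- The heat operator acts on a product of theta functions as multiplication by a function
of `τ`. -/
lemma fiberCoeff_mul_heatProd [DecidableEq (posRoots b)] (hD : IsCanonicalForm b D) {τ : ℂ}
    (hτ : 0 < τ.im) (ζ : E →ₗ[ℝ] ℂ) :
    fiberCoeff b D 1 (weylVector b) τ * ∏ i : posRoots b, thetaDer 0 τ (ζ (P.root i)) =
      fiberCoeff b D 0 (weylVector b) τ * heatProd D τ fun i : posRoots b => ζ (P.root i) := by
  -- Both sides have the same expansion term by term, because the coefficients at x for k = 0 and k
  -- = 1 are the same multiple of those at ρ.
  refine ((hasSum_fiberCoeff_zero D hτ ζ).mul_left _).unique ?_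
  refine ((hasSum_fiberCoeff_one D hτ ζ).mul_left (fiberCoeff b D 0 (weylVector b) τ)).congr_fun ?_
  intro x
  obtain ⟨s, hs, -⟩ := hD.exists_fiberCoeff_eq_mul x
  rw [hs, hs]
  ring

/-- The relation `fiberCoeff_mul_heatProd`, divided by the product, is expanded at z = tρ as t → 0.
No theta factor vanishes for small t ≠ 0 because D(ρ,r) > 0. The constant term is K(N − 2N/3 −
n/3)/8 = K(N − n)/24. -/
lemma fiberCoeff_one_weylVector [P.IsRootSystem] (hD : IsCanonicalForm b D) {τ : ℂ}
    (hτ : 0 < τ.im) (h1 : thetaDer 1 τ 0 ≠ 0) :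
    fiberCoeff b D 1 (weylVector b) τ =
      (((posRoots b).card : ℂ) - Module.finrank ℝ E) / 24 *
        (thetaDer 3 τ 0 / thetaDer 1 τ 0) * fiberCoeff b D 0 (weylVector b) τ := by
  classical
  set c0 := fiberCoeff b D 0 (weylVector b) τ with hc0
  set c1 := fiberCoeff b D 1 (weylVector b) τ with hc1
  set K := thetaDer 3 τ 0 / thetaDer 1 τ 0 with hK
  let η : E →ₗ[ℝ] ℂ := Complex.ofRealCLM.toLinearMap.comp (D (weylVector b))
  let h : posRoots b → ℂ := fun i => η (P.root i)
  have hη : ∀ x, η x = ((D (weylVector b) x : ℝ) : ℂ) := fun x => rfl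
  have hh : ∀ i, h i ≠ 0 := fun i => by
    change η (P.root i) ≠ 0
    rw [hη]
    exact_mod_cast (hD.weylVector_root_pos (mem_posRoots.1 i.2)).ne'
  let A : posRoots b → posRoots b → ℂ := fun i j => (D (P.root (i : ι)) (P.root (j : ι)) : ℂ)
  have hmul : ∀ {a : ℂ}, a ≠ 0 → Tendsto (fun t : ℂ => t * a) (𝓝[≠] 0) (𝓝[≠] 0) := by
    intro a ha
    refine tendsto_nhdsWithin_iff.2 ⟨?_, ?_⟩
    · have : Continuous fun t : ℂ => t * a := by fun_prop
      simpa using (this.tendsto 0).mono_left (nhdsWithin_le_nhds (s := {0}ᶜ))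
    · filter_upwards [self_mem_nhdsWithin] with t ht
      exact mul_ne_zero ht ha
  have hne : ∀ᶠ t in 𝓝[≠] (0 : ℂ), ∀ i, thetaDer 0 τ (t * h i) ≠ 0 :=
    eventually_all.2 fun i => (hmul (hh i)).eventually (eventually_thetaDer_zero_ne hτ h1)
  let Q : posRoots b → posRoots b → ℂ → ℂ := fun i j t =>
    if i = j then thetaDer 2 τ (t * h i) / thetaDer 0 τ (t * h i)
    else thetaDer 1 τ (t * h i) / thetaDer 0 τ (t * h i) *
      (thetaDer 1 τ (t * h j) / thetaDer 0 τ (t * h j))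
  let q : posRoots b → posRoots b → ℂ := fun i j =>
    if i = j then 0 else ((Real.pi * I) ^ 2 * (h i * h j))⁻¹
  let l : posRoots b → posRoots b → ℂ := fun i j =>
    if i = j then K else K / 3 * (h i / h j + h j / h i)
  have hQ : ∀ i j, Tendsto (fun t => Q i j t - q i j / t ^ 2) (𝓝[≠] 0) (𝓝 (l i j)) := by
    intro i j
    by_cases hij : i = j
    · simp only [Q, q, l, if_pos hij, zero_div, sub_zero]
      exact (tendsto_thetaDer_two_div_zero hτ h1).comp (hmul (hh i))
    · simp only [Q, q, l, if_neg hij]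
      exact tendsto_logDeriv_mul_sub hτ h1 (hh i) (hh j)
  have hheat : ∀ᶠ t in 𝓝[≠] (0 : ℂ),
      8 * c1 = c0 * (∑ i, Q i i t - ∑ i, ∑ j, A i j * Q i j t) := by
    filter_upwards [hne] with t ht
    have h2 := hD.fiberCoeff_mul_heatProd hτ (t • η)
    have h3 : ∏ i, thetaDer 0 τ (t * h i) ≠ 0 := Finset.prod_ne_zero_iff.2 fun i _ => ht i
    have h4 : heatProd D τ (fun i => t * h i) = (∏ i, thetaDer 0 τ (t * h i)) *
        ((∑ i, Q i i t - ∑ i, ∑ j, A i j * Q i j t) / 8) := by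
      rw [heatProd, mul_div_assoc', mul_sub, Finset.mul_sum, Finset.mul_sum]
      congr 2
      · exact Finset.sum_congr rfl fun i _ => prod_thetaDer_twoDer ht i i
      · refine Finset.sum_congr rfl fun i _ => ?_
        rw [Finset.mul_sum]
        refine Finset.sum_congr rfl fun j _ => ?_
        rw [prod_thetaDer_twoDer ht i j]
        simp only [A, Q]
        ring
    simp only [LinearMap.smul_apply, smul_eq_mul] at h2
    change c1 * ∏ i, thetaDer 0 τ (t * h i) = c0 * heatProd D τ (fun i => t * h i) at h2
    rw [h4] at h2
    refine mul_left_cancel₀ h3 ?_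
    linear_combination 8 * h2
  set C := ∑ i, ∑ j, A i j * q i j with hC
  have hlim : Tendsto (fun t => 8 * c1 + c0 * C / t ^ 2) (𝓝[≠] 0)
      (𝓝 (c0 * (∑ i, l i i - ∑ i, ∑ j, A i j * l i j))) := by
    have h2 : Tendsto (fun t => c0 * (∑ i, (Q i i t - q i i / t ^ 2) -
        ∑ i, ∑ j, A i j * (Q i j t - q i j / t ^ 2))) (𝓝[≠] 0)
        (𝓝 (c0 * (∑ i, l i i - ∑ i, ∑ j, A i j * l i j))) :=
      ((tendsto_finsetSum _ fun i _ => hQ i i).sub (tendsto_finsetSum _ fun i _ =>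
        tendsto_finsetSum _ fun j _ => (hQ i j).const_mul _)).const_mul _
    refine h2.congr' ?_
    filter_upwards [hheat] with t ht
    rw [ht]
    have h5 : ∑ i, (Q i i t - q i i / t ^ 2) = ∑ i, Q i i t :=
      Finset.sum_congr rfl fun i _ => by simp [q]
    have h6 : ∑ i, ∑ j, A i j * (Q i j t - q i j / t ^ 2) =
        ∑ i, ∑ j, A i j * Q i j t - C / t ^ 2 := by
      rw [hC, Finset.sum_div, ← Finset.sum_sub_distrib]
      refine Finset.sum_congr rfl fun i _ => ?_
      rw [Finset.sum_div, ← Finset.sum_sub_distrib]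
      exact Finset.sum_congr rfl fun j _ => by ring
    rw [h5, h6]
    ring
  -- The left side of the heat relation does not depend on t, so the t⁻² terms must cancel; C need
  -- not be computed.
  have hCzero : c0 * C = 0 := by
    have hsq : Tendsto (fun z : ℂ => z ^ 2) (𝓝[≠] 0) (𝓝 0) := by
      have : Continuous fun z : ℂ => z ^ 2 := by fun_prop
      simpa using (this.tendsto 0).mono_left (nhdsWithin_le_nhds (s := {0}ᶜ))
    have h2 := (hlim.mul hsq).sub (hsq.const_mul (8 * c1))
    rw [mul_zero, mul_zero, sub_zero] at h2
    refine tendsto_nhds_unique (tendsto_const_nhds.congr' ?_) h2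
    filter_upwards [self_mem_nhdsWithin] with t ht
    have ht : t ≠ 0 := ht
    field_simp
    ring
  simp only [hCzero, zero_div, add_zero] at hlim
  have hval := tendsto_nhds_unique tendsto_const_nhds hlim
  have hsymm : ∀ i j, A i j = A j i := fun i j => by simp only [A]; rw [hD.symm]
  -- The vector of the D(ρ,α_i) is fixed by the matrix D(α_i,α_j), by the reproducing property of
  -- `D`.
  have hrow : ∀ j, ∑ i, A i j * (h i / h j) = 1 := by
    intro j
    have h2 : ∑ i, A i j * h i = h j := by
      have h3 := hD.apply_sum (P.root (j : ι)) (weylVector b)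
      rw [← Finset.sum_coe_sort] at h3
      have h4 := congrArg (fun x : ℝ => (x : ℂ)) h3
      simp only [Complex.ofReal_sum, Complex.ofReal_mul] at h4
      change _ = η (P.root j)
      rw [hη, hD.symm, ← h4]
      refine Finset.sum_congr rfl fun i _ => ?_
      rw [hsymm]
      rfl
    simp only [mul_div_assoc', ← Finset.sum_div]
    rw [h2, div_self (hh j)]
  have hsum1 : ∑ i, ∑ j, A i j * (h i / h j) = ((posRoots b).card : ℂ) := by
    rw [Finset.sum_comm, Finset.sum_congr rfl fun j _ => hrow j]
    simp
  have hsum2 : ∑ i, ∑ j, A i j * (h j / h i) = ((posRoots b).card : ℂ) := by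
    rw [← hsum1, Finset.sum_comm]
    exact Finset.sum_congr rfl fun i _ => Finset.sum_congr rfl fun j _ => by rw [hsymm]
  have htr : ∑ i, A i i = (Module.finrank ℝ E : ℂ) := by
    have h3 := hD.sum_apply_self
    rw [← Finset.sum_coe_sort] at h3
    have h4 := congrArg (fun x : ℝ => (x : ℂ)) h3
    simpa [A] using h4
  have hl : ∑ i, ∑ j, A i j * l i j =
      K / 3 * (2 * ((posRoots b).card : ℂ)) + K / 3 * Module.finrank ℝ E := by
    -- On the diagonal the off-diagonal formula would give 2K/3 instead of K; the last summand is
    -- the correction, which sums to the trace n.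
    have h2 : ∀ i j, A i j * l i j = K / 3 * (A i j * (h i / h j)) + K / 3 * (A i j * (h j / h i))
        + K / 3 * (if i = j then A i j else 0) := by
      intro i j
      by_cases hij : i = j
      · subst hij
        simp only [l, if_true, div_self (hh i)]
        ring
      · simp only [l, if_neg hij]
        ring
    simp only [h2, Finset.sum_add_distrib, ← Finset.mul_sum, hsum1, hsum2, Finset.sum_ite_eq,
      Finset.mem_univ, if_true, htr]
    ring
  rw [hl] at hval
  have hdiag : ∑ i, l i i = ((posRoots b).card : ℂ) * K := by
    simp [l]
  rw [hdiag] at hval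
  linear_combination hval / 8

end IsCanonicalForm

end Root

end ThetaBlocks
end

/-! ### The coefficient at the Weyl vector and the strange formula -/

noncomputable section

set_option linter.unusedSectionVars false

namespace ThetaBlocks

open RootPairing Filter Topology
open Complex (I)

section Root

variable {ι E M : Type*} [Fintype ι] [NormedAddCommGroup E] [InnerProductSpace ℝ E]
  [AddCommGroup M] [Module ℝ M] {P : RootPairing ι ℝ E M} {b : P.Base}
  {D : LinearMap.BilinForm ℝ E}

open Classical in
lemma summable_fiber (D : LinearMap.BilinForm ℝ E) {τ : ℂ} (hτ : 0 < τ.im) (x : E) :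
    Summable fun r : posRoots b → ℤ => if halfSum r = x then ‖defectTerm D 0 τ r‖ else 0 := by
  have h := (expansionTerm_zero (b := b) D hτ 0).1
  set c : ℂ := e (τ * ((D x x / 2 : ℝ) : ℂ)) with hc
  have hc0 : c ≠ 0 := e_ne_zero _
  refine Summable.of_nonneg_of_le (fun r => ?_) (fun r => ?_) (h.mul_right ‖c‖⁻¹)
  · split_ifs <;> positivity
  · by_cases hr : halfSum r = x
    · rw [if_pos hr, expansionTerm, hr, LinearMap.zero_apply, e_zero, mul_one, ← hc, norm_mul,
        mul_inv_cancel_right₀ (norm_ne_zero_iff.2 hc0)]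
    · rw [if_neg hr]
      positivity

lemma apply_halfSum_real (f : E →ₗ[ℝ] ℝ) (r : posRoots b → ℤ) :
    f (halfSum r) = 1 / 2 * ∑ i, (r i : ℝ) * f (P.root i) := by
  rw [halfSum, map_smul, map_sum, smul_eq_mul]
  simp only [map_smul, smul_eq_mul]

namespace IsCanonicalForm

/-- With x = `halfSum r`, the defect equals ⅛ ∑ (r_i − 2D(x,α_i))². -/
lemma defect_nonneg (hD : IsCanonicalForm b D) (r : posRoots b → ℤ) : 0 ≤ defect D r := by
  set x := halfSum r with hx
  have h1 : ∑ i : posRoots b, (r i : ℝ) * D x (P.root i) = 2 * D x x := by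
    have h := apply_halfSum_real (D x) r
    rw [← hx] at h
    linarith
  have h2 : ∑ i : posRoots b, D x (P.root i) * D x (P.root i) = D x x := by
    rw [Finset.sum_coe_sort (posRoots b) fun i => D x (P.root i) * D x (P.root i)]
    exact hD.apply_sum x x
  have h3 : 0 ≤ ∑ i : posRoots b, ((r i : ℝ) - 2 * D x (P.root i)) ^ 2 :=
    Finset.sum_nonneg fun i _ => sq_nonneg _
  have h4 : ∑ i : posRoots b, ((r i : ℝ) - 2 * D x (P.root i)) ^ 2 =
      ∑ i, (r i : ℝ) ^ 2 - 4 * ∑ i : posRoots b, (r i : ℝ) * D x (P.root i)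
        + 4 * ∑ i : posRoots b, D x (P.root i) * D x (P.root i) := by
    rw [Finset.mul_sum, Finset.mul_sum, ← Finset.sum_sub_distrib, ← Finset.sum_add_distrib]
    exact Finset.sum_congr rfl fun i _ => by ring
  rw [h4, h1, h2] at h3
  rw [defect, ← hx]
  linarith

lemma hasDerivAt_fiberCoeff (hD : IsCanonicalForm b D) {τ : ℂ} (hτ : 0 < τ.im) (x : E) :
    HasDerivAt (fiberCoeff b D 0 x) (2 * Real.pi * I * fiberCoeff b D 1 x τ) τ := by
  classical
  have hU : IsOpen {w : ℂ | τ.im / 2 < w.im} := Complex.continuous_im.isOpen_preimage _ isOpen_Ioi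
  have hhalf : (0 : ℝ) < ((τ.im / 2 : ℝ) * I : ℂ).im := by simpa using hτ
  have := hasDerivAt_tsum_of_norm_le hU (summable_fiber (b := b) D hhalf x)
    (F := fun r w => if halfSum r = x then defectTerm D 0 w r else 0)
    (F' := fun r w => 2 * Real.pi * I * if halfSum r = x then defectTerm D 1 w r else 0)
    (fun r w _ => ?_) (fun r w hw => ?_) (w := τ) (by simpa using hτ)
  · rw [tsum_mul_left] at this
    exact this
  · by_cases hr : halfSum r = x
    · simp only [if_pos hr, defectTerm, pow_zero, pow_one, one_mul]
      have h1 := (hasDerivAt_e_mul (defect D r : ℂ) w).const_mul (signProd r)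
      simp only [mul_comm (defect D r : ℂ)] at h1
      refine h1.congr_deriv ?_
      ring
    · simp only [if_neg hr, mul_zero]
      exact hasDerivAt_const _ _
  · by_cases hr : halfSum r = x
    · simp only [if_pos hr, defectTerm, pow_zero, one_mul, norm_mul, norm_e_mul_ofReal]
      refine mul_le_mul_of_nonneg_left (Real.exp_le_exp.2 ?_) (norm_nonneg _)
      have hw : τ.im / 2 < w.im := hw
      have h1 : (((τ.im / 2 : ℝ) : ℂ) * I).im = τ.im / 2 := by simp
      rw [h1, neg_le_neg_iff]
      have := hD.defect_nonneg r
      have := Real.pi_pos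
      gcongr
    · simp [if_neg hr]

variable [P.IsCrystallographic] [P.IsReduced] [P.IsRootSystem]

/-- The coefficient at the Weyl vector is a constant multiple of a power of eta. -/
lemma exists_fiberCoeff_weylVector (hD : IsCanonicalForm b D) :
    ∃ c : ℂ, ∀ τ : UpperHalfPlane, fiberCoeff b D 0 (weylVector b) τ *
      eta τ ^ ((Module.finrank ℝ E : ℤ) - ((posRoots b).card : ℤ)) = c := by
  set m : ℤ := (Module.finrank ℝ E : ℤ) - ((posRoots b).card : ℤ) with hm
  set f := fiberCoeff b D 0 (weylVector b) with hf
  have hder : ∀ τ : ℂ, 0 < τ.im → HasDerivAt (fun τ => f τ * ModularForm.eta τ ^ m) 0 τ := by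
    intro τ hτ
    have hη0 : ModularForm.eta τ ≠ 0 := ModularForm.eta_ne_zero hτ
    have hη := (ModularForm.differentiableAt_eta_of_mem_upperHalfPlaneSet hτ).hasDerivAt
    set η' := deriv ModularForm.eta τ with hη'
    have hT : thetaDer 1 τ 0 = 2 * ModularForm.eta τ ^ 3 := thetaDer_one_zero_eq ⟨τ, hτ⟩
    have hT0 : thetaDer 1 τ 0 ≠ 0 := by
      rw [hT]; exact mul_ne_zero two_ne_zero (pow_ne_zero _ hη0)
    have hopen : ∀ᶠ w : ℂ in 𝓝 τ, 0 < w.im :=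
      (Complex.continuous_im.isOpen_preimage _ isOpen_Ioi).mem_nhds hτ
    have h1 : HasDerivAt (fun w => thetaDer 1 w 0) (2 * ((3 : ℕ) * ModularForm.eta τ ^ 2 * η')) τ :=
      ((hη.pow 3).const_mul 2).congr_of_eventuallyEq (by
        filter_upwards [hopen] with w hw
        exact thetaDer_one_zero_eq ⟨w, hw⟩)
    have h2 := h1.unique (hasDerivAt_thetaDer_left 1 hτ 0)
    -- The heat equation for ϑ'(τ,0), combined with Jacobi's identity. The derivative of f then
    -- becomes (N − n)(η'/η) f, which cancels against that of η^{n−N}.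
    have h3 : Real.pi * I * thetaDer 3 τ 0 / thetaDer 1 τ 0 = 12 * (η' / ModularForm.eta τ) := by
      rw [hT]
      field_simp
      push_cast at h2
      linear_combination (-4 : ℂ) * h2
    refine ((hD.hasDerivAt_fiberCoeff hτ (weylVector b)).mul
      ((hasDerivAt_zpow m _ (Or.inl hη0)).comp τ hη)).congr_deriv ?_
    rw [hD.fiberCoeff_one_weylVector hτ hT0, ← hf]
    have h4 : ModularForm.eta τ ^ m = ModularForm.eta τ ^ (m - 1) * ModularForm.eta τ := by
      rw [zpow_sub_one₀ hη0, inv_mul_cancel_right₀ hη0]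
    have h5 : (m : ℂ) = Module.finrank ℝ E - ((posRoots b).card : ℂ) := by
      rw [hm]; push_cast; rfl
    have h6 : η' = Real.pi * I * thetaDer 3 τ 0 / thetaDer 1 τ 0 * ModularForm.eta τ / 12 := by
      rw [h3]; field_simp
    rw [Function.comp_apply, h6, h5, h4]
    ring
  have hU : IsOpen {w : ℂ | 0 < w.im} := Complex.continuous_im.isOpen_preimage _ isOpen_Ioi
  obtain ⟨c, hc⟩ := hU.exists_is_const_of_deriv_eq_zero
    (convex_halfSpace_im_gt 0).isPreconnected
    (fun τ hτ => (hder τ hτ).differentiableAt.differentiableWithinAt)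
    (fun τ hτ => (hder τ hτ).deriv)
  exact ⟨c, fun τ => hc τ τ.2⟩

lemma halfSum_one : halfSum (fun _ : posRoots b => (1 : ℤ)) = weylVector b := by
  rw [halfSum, weylVector, ← Finset.sum_coe_sort (posRoots b)]
  simp

lemma card_le_sum_sq {r : posRoots b → ℤ} (hr : signProd r ≠ 0) (i : posRoots b) :
    1 ≤ (r i : ℝ) ^ 2 := by
  have h : r i ≠ 0 := by
    intro h
    refine hr (Finset.prod_eq_zero (Finset.mem_univ i) ?_)
    simp [h]
  have h2 : 1 ≤ r i ^ 2 := Int.add_one_le_iff.2 (sq_pos_of_ne_zero h)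
  exact_mod_cast h2

/-- Only the constant function `1` attains the minimum of `∑ r_i²` over the fibre of the Weyl
vector. -/
lemma eq_one_of_halfSum_eq (hD : IsCanonicalForm b D) {r : posRoots b → ℤ}
    (hr : halfSum r = weylVector b) (h : ∀ i, r i ≤ 1) : r = fun _ => 1 := by
  have h1 : ∑ i : posRoots b, ((1 : ℝ) - r i) * D (weylVector b) (P.root i) = 0 := by
    have h2 : halfSum (fun _ : posRoots b => (1 : ℤ)) - halfSum r = 0 := by
      rw [halfSum_one, hr, sub_self]
    have h3 := congrArg (D (weylVector b)) h2
    rw [halfSum, halfSum, ← smul_sub, map_smul, ← Finset.sum_sub_distrib, map_sum, map_zero,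
      smul_eq_mul, mul_eq_zero] at h3
    rw [← h3.resolve_left (by norm_num)]
    refine Finset.sum_congr rfl fun i _ => ?_
    rw [← sub_smul, map_smul, smul_eq_mul]
    push_cast
    rfl
  have h4 : ∀ i : posRoots b, 0 < D (weylVector b) (P.root i) := fun i =>
    hD.weylVector_root_pos (mem_posRoots.1 i.2)
  have h5 : ∀ i, (0 : ℝ) ≤ 1 - r i := fun i => by
    have : (r i : ℝ) ≤ 1 := by exact_mod_cast h i
    linarith
  funext i
  have h6 := (Finset.sum_eq_zero_iff_of_nonneg fun i _ =>
    mul_nonneg (h5 i) (h4 i).le).1 h1 i (Finset.mem_univ i)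
  have h7 := (mul_eq_zero.1 h6).resolve_right (h4 i).ne'
  have h8 : (r i : ℝ) = 1 := by linarith
  exact_mod_cast h8

/-- Contributing r have nonzero entries, so ∑ r_i² ≥ N. In the fibre of ρ equality holds only for r
= (1,…,1), whose coefficient is 1; the exponential removes the resulting leading power of q. -/
lemma tendsto_fiberCoeff_weylVector (hD : IsCanonicalForm b D) :
    Tendsto (fun τ : UpperHalfPlane => fiberCoeff b D 0 (weylVector b) τ *
      e ((τ : ℂ) * ((D (weylVector b) (weylVector b) / 2 - (posRoots b).card / 8 : ℝ) : ℂ)))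
      UpperHalfPlane.atImInfty (𝓝 1) := by
  classical
  set ρ := weylVector b with hρ
  set N : ℝ := ((posRoots b).card : ℝ) with hN
  let c : (posRoots b → ℤ) → ℂ := fun r => if halfSum r = ρ then signProd r else 0
  -- The absolute value matters only where the coefficient vanishes; there it keeps the exponent
  -- nonnegative.
  let w : (posRoots b → ℤ) → ℝ := fun r => |∑ i, (r i : ℝ) ^ 2 - N| / 8
  have hle : ∀ r : posRoots b → ℤ, signProd r ≠ 0 → 0 ≤ ∑ i, (r i : ℝ) ^ 2 - N := by
    intro r hr
    have : ∑ i : posRoots b, (1 : ℝ) ≤ ∑ i, (r i : ℝ) ^ 2 :=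
      Finset.sum_le_sum fun i _ => card_le_sum_sq hr i
    simp only [Finset.sum_const, Finset.card_univ, Fintype.card_coe, nsmul_eq_mul, mul_one] at this
    linarith
  have hw : ∀ r, c r ≠ 0 → w r = defect D r + (D ρ ρ / 2 - N / 8) := by
    intro r hr
    have h1 : halfSum r = ρ := by
      by_contra h; exact hr (if_neg h)
    have h2 : signProd r ≠ 0 := by simpa only [c, if_pos h1] using hr
    simp only [w]
    rw [abs_of_nonneg (hle r h2), defect, h1]
    ring
  have hterm : ∀ (τ : UpperHalfPlane) (r : posRoots b → ℤ),
      (if halfSum r = ρ then defectTerm D 0 τ r else 0) *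
        e ((τ : ℂ) * ((D ρ ρ / 2 - N / 8 : ℝ) : ℂ)) = c r * e ((τ : ℂ) * w r) := by
    intro τ r
    by_cases hr : c r = 0
    · rw [hr, zero_mul]
      by_cases h1 : halfSum r = ρ
      · have : signProd r = 0 := by simpa only [c, if_pos h1] using hr
        rw [if_pos h1, defectTerm, this, zero_mul, zero_mul]
      · rw [if_neg h1, zero_mul]
    · have h1 : halfSum r = ρ := by
        by_contra h; exact hr (if_neg h)
      rw [hw r hr, if_pos h1, defectTerm, pow_zero, one_mul, mul_assoc, ← e_add, ← mul_add,
        ← Complex.ofReal_add]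
      simp only [c, if_pos h1]
  have hsum : Summable fun r => ‖c r‖ * Real.exp (-(2 * Real.pi * w r)) := by
    have h1 := (summable_fiber (b := b) D UpperHalfPlane.I.2 ρ).mul_right
      ‖e ((UpperHalfPlane.I : ℂ) * ((D ρ ρ / 2 - N / 8 : ℝ) : ℂ))‖
    refine h1.congr fun r => ?_
    have h2 := congrArg norm (hterm UpperHalfPlane.I r)
    rw [norm_mul, norm_mul, norm_e_mul_ofReal _ (w r)] at h2
    have h3 : ((UpperHalfPlane.I : UpperHalfPlane) : ℂ).im = 1 := by simp
    rw [h3, mul_one] at h2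
    rw [← h2]
    congr 1
    by_cases h4 : halfSum r = ρ <;> simp [h4]
  have h := tendsto_tsum_e_atImInfty (fun r => by simp only [w]; positivity) hsum
  have hval : (∑' r, if w r = 0 then c r else 0) = 1 := by
    rw [tsum_eq_single (fun _ => 1)]
    · have h1 : w (fun _ => 1) = 0 := by simp [w, hN]
      rw [if_pos h1]
      simp only [c, halfSum_one]
      simp [signProd, hρ]
    · intro r hr
      by_cases h1 : w r = 0
      · rw [if_pos h1]
        by_contra h2
        have h3 : halfSum r = ρ := by
          by_contra h; exact h2 (if_neg h)
        have h4 : signProd r ≠ 0 := by simpa only [c, if_pos h3] using h2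
        refine hr (hD.eq_one_of_halfSum_eq h3 fun i => ?_)
        have h5 : ∑ i, ((r i : ℝ) ^ 2 - 1) = 0 := by
          simp only [w, div_eq_zero_iff, abs_eq_zero] at h1
          rw [Finset.sum_sub_distrib, ← h1.resolve_right (by norm_num)]
          simp [hN]
        have h6 := (Finset.sum_eq_zero_iff_of_nonneg fun i _ =>
          sub_nonneg.2 (card_le_sum_sq h4 i)).1 h5 i (Finset.mem_univ i)
        have h7 : r i ^ 2 = 1 := by
          have : (r i : ℝ) ^ 2 = 1 := by linarith
          exact_mod_cast this
        nlinarith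
      · rw [if_neg h1]
  rw [hval] at h
  refine h.congr fun τ => ?_
  rw [fiberCoeff, ← tsum_mul_right]
  exact tsum_congr fun r => (hterm τ r).symm

lemma tendsto_e_mul_atImInfty {w : ℝ} (hw : 0 ≤ w) :
    Tendsto (fun τ : UpperHalfPlane => e ((τ : ℂ) * w)) UpperHalfPlane.atImInfty
      (𝓝 (if w = 0 then 1 else 0)) := by
  have h := tendsto_tsum_e_atImInfty (α := Unit) (c := fun _ => 1) (w := fun _ => w)
    (fun _ => hw) (hasSum_fintype _).summable
  simpa using h

/-- The coefficient at the Weyl vector, and the strange formula. -/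
lemma fiberCoeff_weylVector_mul (hD : IsCanonicalForm b D) :
    (∀ τ : UpperHalfPlane, fiberCoeff b D 0 (weylVector b) τ *
      eta τ ^ ((Module.finrank ℝ E : ℤ) - ((posRoots b).card : ℤ)) = 1) ∧
    D (weylVector b) (weylVector b) / 2 =
      ((Module.finrank ℝ E : ℝ) + 2 * (posRoots b).card) / 24 := by
  obtain ⟨c, hc⟩ := hD.exists_fiberCoeff_weylVector
  set m : ℤ := (Module.finrank ℝ E : ℤ) - ((posRoots b).card : ℤ) with hm
  set ρ := weylVector b
  set y : ℝ := D ρ ρ / 2 - (Module.finrank ℝ E + 2 * (posRoots b).card) / 24 with hy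
  have h1 : Tendsto (fun τ : UpperHalfPlane => c * e ((τ : ℂ) * y))
      UpperHalfPlane.atImInfty (𝓝 1) := by
    have h2 := hD.tendsto_fiberCoeff_weylVector.mul (tendsto_eta_atImInfty.zpow₀ m (Or.inl one_ne_zero))
    rw [one_zpow, mul_one] at h2
    refine h2.congr fun τ => ?_
    have h3 : e (-(τ : ℂ) / 24) ^ m = e (m * (-(τ : ℂ) / 24)) := by
      simp only [e]
      rw [← Complex.exp_int_mul]
      congr 1
      ring
    have h4 : (m : ℂ) = Module.finrank ℝ E - ((posRoots b).card : ℂ) := by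
      rw [hm]; push_cast; rfl
    rw [← hc τ, mul_zpow, h3, mul_mul_mul_comm, ← e_add, h4, hy]
    congr 2
    push_cast
    ring
  -- A function c·e(τy) tending to 1 at i∞ must be constant: for y > 0 it tends to 0, and for y < 0
  -- a finite limit would force c = 0.
  have hboth : c = 1 ∧ y = 0 := by
    rcases le_or_gt 0 y with h | h
    · have h2 := tendsto_nhds_unique h1 ((tendsto_e_mul_atImInfty h).const_mul c)
      by_cases h3 : y = 0
      · rw [if_pos h3, mul_one] at h2
        exact ⟨h2.symm, h3⟩
      · rw [if_neg h3, mul_zero] at h2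
        exact absurd h2 one_ne_zero
    · have h2 := h1.mul (tendsto_e_mul_atImInfty (w := -y) (by linarith))
      rw [if_neg (by linarith), mul_zero] at h2
      have h3 : c = 0 := by
        refine tendsto_nhds_unique (tendsto_const_nhds.congr fun τ => ?_) h2
        rw [mul_assoc, ← e_add, ← mul_add]
        simp [e_zero]
      simp only [h3, zero_mul] at h1
      exact absurd (tendsto_nhds_unique tendsto_const_nhds h1) zero_ne_one
  refine ⟨fun τ => by rw [hc, hboth.1], ?_⟩
  linarith [hboth.2]

end IsCanonicalForm

end Root

end ThetaBlocks
end

/-! ### Constant coefficients, and construction of the canonical form -/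

noncomputable section

set_option linter.unusedSectionVars false

namespace ThetaBlocks

open RootPairing Filter Topology

section Root

variable {ι E M : Type*} [Fintype ι] [NormedAddCommGroup E] [InnerProductSpace ℝ E]
  [AddCommGroup M] [Module ℝ M] {P : RootPairing ι ℝ E M} (b : P.Base)
  (D : LinearMap.BilinForm ℝ E)

/-! ### The signs in the Macdonald identity -/

/-- The coefficients of the theta decomposition of the theta function of a root system. -/
def macdonaldCoeff (x : E) : ℂ :=
  fiberCoeff b D 0 x UpperHalfPlane.I *
    eta UpperHalfPlane.I ^ ((Module.finrank ℝ E : ℤ) - ((posRoots b).card : ℤ))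

variable {b D}

namespace IsCanonicalForm

lemma macdonaldCoeff_smul (hD : IsCanonicalForm b D) (g : P.weylGroup) (x : E) :
    macdonaldCoeff b D (g • x) = (-1) ^ weylLength b g * macdonaldCoeff b D x := by
  rw [macdonaldCoeff, macdonaldCoeff, hD.fiberCoeff_smul, mul_assoc]

lemma macdonaldCoeff_add (hD : IsCanonicalForm b D) {y : E} (hy : IsEvenVector P D y) (x : E) :
    macdonaldCoeff b D (x + y) = macdonaldCoeff b D x := by
  rw [macdonaldCoeff, macdonaldCoeff, hD.fiberCoeff_add _ _ hy]

variable [P.IsCrystallographic] [P.IsReduced]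

lemma isWeight_of_macdonaldCoeff_ne_zero {x : E} (hx : macdonaldCoeff b D x ≠ 0) :
    IsWeight P x :=
  isWeight_of_fiberCoeff_ne_zero (left_ne_zero_of_mul hx)

lemma exists_smul_add_eq_of_ne_zero (hD : IsCanonicalForm b D) {x : E}
    (hx : macdonaldCoeff b D x ≠ 0) :
    ∃ (g : P.weylGroup) (y : E), IsEvenVector P D y ∧ g • x + y = weylVector b := by
  obtain ⟨s, hs, h⟩ := hD.exists_fiberCoeff_eq_mul x
  refine h fun h0 => hx ?_
  rw [macdonaldCoeff, hs, h0, zero_mul, zero_mul]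

/-- With m_i = D(y,α_i) the difference is ∑ m_i(m_i − 1)/2. This puts ρ in the shadow of the
lattice. -/
lemma exists_apply_self_sub (hD : IsCanonicalForm b D) {y : E}
    (hy : ∀ i, ∃ m : ℤ, D y (P.root i) = m) :
    ∃ m : ℤ, D y y / 2 - D (weylVector b) y = m := by
  choose m hm using hy
  have h2 : ∀ k : ℤ, ∃ c : ℤ, k ^ 2 - k = 2 * c := fun k => by
    obtain ⟨c, hc⟩ := Int.even_mul_pred_self k
    exact ⟨c, by linear_combination hc⟩
  choose c hc using h2
  refine ⟨∑ i ∈ posRoots b, c (m i), ?_⟩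
  have h3 : D (weylVector b) y = 1 / 2 * ∑ i ∈ posRoots b, (m i : ℝ) := by
    rw [hD.symm, weylVector, map_smul, map_sum, smul_eq_mul]
    exact congrArg _ (Finset.sum_congr rfl fun i _ => hm i)
  rw [h3, ← hD.apply_sum, Finset.mul_sum, Finset.sum_div, ← Finset.sum_sub_distrib, Int.cast_sum]
  refine Finset.sum_congr rfl fun i _ => ?_
  have h4 : ((m i : ℝ)) ^ 2 - m i = 2 * c (m i) := by exact_mod_cast hc (m i)
  rw [hm]
  linear_combination h4 / 2

lemma exists_apply_self_sub_of_ne_zero (hD : IsCanonicalForm b D) {x : E}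
    (hx : macdonaldCoeff b D x ≠ 0) {y : E} (hy : ∀ i, ∃ m : ℤ, D y (P.root i) = m) :
    ∃ m : ℤ, D y y / 2 - D x y = m := by
  obtain ⟨g, z, hz, h⟩ := hD.exists_smul_add_eq_of_ne_zero hx
  have hgy : ∀ i, ∃ m : ℤ, D (g • y) (P.root i) = m := fun i => by
    rw [hD.apply_smul_root]; exact hy _
  obtain ⟨m, hm⟩ := hD.exists_apply_self_sub hgy
  obtain ⟨n, hn⟩ := hD.exists_int_apply hz.1 hgy
  refine ⟨m + n, ?_⟩
  rw [← hD.weyl g y y, ← hD.weyl g x y, eq_sub_of_add_eq h, map_sub, LinearMap.sub_apply, hn]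
  push_cast
  linear_combination hm

lemma exists_natCast_smul (hD : IsCanonicalForm b D) {x : E} (hx : IsWeight P x) :
    ∃ m : ℕ, 0 < m ∧ ∀ i, ∃ k : ℤ, D (m • x) (P.root i) = k := by
  choose m hm0 hm using fun i => hD.exists_rootLevel_eq (P := P) i
  have hM : 0 < ∏ i, m i := Finset.prod_pos fun i _ => hm0 i
  refine ⟨(∏ i, m i).toNat, by omega, fun i => ?_⟩
  obtain ⟨k, hk⟩ := hx i
  obtain ⟨c, hc⟩ := Finset.dvd_prod_of_mem m (Finset.mem_univ i)
  refine ⟨c * k, ?_⟩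
  have h1 : (((∏ i, m i).toNat : ℕ) : ℝ) = m i * c := by
    rw [← Int.cast_natCast, Int.toNat_of_nonneg hM.le, hc]
    push_cast
    rfl
  rw [map_nsmul, LinearMap.smul_apply, nsmul_eq_mul, h1, ← hm, mul_comm _ (c : ℝ), mul_assoc,
    hD.rootLevel_mul, hk]
  push_cast
  rfl

variable [P.IsRootSystem]

lemma fiberCoeff_mul_eta (hD : IsCanonicalForm b D) (x : E) (τ : UpperHalfPlane) :
    fiberCoeff b D 0 x τ * eta τ ^ ((Module.finrank ℝ E : ℤ) - ((posRoots b).card : ℤ)) =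
      macdonaldCoeff b D x := by
  obtain ⟨s, hs, -⟩ := hD.exists_fiberCoeff_eq_mul x
  have h := hD.fiberCoeff_weylVector_mul.1
  rw [macdonaldCoeff, hs, hs, mul_assoc, mul_assoc, h, h]

lemma macdonaldCoeff_weylVector (hD : IsCanonicalForm b D) :
    macdonaldCoeff b D (weylVector b) = 1 :=
  hD.fiberCoeff_weylVector_mul.1 _

/-- The theta decomposition of the theta function of a root system. -/
lemma hasSum_macdonaldCoeff (hD : IsCanonicalForm b D) (τ : UpperHalfPlane) (ζ : E →ₗ[ℝ] ℂ) :
    HasSum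
      (fun x => macdonaldCoeff b D x * (e ((τ : ℂ) * ((D x x / 2 : ℝ) : ℂ)) * e (ζ x)))
      (eta τ ^ ((Module.finrank ℝ E : ℤ) - ((posRoots b).card : ℤ)) *
        ∏ i ∈ posRoots b, theta τ (ζ (P.root i))) := by
  have h := (hasSum_fiberCoeff_zero (b := b) D τ.2 ζ).mul_left
    (eta τ ^ ((Module.finrank ℝ E : ℤ) - ((posRoots b).card : ℤ)))
  simp only [← theta_eq_thetaDer] at h
  rw [Finset.prod_coe_sort (posRoots b) fun i => theta τ (ζ (P.root i))] at h
  refine h.congr_fun fun x => ?_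
  rw [← hD.fiberCoeff_mul_eta x τ]
  ring

/-- The strange formula settles x = ρ. The Weyl group preserves the norm, and an even translation
changes half the norm at ρ by an integer. -/
lemma exists_apply_self_div_two (hD : IsCanonicalForm b D) {x : E}
    (hx : macdonaldCoeff b D x ≠ 0) :
    ∃ j : ℤ, D x x / 2 = ((Module.finrank ℝ E : ℝ) + 2 * (posRoots b).card) / 24 + j := by
  obtain ⟨g, z, hz, h⟩ := hD.exists_smul_add_eq_of_ne_zero hx
  obtain ⟨m, hm⟩ := hD.exists_apply_self_sub hz.1
  refine ⟨m, ?_⟩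
  rw [← hD.fiberCoeff_weylVector_mul.2, ← hD.weyl g x x, eq_sub_of_add_eq h]
  simp only [map_sub, LinearMap.sub_apply]
  rw [hD.symm z (weylVector b)]
  linear_combination hm

end IsCanonicalForm

/-! ### Existence of the canonical form -/

variable (b)

/-- The operator `x ↦ ∑_{r ∈ R⁺} (x,r) r`. -/
def rootOperator : E →ₗ[ℝ] E := ∑ i ∈ posRoots b, (innerₗ E (P.root i)).smulRight (P.root i)

lemma rootOperator_apply (x : E) :
    rootOperator b x = ∑ i ∈ posRoots b, inner ℝ x (P.root i) • P.root i := by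
  rw [rootOperator, LinearMap.sum_apply]
  exact Finset.sum_congr rfl fun i _ => by
    rw [LinearMap.smulRight_apply, innerₗ_apply_apply, real_inner_comm]

lemma rootOperator_isSymmetric : (rootOperator b).IsSymmetric := by
  intro x y
  rw [rootOperator_apply, rootOperator_apply, sum_inner, inner_sum]
  refine Finset.sum_congr rfl fun i _ => ?_
  rw [real_inner_smul_left, real_inner_smul_right, real_inner_comm y, mul_comm]

lemma inner_rootOperator_pos [P.IsRootSystem] {x : E} (hx : x ≠ 0) :
    0 < inner ℝ x (rootOperator b x) := by
  rw [rootOperator_apply, inner_sum]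
  simp only [real_inner_smul_right]
  have h0 : ∀ i ∈ posRoots b, 0 ≤ inner ℝ x (P.root i) * inner ℝ x (P.root i) :=
    fun i _ => mul_self_nonneg _
  refine lt_of_le_of_ne (Finset.sum_nonneg h0) fun h => hx ?_
  have h1 := (Finset.sum_eq_zero_iff_of_nonneg h0).1 h.symm
  have h2 : ∀ i ∈ posRoots b, inner ℝ x (P.root i) = 0 := fun i hi => by simpa using h1 i hi
  have h3 : ∀ i, inner ℝ x (P.root i) = 0 := by
    intro i
    by_cases hi : i ∈ posRoots b
    · exact h2 i hi
    · have := h2 _ (neg_mem_posRoots hi)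
      rwa [root_neg, inner_neg_right, neg_eq_zero] at this
  have h4 : innerₗ E x = 0 :=
    LinearMap.ext_on_range (v := P.root) RootPairing.IsRootSystem.span_root_eq_top fun i => h3 i
  have h5 := congrArg (fun f => f x) h4
  simpa using h5

variable (hP : ∀ (i : ι) (x y : E), inner ℝ (P.reflection i x) (P.reflection i y) = inner ℝ x y)
include hP

lemma rootOperator_reflection (i : ι) (x : E) :
    rootOperator b (P.reflection i x) = P.reflection i (rootOperator b x) := by
  have key : ∀ x, (2 : ℝ) • rootOperator b x = ∑ j, inner ℝ x (P.root j) • P.root j := by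
    intro x
    rw [sum_eq_two_nsmul_sum_posRoots b, rootOperator_apply, two_smul, two_nsmul]
    intro j
    rw [root_neg, inner_neg_right, neg_smul_neg]
  have h2 : (2 : ℝ) • rootOperator b (P.reflection i x) =
      (2 : ℝ) • P.reflection i (rootOperator b x) := by
    rw [key, ← map_smul, key, map_sum, ← Equiv.sum_comp (P.reflectionPerm i)]
    refine Finset.sum_congr rfl fun j _ => ?_
    rw [map_smul, root_reflectionPerm, hP]
  exact smul_right_injective E (two_ne_zero (α := ℝ)) h2

/-- Take D(x,y) = (T⁻¹x, y), where T is the symmetric positive operator `rootOperator`, which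
commutes with the reflections. -/
theorem exists_isCanonicalForm [P.IsRootSystem] :
    ∃ D : LinearMap.BilinForm ℝ E, IsCanonicalForm b D := by
  have := finiteDimensional_of_isRootSystem P
  have hinj : Function.Injective (rootOperator b) := by
    refine (injective_iff_map_eq_zero _).2 fun x hx => ?_
    by_contra h
    have := inner_rootOperator_pos b h
    rw [hx, inner_zero_right] at this
    exact lt_irrefl _ this
  let T : E ≃ₗ[ℝ] E := LinearEquiv.ofInjectiveEndo (rootOperator b) hinj
  have hT : ∀ x, T x = rootOperator b x := fun x => rfl
  let D : LinearMap.BilinForm ℝ E := (innerₗ E).comp T.symm.toLinearMap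
  have hDT : ∀ x y, D (T x) y = inner ℝ x y := fun x y => by
    change inner ℝ (T.symm (T x)) y = _
    rw [T.symm_apply_apply]
  refine ⟨D, fun x y => ?_, fun x hx => ?_, fun i x y => ?_, fun x => ?_⟩
  · obtain ⟨x, rfl⟩ := T.surjective x
    obtain ⟨y, rfl⟩ := T.surjective y
    rw [hDT, hDT, hT, hT, ← rootOperator_isSymmetric b, real_inner_comm]
  · obtain ⟨x, rfl⟩ := T.surjective x
    rw [hDT, hT]
    exact inner_rootOperator_pos b fun h => hx (by rw [h, map_zero])
  · obtain ⟨x, rfl⟩ := T.surjective x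
    rw [hDT, hT, ← rootOperator_reflection b hP, ← hT, hDT, hP]
  · obtain ⟨x, rfl⟩ := T.surjective x
    simp only [hDT]
    rw [hT, rootOperator_apply]

/-- For irreducible root systems, the canonical form is `(·,·)/h`. -/
theorem isCanonicalForm_inner [P.IsRootSystem] [P.IsIrreducible] :
    0 < hNumber b ∧ IsCanonicalForm b ((hNumber b)⁻¹ • innerₗ E) := by
  have := finiteDimensional_of_isRootSystem P
  have hnt : Nontrivial E := RootPairing.IsIrreducible.nontrivial P
  obtain ⟨μ, hμ⟩ : ∃ μ : ℝ, Module.End.HasEigenvalue (rootOperator b) μ :=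
    ⟨_, (rootOperator_isSymmetric b).hasEigenvalue_iSup_of_finiteDimensional⟩
  -- Schur's argument: the symmetric operator has a real eigenvalue, whose eigenspace is stable
  -- under all reflections. Its trace below identifies the eigenvalue with h.
  have htop : Module.End.eigenspace (rootOperator b) μ = ⊤ := by
    refine RootPairing.IsIrreducible.eq_top_of_invtSubmodule_reflection (P := P) _ ?_ hμ
    intro i x hx
    rw [Module.End.mem_eigenspace_iff] at hx
    change P.reflection i x ∈ Module.End.eigenspace (rootOperator b) μ
    rw [Module.End.mem_eigenspace_iff, rootOperator_reflection b hP, hx, map_smul]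
  have hT : ∀ x, rootOperator b x = μ • x := fun x =>
    Module.End.mem_eigenspace_iff.1 (htop ▸ Submodule.mem_top)
  have hn : (0 : ℝ) < Module.finrank ℝ E := by exact_mod_cast Module.finrank_pos
  have hμh : μ = hNumber b := by
    have h1 : rootOperator b = μ • LinearMap.id := LinearMap.ext hT
    have h2 := congrArg (LinearMap.trace ℝ E) h1
    rw [map_smul, LinearMap.trace_id, rootOperator, map_sum, smul_eq_mul] at h2
    simp only [LinearMap.trace_smulRight, innerₗ_apply_apply] at h2
    rw [hNumber, h2, mul_div_cancel_right₀ _ hn.ne']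
  have hpos : 0 < hNumber b := by
    obtain ⟨x, hx⟩ := exists_ne (0 : E)
    have h1 := inner_rootOperator_pos b hx
    rw [hT, real_inner_smul_right, hμh] at h1
    exact (pos_iff_pos_of_mul_pos h1).2 (real_inner_self_pos.2 hx)
  refine ⟨hpos, fun x y => ?_, fun x hx => ?_, fun i x y => ?_, fun x => ?_⟩
  · simp [real_inner_comm]
  · simp only [LinearMap.smul_apply, innerₗ_apply_apply, smul_eq_mul]
    exact mul_pos (inv_pos.2 hpos) (real_inner_self_pos.2 hx)
  · simp [hP]
  · simp only [LinearMap.smul_apply, innerₗ_apply_apply, smul_eq_mul, mul_smul]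
    rw [← Finset.smul_sum, ← rootOperator_apply, hT, hμh, inv_smul_smul₀ hpos.ne']

end Root

end ThetaBlocks
end

/-! ### The theta function of a root system as a Jacobi form -/

noncomputable section

set_option linter.unusedSectionVars false

namespace ThetaBlocks

open RootPairing Filter Topology

lemma differentiableAt_finset_prod_apply {F I : Type*} [NormedAddCommGroup F] [NormedSpace ℂ F]
    {s : Finset I} {g : I → F → ℂ} {x : F} (h : ∀ i ∈ s, DifferentiableAt ℂ (g i) x) :
    DifferentiableAt ℂ (fun x => ∏ i ∈ s, g i x) x := by
  classical
  induction s using Finset.induction_on with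
  | empty => simp
  | insert a s ha ih =>
    simp only [Finset.prod_insert ha]
    exact (h a (Finset.mem_insert_self a s)).mul
      (ih fun i hi => h i (Finset.mem_insert_of_mem hi))

lemma differentiableAt_eta_mul_prod_theta {F I : Type*} [NormedAddCommGroup F] [NormedSpace ℂ F]
    (s : Finset I) (l : I → F →L[ℂ] ℂ) (m : ℤ) {p : ℂ × F} (hp : 0 < p.1.im) :
    DifferentiableAt ℂ (fun p : ℂ × F =>
      ModularForm.eta p.1 ^ m * ∏ i ∈ s, thetaDer 0 p.1 (l i p.2)) p := by
  have h0 : DifferentiableAt ℂ ModularForm.eta p.1 :=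
    ModularForm.differentiableAt_eta_of_mem_upperHalfPlaneSet hp
  have h1 : DifferentiableAt ℂ (fun p : ℂ × F => ModularForm.eta p.1) p :=
    h0.comp p differentiableAt_fst
  have h2 : ModularForm.eta p.1 ≠ 0 := ModularForm.eta_ne_zero hp
  refine DifferentiableAt.fun_mul (h1.zpow (Or.inl h2)) ?_
  refine differentiableAt_finset_prod_apply fun i _ => ?_
  have h3 : DifferentiableAt ℂ (fun p : ℂ × F => ((p.1, l i p.2) : ℂ × ℂ)) p := by
    fun_prop
  have h4 : DifferentiableAt ℂ (fun p : ℂ × ℂ => thetaDer 0 p.1 p.2)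
      ((fun p : ℂ × F => ((p.1, l i p.2) : ℂ × ℂ)) p) := differentiableAt_thetaDer_zero hp
  exact h4.comp p h3

section Root

variable {ι E M : Type*} [Fintype ι] [NormedAddCommGroup E] [InnerProductSpace ℝ E]
  [AddCommGroup M] [Module ℝ M] {P : RootPairing ι ℝ E M} {b : P.Base}
  {V : Type*} [AddCommGroup V] [Module ℂ V]

/-- The embedding of the space of a root system into a complex vector space which sends the basis
dual to the simple roots (with respect to `D`) to the basis `B`. -/
def realEmbed (D : LinearMap.BilinForm ℝ E) (B : Module.Basis b.support ℂ V) : E →+ V where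
  toFun x := ∑ f : b.support, ((D x (P.root f) : ℝ) : ℂ) • B f
  map_zero' := by simp
  map_add' x y := by
    simp [add_smul, Finset.sum_add_distrib]

variable {D : LinearMap.BilinForm ℝ E} (B : Module.Basis b.support ℂ V)

lemma realEmbed_apply (x : E) :
    realEmbed D B x = ∑ f : b.support, ((D x (P.root f) : ℝ) : ℂ) • B f := rfl

lemma realEmbed_smul (c : ℝ) (x : E) : realEmbed D B (c • x) = (c : ℂ) • realEmbed D B x := by
  rw [realEmbed_apply, realEmbed_apply, Finset.smul_sum]
  refine Finset.sum_congr rfl fun f _ => ?_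
  rw [map_smul, LinearMap.smul_apply, smul_eq_mul, Complex.ofReal_mul, smul_smul]

variable [P.IsRootSystem]

namespace IsCanonicalForm

lemma nondegenerate (hD : IsCanonicalForm b D) : LinearMap.BilinForm.Nondegenerate D := by
  constructor
  · intro x hx
    by_contra h
    exact (hD.pos x h).ne' (hx x)
  · intro x hx
    by_contra h
    exact (hD.pos x h).ne' (hx x)

/-- The basis dual to the simple roots. -/
lemma exists_coweight [DecidableEq b.support] (hD : IsCanonicalForm b D) :
    ∃ ω : Module.Basis b.support ℝ E,
      ∀ f f' : b.support, D (ω f) (P.root f') = if f' = f then 1 else 0 := by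
  refine ⟨LinearMap.BilinForm.dualBasis D hD.nondegenerate b.toWeightBasis, fun f f' => ?_⟩
  rw [← b.toWeightBasis_apply, LinearMap.BilinForm.apply_dualBasis_left]

lemma realEmbed_coweight [DecidableEq b.support] {ω : Module.Basis b.support ℝ E}
    (hω : ∀ f f' : b.support, D (ω f) (P.root f') = if f' = f then 1 else 0) (f : b.support) :
    realEmbed D B (ω f) = B f := by
  simp [realEmbed_apply, hω]

lemma sum_smul_coweight [DecidableEq b.support] (hD : IsCanonicalForm b D)
    {ω : Module.Basis b.support ℝ E}
    (hω : ∀ f f' : b.support, D (ω f) (P.root f') = if f' = f then 1 else 0) (x : E) :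
    ∑ f : b.support, D x (P.root f) • ω f = x := by
  have h : D (∑ f : b.support, D x (P.root f) • ω f) = D x := by
    refine b.toWeightBasis.ext fun f => ?_
    simp [hω]
  exact sub_eq_zero.1 (hD.nondegenerate.1 _ fun y => by rw [map_sub, h, sub_self, LinearMap.zero_apply])

variable [P.IsCrystallographic] [P.IsReduced]

/-- Integrality on all roots reduces to the simple roots, so their dual basis is a ℤ-basis of the
lattice dual to the root lattice. -/
lemma mem_closure_range_iff (hD : IsCanonicalForm b D) {v : V} :
    v ∈ AddSubgroup.closure (Set.range B) ↔
      ∃ y : E, (∀ i, ∃ m : ℤ, D y (P.root i) = m) ∧ realEmbed D B y = v := by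
  classical
  constructor
  · intro hv
    obtain ⟨ω, hω⟩ := hD.exists_coweight
    induction hv using AddSubgroup.closure_induction with
    | mem v hv =>
      obtain ⟨f, rfl⟩ := hv
      refine ⟨ω f, fun i => ?_, realEmbed_coweight B hω f⟩
      refine ⟨rootCoeff b i f, ?_⟩
      rw [apply_root_eq_sum (b := b)]
      simp [hω]
    | zero => exact ⟨0, fun i => ⟨0, by simp⟩, map_zero _⟩
    | add v w _ _ hv hw =>
      obtain ⟨y, hy, rfl⟩ := hv
      obtain ⟨z, hz, rfl⟩ := hw
      refine ⟨y + z, fun i => ?_, map_add _ _ _⟩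
      obtain ⟨m, hm⟩ := hy i
      obtain ⟨n, hn⟩ := hz i
      exact ⟨m + n, by rw [map_add, LinearMap.add_apply, hm, hn]; push_cast; rfl⟩
    | neg v _ hv =>
      obtain ⟨y, hy, rfl⟩ := hv
      refine ⟨-y, fun i => ?_, map_neg _ _⟩
      obtain ⟨m, hm⟩ := hy i
      exact ⟨-m, by rw [map_neg, LinearMap.neg_apply, hm]; push_cast; rfl⟩
  · rintro ⟨y, hy, rfl⟩
    choose m hm using hy
    rw [realEmbed_apply]
    refine AddSubgroup.sum_mem _ fun f _ => ?_
    rw [hm, Complex.ofReal_intCast, Int.cast_smul_eq_zsmul]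
    exact AddSubgroup.zsmul_mem _ (AddSubgroup.subset_closure (Set.mem_range_self f)) _

variable {B} {β : LinearMap.BilinForm ℂ V}

lemma form_symm (hD : IsCanonicalForm b D)
    (hβ : ∀ x y, β (realEmbed D B x) (realEmbed D B y) = (D x y : ℂ)) (z w : V) :
    β z w = β w z := by
  classical
  obtain ⟨ω, hω⟩ := hD.exists_coweight
  have h : β = β.flip := LinearMap.BilinForm.ext_basis B fun f f' => by
    rw [show β.flip (B f) (B f') = β (B f') (B f) from rfl, ← realEmbed_coweight B hω, ← realEmbed_coweight B hω, hβ, hβ, hD.symm]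
  conv_lhs => rw [h]
  rfl

lemma form_eq_sum (hD : IsCanonicalForm b D)
    (hβ : ∀ x y, β (realEmbed D B x) (realEmbed D B y) = (D x y : ℂ)) (z w : V) :
    β z w = ∑ i ∈ posRoots b,
      β (realEmbed D B (P.root i)) z * β (realEmbed D B (P.root i)) w := by
  classical
  obtain ⟨ω, hω⟩ := hD.exists_coweight
  have h : β = ∑ i ∈ posRoots b, LinearMap.BilinForm.linMulLin (β (realEmbed D B (P.root i)))
      (β (realEmbed D B (P.root i))) := LinearMap.BilinForm.ext_basis B fun f f' => by
    rw [LinearMap.BilinForm.sum_apply, ← realEmbed_coweight B hω, ← realEmbed_coweight B hω, hβ,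
      ← hD.apply_sum]
    push_cast
    refine Finset.sum_congr rfl fun i _ => ?_
    rw [LinearMap.BilinForm.linMulLin_apply, hβ, hβ, hD.symm (P.root i), hD.symm (P.root i)]
  conv_lhs => rw [h]
  rw [LinearMap.BilinForm.sum_apply]
  rfl

lemma form_nondegenerate (hD : IsCanonicalForm b D)
    (hβ : ∀ x y, β (realEmbed D B x) (realEmbed D B y) = (D x y : ℂ)) (z : V)
    (hz : ∀ w, β z w = 0) : z = 0 := by
  classical
  obtain ⟨ω, hω⟩ := hD.exists_coweight
  refine (B.forall_coord_eq_zero_iff).1 fun f => ?_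
  have h := hz (realEmbed D B (P.root f))
  rw [← B.sum_repr z, map_sum, LinearMap.sum_apply] at h
  rw [Finset.sum_eq_single f] at h
  · rw [map_smul, LinearMap.smul_apply, ← realEmbed_coweight B hω, hβ, hω, if_pos rfl] at h
    simpa using h
  · intro f' _ hf
    rw [map_smul, LinearMap.smul_apply, ← realEmbed_coweight B hω, hβ, hω, if_neg (Ne.symm hf)]
    simp
  · simp

lemma form_isIntegralLattice (hD : IsCanonicalForm b D)
    (hβ : ∀ x y, β (realEmbed D B x) (realEmbed D B y) = (D x y : ℂ)) :
    IsIntegralLattice (AddSubgroup.closure (Set.range B)) β where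
  exists_basis := ⟨Fintype.card b.support, B.reindex (Fintype.equivFin _), by
    rw [Module.Basis.range_reindex]⟩
  symm := hD.form_symm hβ
  nondegenerate := hD.form_nondegenerate hβ
  integral := by
    intro x hx y hy
    obtain ⟨x, hx', rfl⟩ := (hD.mem_closure_range_iff B).1 hx
    obtain ⟨y, hy', rfl⟩ := (hD.mem_closure_range_iff B).1 hy
    obtain ⟨m, hm⟩ := hD.exists_int_apply hx' hy'
    exact ⟨m, by rw [hβ, hm]; simp⟩

lemma realEmbed_injective (hD : IsCanonicalForm b D)
    (hβ : ∀ x y, β (realEmbed D B x) (realEmbed D B y) = (D x y : ℂ)) :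
    Function.Injective (realEmbed D B) := by
  refine (injective_iff_map_eq_zero _).2 fun x hx => ?_
  by_contra h
  have h2 := hβ x x
  rw [hx, map_zero] at h2
  exact (hD.pos x h).ne' (by exact_mod_cast h2.symm)

lemma realEmbed_mem_shadow (hD : IsCanonicalForm b D)
    (hβ : ∀ x y, β (realEmbed D B x) (realEmbed D B y) = (D x y : ℂ)) {x : E}
    (hx : macdonaldCoeff b D x ≠ 0) :
    realEmbed D B x ∈ shadow (AddSubgroup.closure (Set.range B)) β := by
  constructor
  · obtain ⟨m, hm0, hm⟩ := hD.exists_natCast_smul (isWeight_of_macdonaldCoeff_ne_zero hx)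
    exact ⟨m, hm0, (hD.mem_closure_range_iff B).2 ⟨m • x, hm, map_nsmul _ _ _⟩⟩
  · intro y hy
    obtain ⟨y, hy', rfl⟩ := (hD.mem_closure_range_iff B).1 hy
    obtain ⟨m, hm⟩ := hD.exists_apply_self_sub_of_ne_zero hx hy'
    refine ⟨m, ?_⟩
    rw [hβ, hβ]
    exact_mod_cast congrArg (fun t : ℝ => (t : ℂ)) hm

variable (b D B β) in
/-- The theta function of a root system on a complex vector space. -/
def _root_.ThetaBlocks.formTheta (τ : UpperHalfPlane) (z : V) : ℂ :=
  eta τ ^ ((Module.finrank ℝ E : ℤ) - ((posRoots b).card : ℤ)) *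
    ∏ i ∈ posRoots b, theta τ (β (realEmbed D B (P.root i)) z)

lemma hasSum_formTheta (hD : IsCanonicalForm b D) (τ : UpperHalfPlane)
    (z : V) :
    HasSum (fun x => macdonaldCoeff b D x *
      (e ((τ : ℂ) * ((D x x / 2 : ℝ) : ℂ)) * e (β (realEmbed D B x) z)))
      (formTheta b D B β τ z) := by
  let ζ : E →ₗ[ℝ] ℂ :=
    { toFun := fun x => β (realEmbed D B x) z
      map_add' := fun x y => by simp
      map_smul' := fun c x => by simp [realEmbed_smul] }
  exact hD.hasSum_macdonaldCoeff τ ζ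

/-- Each of the N theta factors contributes (cτ+d)⁻¹ε³ and the eta power ε^{n−N}, in total
(cτ+d)^{−N} ε^{n+2N}; here −N = k − h/2 for k = n/2. The Gaussian exponents add up by `form_eq_sum`.
-/
lemma formTheta_smul (hD : IsCanonicalForm b D)
    (hβ : ∀ x y, β (realEmbed D B x) (realEmbed D B y) = (D x y : ℂ))
    (A : Matrix.SpecialLinearGroup (Fin 2) ℤ) (τ : UpperHalfPlane) (z : V) :
    formTheta b D B β (A • τ) ((autFactor A τ)⁻¹ • z) =
      e ((A 1 0 : ℂ) * (β z z / 2) / autFactor A τ) * autFactor A τ ^ (-((posRoots b).card : ℤ)) *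
        (eta (A • τ) / eta τ) ^ ((Module.finrank ℝ E : ℤ) + 2 * ((posRoots b).card : ℤ)) *
          formTheta b D B β τ z := by
  have h0 := eta_ne_zero τ
  have h1 := eta_ne_zero (A • τ)
  have h2 := autFactor_ne_zero A τ
  simp only [formTheta, map_smul, smul_eq_mul, theta_smul, Finset.prod_mul_distrib,
    Finset.prod_const]
  rw [← e_sum, ← Finset.sum_div, ← Finset.mul_sum, ← Finset.sum_div]
  have h3 : ∑ i ∈ posRoots b, β (realEmbed D B (P.root i)) z ^ 2 = β z z := by
    simp only [hD.form_eq_sum hβ z z, sq]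
  have h4 : eta (A • τ) ^ ((Module.finrank ℝ E : ℤ) - ((posRoots b).card : ℤ)) *
      ((eta (A • τ) / eta τ) ^ 3) ^ (posRoots b).card =
      (eta (A • τ) / eta τ) ^ ((Module.finrank ℝ E : ℤ) + 2 * ((posRoots b).card : ℤ)) *
        eta τ ^ ((Module.finrank ℝ E : ℤ) - ((posRoots b).card : ℤ)) := by
    rw [← pow_mul, ← zpow_natCast, div_zpow, div_zpow, ← mul_div_assoc, div_mul_eq_mul_div,
      div_eq_div_iff (zpow_ne_zero _ h0) (zpow_ne_zero _ h0), ← zpow_add₀ h1, mul_assoc,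
      ← zpow_add₀ h0]
    congr 2 <;> push_cast <;> ring
  rw [h3, inv_pow, ← zpow_natCast (autFactor A τ), ← zpow_neg]
  linear_combination e ((A 1 0 : ℂ) * (β z z / 2) / autFactor A τ) *
    autFactor A τ ^ (-((posRoots b).card : ℤ)) *
    (∏ i ∈ posRoots b, theta τ (β (realEmbed D B (P.root i)) z)) * h4

/-- The signs (−1)^{m+n} are rewritten as e((m+n)²/2), so that they too add up, to e(β(x+y)),
through `form_eq_sum`. -/
lemma formTheta_add (hD : IsCanonicalForm b D)
    (hβ : ∀ x y, β (realEmbed D B x) (realEmbed D B y) = (D x y : ℂ)) {x y : E}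
    (hx : ∀ i, ∃ m : ℤ, D x (P.root i) = m) (hy : ∀ i, ∃ m : ℤ, D y (P.root i) = m)
    (τ : UpperHalfPlane) (z : V) :
    formTheta b D B β τ (z + (τ : ℂ) • realEmbed D B x + realEmbed D B y) =
      e (β (realEmbed D B x + realEmbed D B y) (realEmbed D B x + realEmbed D B y) / 2) *
        e (-(τ : ℂ) * (β (realEmbed D B x) (realEmbed D B x) / 2) - β (realEmbed D B x) z) *
          formTheta b D B β τ z := by
  choose m hm using hx
  choose n hn using hy
  have hβm : ∀ i, β (realEmbed D B (P.root i)) (realEmbed D B x) = m i := fun i => by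
    rw [hβ, hD.symm, hm]; simp
  have hβn : ∀ i, β (realEmbed D B (P.root i)) (realEmbed D B y) = n i := fun i => by
    rw [hβ, hD.symm, hn]; simp
  have h1 : ∀ i, theta τ (β (realEmbed D B (P.root i))
      (z + (τ : ℂ) • realEmbed D B x + realEmbed D B y)) =
      e (((m i : ℂ) + n i) * (m i + n i) / 2) *
        e (-(τ * ((m i : ℂ) * m i / 2)) - m i * β (realEmbed D B (P.root i)) z) *
          theta τ (β (realEmbed D B (P.root i)) z) := by
    intro i
    have h2 : (-1 : ℂ) ^ (m i + n i) = e (((m i : ℂ) + n i) * (m i + n i) / 2) := by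
      have := e_half_intCast ((m i + n i) * (m i + n i))
      push_cast at this
      rw [this]
      rcases Int.even_or_odd (m i + n i) with h | h
      · rw [h.neg_one_zpow, (h.mul_left _).neg_one_zpow]
      · rw [h.neg_one_zpow, (h.mul h).neg_one_zpow]
    rw [map_add, map_add, map_smul, hβm, hβn, smul_eq_mul, mul_comm (τ : ℂ), theta_add_lattice, h2,
      sq]
  simp only [formTheta, h1, Finset.prod_mul_distrib]
  rw [← e_sum, ← e_sum, ← Finset.sum_div, Finset.sum_sub_distrib, Finset.sum_neg_distrib,
    ← Finset.mul_sum, ← Finset.sum_div, hD.form_eq_sum hβ (realEmbed D B x + realEmbed D B y),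
    hD.form_eq_sum hβ (realEmbed D B x), hD.form_eq_sum hβ (realEmbed D B x) z]
  simp only [map_add, hβm, hβn, neg_mul]
  ring

lemma differentiableOn_formTheta (k : ℕ) (u : (Fin k → ℂ) →ₗ[ℂ] V) :
    DifferentiableOn ℂ (fun p : ℂ × (Fin k → ℂ) => formTheta b D B β (ofComplex p.1) (u p.2))
      {p | 0 < p.1.im} := by
  let l : ι → (Fin k → ℂ) →L[ℂ] ℂ := fun i =>
    LinearMap.toContinuousLinearMap ((β (realEmbed D B (P.root i))).comp u)
  refine DifferentiableOn.congr (f := fun p : ℂ × (Fin k → ℂ) =>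
    ModularForm.eta p.1 ^ ((Module.finrank ℝ E : ℤ) - ((posRoots b).card : ℤ)) *
      ∏ i ∈ posRoots b, thetaDer 0 p.1 (l i p.2)) (fun p hp =>
    (differentiableAt_eta_mul_prod_theta (posRoots b) l _ hp).differentiableWithinAt) ?_
  intro p hp
  simp only [formTheta, eta, theta_eq_thetaDer]
  rw [UpperHalfPlane.ofComplex_apply_of_im_pos hp]
  rfl

-- In the expansion `hasSum_formTheta` the coefficients are constants, so each x yields one term,
-- with n = β(x). The condition n ≥ β(r) thus holds with equality.
open Classical in
lemma exists_fourier_formTheta (hD : IsCanonicalForm b D)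
    (hβ : ∀ x y, β (realEmbed D B x) (realEmbed D B y) = (D x y : ℂ)) {h : ℤ}
    (hh : h = (Module.finrank ℝ E : ℤ) + 2 * ((posRoots b).card : ℤ)) :
    ∃ c : ℤ → V → ℂ, ∀ (τ : UpperHalfPlane) (z : V),
    HasSum
      (fun p : {p : ℤ × V //
          p.2 ∈ shadow (AddSubgroup.closure (Set.range B)) β ∧
            (β p.2 p.2).re / 2 ≤ (h : ℝ) / 24 + (p.1 : ℝ)} =>
        c p.1.1 p.1.2 * e (((h : ℂ) / 24 + (p.1.1 : ℂ)) * (τ : ℂ)) * e (β p.1.2 z))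
      (formTheta b D B β τ z) := by
  have hinj := hD.realEmbed_injective hβ
  have hj : ∀ x : {x // macdonaldCoeff b D x ≠ 0}, ∃ j : ℤ, D x.1 x.1 / 2 = (h : ℝ) / 24 + j := by
    intro x
    rw [hh]
    push_cast
    exact hD.exists_apply_self_div_two x.2
  choose j hj using hj
  let g : {x // macdonaldCoeff b D x ≠ 0} → {p : ℤ × V //
      p.2 ∈ shadow (AddSubgroup.closure (Set.range B)) β ∧
        (β p.2 p.2).re / 2 ≤ (h : ℝ) / 24 + (p.1 : ℝ)} := fun x =>
    ⟨(j x, realEmbed D B x), hD.realEmbed_mem_shadow hβ x.2, by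
      simp only [hβ, Complex.ofReal_re]; exact (hj x).le⟩
  have hg : Function.Injective g := fun x y hxy => by
    have h1 := congrArg (fun p => p.1.2) hxy
    exact Subtype.ext (hinj h1)
  let c : ℤ → V → ℂ := fun k v =>
    if hv : ∃ x, (g x).1 = (k, v) then macdonaldCoeff b D hv.choose.1 else 0
  have hc : ∀ x, c (g x).1.1 (g x).1.2 = macdonaldCoeff b D x.1 := by
    intro x
    have hv : ∃ y, (g y).1 = ((g x).1.1, (g x).1.2) := ⟨x, rfl⟩
    simp only [c]
    rw [dif_pos hv]
    rw [hg (Subtype.ext hv.choose_spec)]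
  refine ⟨c, fun τ z => ?_⟩
  rw [← hg.hasSum_iff]
  · have h1 := hD.hasSum_formTheta (B := B) (β := β) τ z
    rw [← hasSum_subtype_iff_of_support_subset (s := {x | macdonaldCoeff b D x ≠ 0})] at h1
    · refine h1.congr_fun fun x => ?_
      simp only [Function.comp_apply]
      rw [hc, mul_assoc]
      congr 2
      rw [hj x]
      push_cast
      congr 1
      ring
    · intro x hx
      exact left_ne_zero_of_mul hx
  · intro p hp
    have : ¬ ∃ x, (g x).1 = (p.1.1, p.1.2) := fun ⟨x, hx⟩ => hp ⟨x, Subtype.ext hx⟩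
    simp only [c]
    rw [dif_neg this, zero_mul, zero_mul]

/-- The theta function of a root system is a Jacobi form. -/
theorem isJacobiForm_formTheta (hD : IsCanonicalForm b D)
    (hβ : ∀ x y, β (realEmbed D B x) (realEmbed D B y) = (D x y : ℂ)) :
    IsJacobiForm (AddSubgroup.closure (Set.range B)) β ((Module.finrank ℝ E : ℚ) / 2)
      ((Module.finrank ℝ E : ℤ) + 2 * ((posRoots b).card : ℤ)) (formTheta b D B β) where
  lattice := hD.form_isIntegralLattice hβ
  holomorphic := differentiableOn_formTheta
  modular := ⟨-((posRoots b).card : ℤ), by push_cast; ring, hD.formTheta_smul hβ⟩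
  elliptic := by
    intro x hx y hy τ z
    obtain ⟨x, hx', rfl⟩ := (hD.mem_closure_range_iff B).1 hx
    obtain ⟨y, hy', rfl⟩ := (hD.mem_closure_range_iff B).1 hy
    exact hD.formTheta_add hβ hx' hy' τ z
  fourier := hD.exists_fourier_formTheta hβ rfl

end IsCanonicalForm

end Root

end ThetaBlocks
end

/-! ### Restriction to the line through a lattice vector -/

noncomputable section

set_option linter.unusedSectionVars false

namespace ThetaBlocks

section Pullback

variable {V : Type*} [AddCommGroup V] [Module ℂ V]

lemma isIntegralLattice_scalar {m : ℝ} (hm : 0 < m) {N : ℤ} (hN : (N : ℂ) = 2 * m) :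
    IsIntegralLattice (Int.castAddHom ℂ).range ((2 * (m : ℂ)) • LinearMap.mul ℂ ℂ) where
  exists_basis := by
    refine ⟨1, Module.Basis.singleton (Fin 1) ℂ, ?_⟩
    have h : Set.range (Module.Basis.singleton (Fin 1) ℂ) = {1} := by
      ext z; simp
    rw [h]
    ext z
    rw [AddSubgroup.mem_closure_singleton]
    simp only [AddMonoidHom.mem_range, Int.coe_castAddHom, zsmul_one]
  symm x y := by simp [mul_comm]
  nondegenerate x h := by
    have h1 := h 1
    simpa [hm.ne'] using h1
  integral := by
    rintro _ ⟨x, rfl⟩ _ ⟨y, rfl⟩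
    exact ⟨N * (x * y), by simp [hN]⟩

/-- The number β(r,x)/(2m) is the coordinate of the orthogonal projection of r to the line of x;
testing the shadow condition of r on multiples of x gives the scalar one. -/
lemma mem_shadow_scalar {L : AddSubgroup V} {β : LinearMap.BilinForm ℂ V}
    (hL : IsIntegralLattice L β) {x : V} (hx : x ∈ L) {m : ℝ} (hm : 0 < m)
    (hxm : β x x = 2 * m) {r : V} (hr : r ∈ shadow L β) :
    β r x / (2 * m) ∈ shadow (Int.castAddHom ℂ).range ((2 * (m : ℂ)) • LinearMap.mul ℂ ℂ) := by
  have hm0 : (m : ℂ) ≠ 0 := by simp [hm.ne']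
  obtain ⟨N, hN⟩ := hL.integral x hx x hx
  obtain ⟨⟨q, hq, hqr⟩, hr⟩ := hr
  constructor
  · obtain ⟨k, hk⟩ := hL.integral _ hqr x hx
    have hN2 : (N : ℝ) = 2 * m := by exact_mod_cast hN.symm.trans hxm
    have hN0 : 0 < N := by
      have : (0 : ℝ) < N := by rw [hN2]; linarith
      exact_mod_cast this
    refine ⟨q * N.toNat, Nat.mul_pos hq (by omega), k, ?_⟩
    have h1 : ((N.toNat : ℕ) : ℂ) = 2 * m := by
      rw [← Int.cast_natCast, Int.toNat_of_nonneg hN0.le, ← hN, hxm]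
    rw [map_nsmul, LinearMap.smul_apply, nsmul_eq_mul] at hk
    rw [nsmul_eq_mul, Nat.cast_mul, h1]
    simp only [Int.coe_castAddHom]
    rw [← hk]
    field_simp
  · rintro _ ⟨a, rfl⟩
    obtain ⟨k, hk⟩ := hr (a • x) (L.zsmul_mem hx a)
    refine ⟨k, ?_⟩
    rw [← hk, ← Int.cast_smul_eq_zsmul ℂ]
    simp only [map_smul, LinearMap.smul_apply, smul_eq_mul, hxm, LinearMap.mul_apply',
      Int.coe_castAddHom]
    field_simp

/-- The restriction of a Jacobi form of lattice index to the line spanned by a lattice vector. -/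
theorem IsJacobiForm.isScalarJacobiForm {L : AddSubgroup V} {β : LinearMap.BilinForm ℂ V} {k : ℚ}
    {h : ℤ} {φ : UpperHalfPlane → V → ℂ} (hφ : IsJacobiForm L β k h φ) {x : V} (hx : x ∈ L)
    {m : ℝ} (hm : 0 < m) (hxm : β x x = 2 * m)
    (hCS : ∀ r ∈ shadow L β, ∃ t : ℝ, β r x = t ∧ t ^ 2 ≤ (β r r).re * (2 * m)) :
    IsScalarJacobiForm k m h (fun τ u => φ τ (u • x)) where
  lattice := by
    obtain ⟨N, hN⟩ := hφ.lattice.integral x hx x hx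
    exact isIntegralLattice_scalar hm (N := N) (hN.symm.trans hxm)
  holomorphic n u := hφ.holomorphic n ((LinearMap.toSpanSingleton ℂ V x).comp u)
  modular := by
    obtain ⟨l, hl, H⟩ := hφ.modular
    refine ⟨l, hl, fun A τ z => ?_⟩
    have h1 := H A τ (z • x)
    rw [smul_smul] at h1
    rw [smul_eq_mul, h1]
    simp only [map_smul, LinearMap.smul_apply, smul_eq_mul, hxm, LinearMap.mul_apply']
    ring_nf
  elliptic := by
    rintro _ ⟨a, rfl⟩ _ ⟨c, rfl⟩ τ z
    have h1 := hφ.elliptic (a • x) (L.zsmul_mem hx a) (c • x) (L.zsmul_mem hx c) τ (z • x)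
    rw [← Int.cast_smul_eq_zsmul ℂ, ← Int.cast_smul_eq_zsmul ℂ, smul_smul, ← add_smul, ← add_smul,
      ← add_smul] at h1
    simp only [Int.coe_castAddHom, smul_eq_mul]
    rw [h1]
    simp only [map_smul, LinearMap.smul_apply, smul_eq_mul, hxm, LinearMap.mul_apply']
    ring_nf
  fourier := by
    classical
    have hm0 : (m : ℂ) ≠ 0 := by simp [hm.ne']
    obtain ⟨c, hc⟩ := hφ.fourier
    let f : {p : ℤ × V // p.2 ∈ shadow L β ∧ (β p.2 p.2).re / 2 ≤ (h : ℝ) / 24 + (p.1 : ℝ)} →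
        {p : ℤ × ℂ // p.2 ∈ shadow (Int.castAddHom ℂ).range ((2 * (m : ℂ)) • LinearMap.mul ℂ ℂ) ∧
          (((2 * (m : ℂ)) • LinearMap.mul ℂ ℂ : LinearMap.BilinForm ℂ ℂ) p.2 p.2).re / 2 ≤
            (h : ℝ) / 24 + (p.1 : ℝ)} :=
      fun p => ⟨(p.1.1, β p.1.2 x / (2 * m)), mem_shadow_scalar hφ.lattice hx hm hxm p.2.1, by
        refine le_trans ?_ p.2.2
        obtain ⟨t, ht, hle⟩ := hCS p.1.2 p.2.1
        have h1 : (((2 * (m : ℂ)) • LinearMap.mul ℂ ℂ : LinearMap.BilinForm ℂ ℂ)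
            (β p.1.2 x / (2 * m)) (β p.1.2 x / (2 * m))) = ((t ^ 2 / (2 * m) : ℝ) : ℂ) := by
          simp only [LinearMap.smul_apply, LinearMap.mul_apply', smul_eq_mul, ht]
          push_cast
          field_simp
        simp only
        rw [h1, Complex.ofReal_re]
        -- Projection does not increase the norm, by the Cauchy–Schwarz hypothesis, so n ≥ β(r)
        -- survives the restriction.
        have h2 : t ^ 2 / (2 * m) ≤ (β p.1.2 p.1.2).re := by
          rw [div_le_iff₀ (by linarith)]; exact hle
        linarith⟩
    -- Several shadow vectors may have the same projection, so the new coefficients are sums over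
    -- the fibres.
    refine ⟨fun j s => ∑' p, if (f p).1 = (j, s) then c p.1.1 p.1.2 else 0, fun τ u => ?_⟩
    have h1 := hasSum_fiberwise f (hc τ (u • x))
    refine h1.congr_fun fun y => ?_
    rw [← tsum_mul_right, ← tsum_mul_right]
    refine tsum_congr fun p => ?_
    by_cases hp : f p = y
    · rw [if_pos (by rw [hp]), if_pos hp, ← hp]
      congr 2
      simp only [f, map_smul, LinearMap.smul_apply, LinearMap.mul_apply', smul_eq_mul]
      field_simp
    · rw [if_neg hp, if_neg fun h' => hp (Subtype.ext h'), zero_mul, zero_mul]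

end Pullback

section Root

variable {ι E M : Type*} [Fintype ι] [NormedAddCommGroup E] [InnerProductSpace ℝ E]
  [AddCommGroup M] [Module ℝ M] {P : RootPairing ι ℝ E M} {b : P.Base}
  {V : Type*} [AddCommGroup V] [Module ℂ V] {D : LinearMap.BilinForm ℝ E}
  {B : Module.Basis b.support ℂ V} {β : LinearMap.BilinForm ℂ V}
  [P.IsRootSystem] [P.IsCrystallographic] [P.IsReduced]

/-- A shadow vector has a multiple in the lattice, hence comes from a real vector of E, where
Cauchy–Schwarz for the positive definite `D` applies. -/
lemma IsCanonicalForm.isScalarJacobiForm (hD : IsCanonicalForm b D)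
    (hβ : ∀ x y, β (realEmbed D B x) (realEmbed D B y) = (D x y : ℂ)) {k : ℚ} {h : ℤ}
    {φ : UpperHalfPlane → V → ℂ}
    (hφ : IsJacobiForm (AddSubgroup.closure (Set.range B)) β k h φ) {v : V}
    (hv : v ∈ AddSubgroup.closure (Set.range B)) (hv0 : v ≠ 0) {m : ℝ} (hvm : β v v = 2 * m) :
    IsScalarJacobiForm k m h (fun τ u => φ τ (u • v)) := by
  have hvL := hv
  obtain ⟨x, hx, rfl⟩ := (hD.mem_closure_range_iff B).1 hv
  have hx0 : x ≠ 0 := fun h => hv0 (by rw [h, map_zero])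
  rw [hβ] at hvm
  have hDm : D x x = 2 * m := by exact_mod_cast hvm
  have hm : 0 < m := by
    have := hD.pos x hx0
    linarith
  refine hφ.isScalarJacobiForm hvL hm (by rw [hβ, hvm]) fun r hr => ?_
  obtain ⟨⟨q, hq, hqr⟩, -⟩ := hr
  obtain ⟨y, -, hy⟩ := (hD.mem_closure_range_iff B).1 hqr
  have hq0 : (q : ℝ) ≠ 0 := by exact_mod_cast hq.ne'
  have hr : r = realEmbed D B ((q : ℝ)⁻¹ • y) := by
    rw [realEmbed_smul, hy, ← Nat.cast_smul_eq_nsmul ℂ, smul_smul]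
    push_cast
    rw [inv_mul_cancel₀ (by exact_mod_cast hq.ne'), one_smul]
  refine ⟨D ((q : ℝ)⁻¹ • y) x, by rw [hr, hβ], ?_⟩
  rw [hr, hβ, Complex.ofReal_re, ← hDm]
  have hnn : ∀ z, 0 ≤ D z z := fun z => by
    by_cases hz : z = 0
    · simp [hz]
    · exact (hD.pos z hz).le
  have := LinearMap.BilinForm.apply_mul_apply_le_of_forall_zero_le D hnn ((q : ℝ)⁻¹ • y) x
  rwa [hD.symm x, ← sq] at this

end Root

end ThetaBlocks
end

/-! ### The two models: coordinates on simple roots, and ℂ ⊗ E -/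

noncomputable section

set_option linter.unusedSectionVars false

namespace ThetaBlocks

open RootPairing

section Root

variable {ι E M : Type*} [Fintype ι] [NormedAddCommGroup E] [InnerProductSpace ℝ E]
  [AddCommGroup M] [Module ℝ M] {P : RootPairing ι ℝ E M} {b : P.Base}
  {D : LinearMap.BilinForm ℝ E} [P.IsRootSystem] [P.IsCrystallographic] [P.IsReduced]

lemma isThetaBlock_of_forall {φ : UpperHalfPlane → ℂ → ℂ} {I : Type*} (s : Finset I) (a : I → ℤ)
    (d : ℤ) (ha : ∀ i ∈ s, a i ≠ 0)
    (h : ∀ τ u, φ τ u = eta τ ^ d * ∏ i ∈ s, theta τ ((a i : ℂ) * u)) : IsThetaBlock φ := by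
  refine ⟨s.toList.map a, d, ?_, fun τ u => ?_⟩
  · simpa using ha
  · rw [h, mul_comm, ← Finset.prod_map_toList]
    simp only [List.bind_eq_flatMap, List.pure_def, ← List.map_eq_flatMap, List.map_map,
      Function.comp_def]

/-! ### The coordinate version -/

lemma rootForm_apply (i : ι) (z : b.support → ℂ) :
    rootForm b i z = ∑ f : b.support, (rootCoeff b i f : ℂ) * z f := by
  simp [rootForm]

lemma realEmbed_basisFun (x : E) (f : b.support) :
    realEmbed D (Pi.basisFun ℂ b.support) x f = D x (P.root f) := by
  classical
  simp [realEmbed_apply, Finset.sum_apply, Pi.single_apply]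

lemma rootForm_realEmbed (i : ι) (x : E) :
    rootForm b i (realEmbed D (Pi.basisFun ℂ b.support) x) = D x (P.root i) := by
  rw [rootForm_apply, apply_root_eq_sum (b := b)]
  simp only [realEmbed_basisFun]
  push_cast
  rfl

lemma starForm_apply (z w : b.support → ℂ) :
    starForm b z w = ∑ i ∈ posRoots b, rootForm b i z * rootForm b i w := by
  rw [starForm, LinearMap.BilinForm.sum_apply]
  rfl

lemma IsCanonicalForm.starForm_realEmbed (hD : IsCanonicalForm b D) (x y : E) :
    starForm b (realEmbed D (Pi.basisFun ℂ b.support) x)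
      (realEmbed D (Pi.basisFun ℂ b.support) y) = (D x y : ℂ) := by
  rw [starForm_apply, ← hD.apply_sum]
  simp only [rootForm_realEmbed]
  push_cast
  rfl

lemma IsCanonicalForm.starForm_root (hD : IsCanonicalForm b D) (i : ι) (z : b.support → ℂ) :
    starForm b (realEmbed D (Pi.basisFun ℂ b.support) (P.root i)) z = rootForm b i z := by
  classical
  obtain ⟨ω, hω⟩ := hD.exists_coweight
  have h : starForm b (realEmbed D (Pi.basisFun ℂ b.support) (P.root i)) = rootForm b i :=
    (Pi.basisFun ℂ b.support).ext fun f => by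
      rw [← IsCanonicalForm.realEmbed_coweight (Pi.basisFun ℂ b.support) hω, hD.starForm_realEmbed,
        rootForm_realEmbed, hD.symm]
  rw [h]

lemma intLattice_eq_closure (F : Type*) [Fintype F] :
    intLattice F = AddSubgroup.closure (Set.range (Pi.basisFun ℂ F)) := by
  classical
  apply le_antisymm
  · rintro _ ⟨a, rfl⟩
    rw [← (Pi.basisFun ℂ F).sum_repr (((Int.castAddHom ℂ).compLeft F) a)]
    refine AddSubgroup.sum_mem _ fun f _ => ?_
    have : (Pi.basisFun ℂ F).repr (((Int.castAddHom ℂ).compLeft F) a) f = (a f : ℂ) := rfl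
    rw [this, Int.cast_smul_eq_zsmul]
    exact AddSubgroup.zsmul_mem _ (AddSubgroup.subset_closure (Set.mem_range_self f)) _
  · rw [AddSubgroup.closure_le]
    rintro _ ⟨f, rfl⟩
    refine ⟨Pi.single f 1, ?_⟩
    ext f'
    by_cases h : f' = f
    · subst h; simp
    · simp [h]

lemma IsCanonicalForm.formTheta_eq_rootTheta (hD : IsCanonicalForm b D) :
    formTheta b D (Pi.basisFun ℂ b.support) (starForm b) = rootTheta b := by
  funext τ z
  simp only [formTheta, rootTheta, hD.starForm_root]

theorem IsCanonicalForm.isJacobiForm_rootTheta (hD : IsCanonicalForm b D) :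
    IsJacobiForm (intLattice b.support) (starForm b) ((Module.finrank ℝ E : ℚ) / 2)
      ((Module.finrank ℝ E : ℤ) + 2 * ((posRoots b).card : ℤ)) (rootTheta b) := by
  rw [intLattice_eq_closure, ← hD.formTheta_eq_rootTheta]
  exact hD.isJacobiForm_formTheta hD.starForm_realEmbed

lemma rootForm_intCast (i : ι) (a : b.support → ℤ) :
    rootForm b i (fun f => (a f : ℂ)) = ((∑ f : b.support, rootCoeff b i f * a f : ℤ) : ℂ) := by
  rw [rootForm_apply]
  push_cast
  rfl

theorem IsCanonicalForm.isScalarJacobiForm_rootTheta (hD : IsCanonicalForm b D)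
    {a : b.support → ℤ} (ha : a ≠ 0) :
    IsScalarJacobiForm ((Module.finrank ℝ E : ℚ) / 2)
      ((∑ r ∈ posRoots b, ((∑ f : b.support, rootCoeff b r f * a f : ℤ) : ℝ) ^ 2) / 2)
      ((Module.finrank ℝ E : ℤ) + 2 * ((posRoots b).card : ℤ))
      (fun τ u => rootTheta b τ (fun f => (a f : ℂ) * u)) := by
  have h1 := hD.isJacobiForm_rootTheta
  rw [intLattice_eq_closure] at h1
  have hmem : (fun f => (a f : ℂ)) ∈
      AddSubgroup.closure (Set.range (Pi.basisFun ℂ b.support)) := by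
    rw [← intLattice_eq_closure]
    exact ⟨a, rfl⟩
  have hne : (fun f => (a f : ℂ)) ≠ 0 := fun h => ha (by
    funext f
    have := congrFun h f
    simpa using this)
  have h2 := hD.isScalarJacobiForm hD.starForm_realEmbed h1 hmem hne
    (m := (∑ r ∈ posRoots b, ((∑ f : b.support, rootCoeff b r f * a f : ℤ) : ℝ) ^ 2) / 2) (by
      rw [starForm_apply]
      simp only [rootForm_intCast, ← sq]
      push_cast
      ring)
  have h3 : (fun (τ : UpperHalfPlane) (u : ℂ) => rootTheta b τ (fun f => (a f : ℂ) * u)) =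
      fun τ u => rootTheta b τ (u • fun f => (a f : ℂ)) := by
    funext τ u
    congr 1
    funext f
    exact mul_comm _ _
  rw [h3]
  exact h2

lemma isThetaBlock_rootTheta {a : b.support → ℤ}
    (ha : ∀ r ∈ posRoots b, ∑ f : b.support, rootCoeff b r f * a f ≠ 0) :
    IsThetaBlock (fun τ u => rootTheta b τ (fun f => (a f : ℂ) * u)) := by
  refine isThetaBlock_of_forall (posRoots b) (fun r => ∑ f : b.support, rootCoeff b r f * a f)
    ((Module.finrank ℝ E : ℤ) - ((posRoots b).card : ℤ)) ha fun τ u => ?_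
  rw [rootTheta]
  congr 1
  refine Finset.prod_congr rfl fun i _ => ?_
  rw [rootForm_apply]
  push_cast
  rw [Finset.sum_mul]
  congr 1
  exact Finset.sum_congr rfl fun f _ => (mul_assoc _ _ _).symm

/-! ### Irreducible root systems -/

variable (hD : IsCanonicalForm b ((hNumber b)⁻¹ • innerₗ E))

lemma scaledInner_apply (b : P.Base) (x y : E) :
    ((hNumber b)⁻¹ • innerₗ E : LinearMap.BilinForm ℝ E) x y = inner ℝ x y / hNumber b := by
  rw [LinearMap.smul_apply, LinearMap.smul_apply, innerₗ_apply_apply, smul_eq_mul, div_eq_inv_mul]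

lemma scaledForm_tmul (b : P.Base) (u v : ℂ) (x y : E) :
    scaledForm b (u ⊗ₜ[ℝ] x) (v ⊗ₜ[ℝ] y) = u * v * ((inner ℝ x y / hNumber b : ℝ) : ℂ) := by
  rw [scaledForm, LinearMap.BilinForm.baseChange_tmul, scaledInner_apply, Complex.real_smul]
  ring

lemma mem_latticeW_iff {x : E} :
    x ∈ latticeW b ↔ ∀ i, ∃ m : ℤ,
      ((hNumber b)⁻¹ • innerₗ E : LinearMap.BilinForm ℝ E) x (P.root i) = m := by
  simp only [scaledInner_apply]
  rfl

lemma mem_latticeWev_iff {x : E} :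
    x ∈ latticeWev b ↔ IsEvenVector P ((hNumber b)⁻¹ • innerₗ E) x := by
  have h : inner ℝ x x / (2 * hNumber b) =
      ((hNumber b)⁻¹ • innerₗ E : LinearMap.BilinForm ℝ E) x x / 2 := by
    rw [scaledInner_apply, div_div, mul_comm]
  rw [IsEvenVector, ← mem_latticeW_iff, ← h]
  rfl

include hD in
/-- The data of `formTheta` for the complexification of an irreducible root system. -/
lemma exists_realEmbed_eq_tmul : ∃ B : Module.Basis b.support ℂ (ℂ ⊗[ℝ] E),
    ∀ x, realEmbed ((hNumber b)⁻¹ • innerₗ E) B x = (1 : ℂ) ⊗ₜ[ℝ] x := by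
  classical
  obtain ⟨ω, hω⟩ := hD.exists_coweight
  refine ⟨ω.baseChange ℂ, fun x => ?_⟩
  conv_rhs => rw [← hD.sum_smul_coweight hω x]
  rw [realEmbed_apply, TensorProduct.tmul_sum]
  refine Finset.sum_congr rfl fun f _ => ?_
  rw [Module.Basis.baseChange_apply, TensorProduct.tmul_smul, TensorProduct.smul_tmul',
    TensorProduct.smul_tmul', Complex.real_smul, smul_eq_mul]

section Irreducible

variable {B : Module.Basis b.support ℂ (ℂ ⊗[ℝ] E)}
  (hB : ∀ x, realEmbed ((hNumber b)⁻¹ • innerₗ E) B x = (1 : ℂ) ⊗ₜ[ℝ] x)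
include hB

lemma scaledForm_realEmbed (x y : E) :
    scaledForm b (realEmbed ((hNumber b)⁻¹ • innerₗ E) B x)
      (realEmbed ((hNumber b)⁻¹ • innerₗ E) B y) =
      ((((hNumber b)⁻¹ • innerₗ E : LinearMap.BilinForm ℝ E) x y : ℝ) : ℂ) := by
  rw [hB, hB, scaledForm_tmul, scaledInner_apply, one_mul, one_mul]

lemma formTheta_eq_macdonaldTheta :
    formTheta b ((hNumber b)⁻¹ • innerₗ E) B (scaledForm b) = macdonaldTheta b := by
  funext τ z
  simp only [formTheta, macdonaldTheta, hB]

include hD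

lemma latticeWC_eq_closure : latticeWC b = AddSubgroup.closure (Set.range B) := by
  ext v
  rw [hD.mem_closure_range_iff B]
  simp only [hB, ← mem_latticeW_iff]
  rfl

theorem isJacobiForm_macdonaldTheta :
    IsJacobiForm (latticeWC b) (scaledForm b) ((Module.finrank ℝ E : ℚ) / 2)
      ((Module.finrank ℝ E : ℤ) + 2 * ((posRoots b).card : ℤ)) (macdonaldTheta b) := by
  rw [latticeWC_eq_closure hD hB, ← formTheta_eq_macdonaldTheta hB]
  exact hD.isJacobiForm_formTheta (scaledForm_realEmbed hB)

theorem isScalarJacobiForm_macdonaldTheta {x : E} (hx : x ∈ latticeW b) (hx0 : x ≠ 0) :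
    IsScalarJacobiForm ((Module.finrank ℝ E : ℚ) / 2) (inner ℝ x x / (2 * hNumber b))
      ((Module.finrank ℝ E : ℤ) + 2 * ((posRoots b).card : ℤ))
      (fun τ u => macdonaldTheta b τ (u ⊗ₜ[ℝ] x)) := by
  have h1 := isJacobiForm_macdonaldTheta hD hB
  rw [latticeWC_eq_closure hD hB] at h1
  have hmem : (1 : ℂ) ⊗ₜ[ℝ] x ∈ AddSubgroup.closure (Set.range B) := by
    rw [← latticeWC_eq_closure hD hB]
    exact ⟨x, hx, rfl⟩
  have hne : (1 : ℂ) ⊗ₜ[ℝ] x ≠ 0 := by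
    rw [← hB, ← map_zero (realEmbed ((hNumber b)⁻¹ • innerₗ E) B)]
    exact (hD.realEmbed_injective (scaledForm_realEmbed hB)).ne hx0
  have h2 := hD.isScalarJacobiForm (scaledForm_realEmbed hB) h1 hmem hne
    (m := inner ℝ x x / (2 * hNumber b)) (by
      rw [scaledForm_tmul, one_mul, one_mul, mul_comm 2 (hNumber b), ← div_div]
      push_cast
      ring)
  simpa only [TensorProduct.smul_tmul', smul_eq_mul, mul_one] using h2

end Irreducible

lemma isThetaBlock_macdonaldTheta (hpos : 0 < hNumber b) {x : E} (hx : x ∈ latticeW b)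
    (h : ∀ r : ι, inner ℝ (P.root r) x ≠ 0) :
    IsThetaBlock (fun τ u => macdonaldTheta b τ (u ⊗ₜ[ℝ] x)) := by
  choose m hm using hx
  refine isThetaBlock_of_forall (posRoots b) m
    ((Module.finrank ℝ E : ℤ) - ((posRoots b).card : ℤ)) (fun i _ hi => ?_) fun τ u => ?_
  · have h1 := hm i
    rw [hi, Int.cast_zero, div_eq_zero_iff, real_inner_comm] at h1
    exact h1.elim (h i) hpos.ne'
  · rw [macdonaldTheta]
    congr 1
    refine Finset.prod_congr rfl fun i _ => ?_
    rw [scaledForm_tmul, real_inner_comm, hm]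
    congr 1
    push_cast
    ring

end Root

end ThetaBlocks
end

/-! ### The Macdonald identities -/

noncomputable section

set_option linter.unusedSectionVars false

namespace ThetaBlocks

open RootPairing

section Root

variable {ι E M : Type*} [Fintype ι] [NormedAddCommGroup E] [InnerProductSpace ℝ E]
  [AddCommGroup M] [Module ℝ M] {P : RootPairing ι ℝ E M} {b : P.Base}
  [P.IsRootSystem] [P.IsCrystallographic] [P.IsReduced] {D : LinearMap.BilinForm ℝ E}

namespace IsCanonicalForm

/-- The number of Weyl group elements moving a point of the support of the coefficients into the
coset of the Weyl vector. -/
lemma card_smul_sub_isEvenVector (hD : IsCanonicalForm b D) {x : E}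
    (hx : macdonaldCoeff b D x ≠ 0) :
    Nat.card {g : P.weylGroup // IsEvenVector P D (g⁻¹ • x - weylVector b)} =
      Nat.card {g : P.weylGroup // IsEvenVector P D (g • weylVector b - weylVector b)} := by
  obtain ⟨g₀, y, hy, h⟩ := hD.exists_smul_add_eq_of_ne_zero hx
  have hx2 : x = g₀⁻¹ • (weylVector b - y) := by
    rw [← h, add_sub_cancel_right, inv_smul_smul]
  refine Nat.card_congr (Equiv.subtypeEquiv ((Equiv.inv _).trans (Equiv.mulRight g₀⁻¹)) fun g => ?_)
  change _ ↔ IsEvenVector P D ((g⁻¹ * g₀⁻¹) • weylVector b - weylVector b)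
  have h1 : g⁻¹ • x - weylVector b =
      ((g⁻¹ * g₀⁻¹) • weylVector b - weylVector b) + -((g⁻¹ * g₀⁻¹) • y) := by
    rw [hx2, smul_smul, smul_sub]
    abel
  have h2 : IsEvenVector P D ((g⁻¹ * g₀⁻¹) • y) := hD.isEvenVector_smul _ hy
  rw [h1]
  refine ⟨fun h3 => ?_, fun h3 => hD.isEvenVector_add h3 (isEvenVector_neg h2)⟩
  have h4 := hD.isEvenVector_add h3 h2
  rwa [neg_add_cancel_right] at h4

open Classical in
/-- Regrouping of the theta decomposition along the orbits of the Weyl group. -/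
lemma hasSum_coset (hD : IsCanonicalForm b D) {F : E → ℂ} {a : ℂ} (hF : HasSum F a)
    (hsupp : ∀ x, F x ≠ 0 → macdonaldCoeff b D x ≠ 0) :
    HasSum (fun x : {x // IsEvenVector P D (x - weylVector b)} =>
      ∑ g : P.weylGroup, F (g • x.1))
      (Nat.card {g : P.weylGroup // IsEvenVector P D (g • weylVector b - weylVector b)} * a) := by
  set C : Set E := {x | IsEvenVector P D (x - weylVector b)} with hC
  set K := Nat.card {g : P.weylGroup // IsEvenVector P D (g • weylVector b - weylVector b)} with hK
  have h1 : ∀ g : P.weylGroup, Summable fun x => if g⁻¹ • x ∈ C then F x else 0 := fun g => by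
    refine (hF.summable.indicator {x | g⁻¹ • x ∈ C}).congr fun x => ?_
    simp [Set.indicator_apply]
  have h2 := hasSum_sum (s := Finset.univ) fun g (_ : g ∈ Finset.univ) => (h1 g).hasSum
  -- Each x with F(x) ≠ 0 lies in gC for exactly K elements g, so summing over all translates gC
  -- counts the whole series K times.
  have h3 : HasSum (fun x => ∑ g : P.weylGroup, if g⁻¹ • x ∈ C then F x else 0) (K * a) := by
    refine (hF.mul_left (K : ℂ)).congr_fun fun x => ?_
    by_cases hx : F x = 0
    · simp [hx]
    · rw [← Finset.sum_filter, Finset.sum_const, nsmul_eq_mul, hK,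
        ← hD.card_smul_sub_isEvenVector (hsupp x hx), Nat.card_eq_fintype_card,
        Fintype.card_subtype]
      rfl
  have h4 : ∀ g : P.weylGroup, HasSum (fun x => if x ∈ C then F (g • x) else 0)
      (∑' x, if g⁻¹ • x ∈ C then F x else 0) := fun g => by
    have h5 := ((MulAction.toPerm g : Equiv.Perm E).hasSum_iff).2 (h1 g).hasSum
    refine h5.congr_fun fun x => ?_
    simp
  have h6 := hasSum_sum (s := Finset.univ) fun g (_ : g ∈ Finset.univ) => h4 g
  rw [h2.unique h3] at h6
  have h7 := (hasSum_subtype_iff_indicator (s := C) (f := fun x => ∑ g : P.weylGroup, F (g • x))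
    (a := K * a)).2 ?_
  · exact h7
  · refine h6.congr_fun fun x => ?_
    by_cases hx : x ∈ C <;> simp [hx]

end IsCanonicalForm

/-- The Macdonald identities. -/
theorem hasSum_macdonaldTheta (hD : IsCanonicalForm b ((hNumber b)⁻¹ • innerₗ E))
    {B : Module.Basis b.support ℂ (ℂ ⊗[ℝ] E)}
    (hB : ∀ x, realEmbed ((hNumber b)⁻¹ • innerₗ E) B x = (1 : ℂ) ⊗ₜ[ℝ] x)
    (τ : UpperHalfPlane) (z : ℂ ⊗[ℝ] E) :
    HasSum
      (fun x : {x : E // ∃ y ∈ latticeWev b, x = weylVector b + y} =>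
        (Nat.card (weylStabilizer b) : ℂ)⁻¹ *
          (e ((τ : ℂ) * ((inner ℝ x.1 x.1 / (2 * hNumber b) : ℝ) : ℂ)) *
            ∑ g : P.weylGroup,
              (-1 : ℂ) ^ weylLength b g * e (scaledForm b ((1 : ℂ) ⊗ₜ[ℝ] (g • x.1)) z)))
      (macdonaldTheta b τ z) := by
  have h1 := hD.hasSum_formTheta (B := B) (β := scaledForm b) τ z
  rw [formTheta_eq_macdonaldTheta hB] at h1
  have h2 := hD.hasSum_coset h1 fun x hx => left_ne_zero_of_mul hx
  have hstab : weylStabilizer b = {g : P.weylGroup | IsEvenVector P ((hNumber b)⁻¹ • innerₗ E)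
      (g • weylVector b - weylVector b)} := by
    ext g
    exact mem_latticeWev_iff
  have hcard : (Nat.card (weylStabilizer b) : ℂ) ≠ 0 := by
    have : Nonempty (weylStabilizer b) := ⟨1, by
      rw [hstab]
      change IsEvenVector P _ ((1 : P.weylGroup) • weylVector b - weylVector b)
      rw [one_smul, sub_self]
      exact IsCanonicalForm.isEvenVector_zero⟩
    exact_mod_cast Nat.card_pos.ne'
  have h3 := h2.mul_left (Nat.card (weylStabilizer b) : ℂ)⁻¹
  rw [← mul_assoc, hstab] at h3
  rw [hstab] at hcard ⊢
  rw [show Nat.card {g : P.weylGroup // IsEvenVector P ((hNumber b)⁻¹ • innerₗ E)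
      (g • weylVector b - weylVector b)} = Nat.card ↑{g : P.weylGroup | IsEvenVector P
      ((hNumber b)⁻¹ • innerₗ E) (g • weylVector b - weylVector b)} from rfl,
    inv_mul_cancel₀ hcard, one_mul] at h3
  let ψ : {x : E // ∃ y ∈ latticeWev b, x = weylVector b + y} ≃
      {x // IsEvenVector P ((hNumber b)⁻¹ • innerₗ E) (x - weylVector b)} :=
    Equiv.subtypeEquivRight fun x => by
      rw [← mem_latticeWev_iff]
      constructor
      · rintro ⟨y, hy, rfl⟩
        rwa [add_sub_cancel_left]
      · exact fun h => ⟨_, h, (add_sub_cancel _ _).symm⟩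
  rw [← ψ.hasSum_iff] at h3
  refine h3.congr_fun fun x => ?_
  obtain ⟨x, y, hy, rfl⟩ := x
  have hy' := mem_latticeWev_iff.1 hy
  simp only [Function.comp_apply]
  rw [show (ψ ⟨weylVector b + y, y, hy, rfl⟩ : E) = weylVector b + y from rfl]
  congr 1
  rw [Finset.mul_sum]
  refine Finset.sum_congr rfl fun g _ => ?_
  -- The coefficient at g(ρ+y) is (−1)^{ℓ(g)} times the one at ρ, which is 1.
  rw [hD.macdonaldCoeff_smul, hD.macdonaldCoeff_add hy', hD.macdonaldCoeff_weylVector, hD.weyl, hB,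
    scaledInner_apply, div_div, mul_comm (hNumber b), mul_one]
  ring

end Root

end ThetaBlocks
end

theorem mainTheorem2 {ι E M : Type*} [Fintype ι] [NormedAddCommGroup E] [InnerProductSpace ℝ E]
    [AddCommGroup M] [Module ℝ M]
    (P : RootPairing ι ℝ E M) [P.IsRootSystem] [P.IsCrystallographic] [P.IsReduced]
    (hP : ∀ (i : ι) (x y : E), inner ℝ (P.reflection i x) (P.reflection i y) = inner ℝ x y)
    (b : P.Base) (n N : ℕ) (hn : n = Module.finrank ℝ E) (hN : N = (posRoots b).card) :
    -- the Macdonald identity, for irreducible root systems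
    (P.IsIrreducible →
      (∀ (τ : UpperHalfPlane) (z : ℂ ⊗[ℝ] E),
        HasSum
          (fun x : {x : E // ∃ y ∈ latticeWev b, x = weylVector b + y} =>
            (Nat.card (weylStabilizer b) : ℂ)⁻¹ *
              (e ((τ : ℂ) * ((inner ℝ x.1 x.1 / (2 * hNumber b) : ℝ) : ℂ)) *
                ∑ g : P.weylGroup,
                  (-1 : ℂ) ^ weylLength b g * e (scaledForm b ((1 : ℂ) ⊗ₜ[ℝ] (g • x.1)) z)))
          (macdonaldTheta b τ z)) ∧
      IsJacobiForm (latticeWC b) (scaledForm b) ((n : ℚ) / 2) ((n : ℤ) + 2 * (N : ℤ))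
        (macdonaldTheta b) ∧
      ∀ x ∈ latticeW b, x ≠ 0 →
        IsScalarJacobiForm ((n : ℚ) / 2) (inner ℝ x x / (2 * hNumber b)) ((n : ℤ) + 2 * (N : ℤ))
          (fun τ u => macdonaldTheta b τ (u ⊗ₜ[ℝ] x)) ∧
        ((∀ r : ι, inner ℝ (P.root r) x ≠ 0) →
          IsThetaBlock (fun τ u => macdonaldTheta b τ (u ⊗ₜ[ℝ] x)))) ∧
    -- the coordinate version, for arbitrary root systems
    IsJacobiForm (intLattice b.support) (starForm b) ((n : ℚ) / 2) ((n : ℤ) + 2 * (N : ℤ))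
      (rootTheta b) ∧
    ∀ a : b.support → ℤ, a ≠ 0 →
      IsScalarJacobiForm ((n : ℚ) / 2)
        ((∑ r ∈ posRoots b, ((∑ f : b.support, rootCoeff b r f * a f : ℤ) : ℝ) ^ 2) / 2)
        ((n : ℤ) + 2 * (N : ℤ))
        (fun τ u => rootTheta b τ (fun f => (a f : ℂ) * u)) ∧
      ((∀ r ∈ posRoots b, ∑ f : b.support, rootCoeff b r f * a f ≠ 0) →
        IsThetaBlock (fun τ u => rootTheta b τ (fun f => (a f : ℂ) * u))) := by
  subst hn hN
  refine ⟨fun hirr => ?_, ?_⟩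
  · obtain ⟨hpos, hD⟩ := isCanonicalForm_inner b hP
    obtain ⟨B, hB⟩ := exists_realEmbed_eq_tmul hD
    exact ⟨hasSum_macdonaldTheta hD hB, isJacobiForm_macdonaldTheta hD hB, fun x hx hx0 =>
      ⟨isScalarJacobiForm_macdonaldTheta hD hB hx hx0, isThetaBlock_macdonaldTheta hpos hx⟩⟩
  · obtain ⟨D, hD⟩ := exists_isCanonicalForm b hP
    exact ⟨hD.isJacobiForm_rootTheta, fun a ha =>
      ⟨hD.isScalarJacobiForm_rootTheta ha, isThetaBlock_rootTheta⟩⟩
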